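/- Let $G$ be a finite cubic (that is, $3$-regular) graph, in which parallel edges and loops are allowed, and suppose that $G$ is cyclically $7$-edge-connected, i.e. there is no edge-cut of $G$ with fewer than $7$ edges that separates two subgraphs of $G$ both containing a circuit. Let $v$ be a vertex of $G$. Then $G$ has a $2$-factor (a $2$-regular spanning subgraph) $F$ such that $v$ does not belong to a circuit of length $7$ of $F$. -/

import Mathlib

open scoped Graph

namespace CircuitFactor

variable {α β : Type*}

/-- The degree of a vertex `x` in a (multi)graph: the number of edges incident with `x`,
where every loop at `x` is counted twice. -/
noncomputable def degree (G : Graph α β) (x : α) : ℕ∞ :=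
  (G.incidenceSet x).encard + (G.loopSet x).encard

/-- A graph is `d`-regular if all its vertices have degree `d`. -/
def IsRegular (G : Graph α β) (d : ℕ) : Prop :=
  ∀ x ∈ V(G), degree G x = d

/-- A cubic graph is a `3`-regular graph. -/
def IsCubic (G : Graph α β) : Prop := IsRegular G 3

/-- A graph is connected if it has a vertex and any two of its vertices are joined by a
sequence of consecutively adjacent vertices. -/
def IsConnected (G : Graph α β) : Prop :=
  V(G).Nonempty ∧ ∀ x ∈ V(G), ∀ y ∈ V(G), Relation.ReflTransGen G.Adj x y

/-- A circuit is a finite connected `2`-regular graph. (A loop with its vertex is a circuit of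
length `1`, and two parallel edges with their ends form a circuit of length `2`.) -/
def IsCircuit (C : Graph α β) : Prop :=
  V(C).Finite ∧ IsConnected C ∧ IsRegular C 2

/-- The length of a circuit is the number of its edges. -/
noncomputable def length (C : Graph α β) : ℕ∞ := E(C).encard

/-- The graph `G` contains a circuit. -/
def ContainsCircuit (G : Graph α β) : Prop :=
  ∃ C : Graph α β, C ≤ G ∧ IsCircuit C

/-- The edge-cut of `G` determined by a set `S` of vertices: all edges of `G` that have one end
in `S` and the other end outside `S`. -/
def edgeCut (G : Graph α β) (S : Set α) : Set β :=
  {e | ∃ x ∈ S, ∃ y ∉ S, G.IsLink e x y}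

/-- `G` is cyclically `h`-edge-connected if no edge-cut with fewer than `h` edges separates two
subgraphs that both contain a circuit. -/
def IsCyclicallyEdgeConnected (G : Graph α β) (h : ℕ) : Prop :=
  ¬ ∃ S : Set α, S ⊆ V(G) ∧ (edgeCut G S).encard < h ∧
    ContainsCircuit (G.induce S) ∧ ContainsCircuit (G.deleteVerts S)

/-- A `k`-factor of `G` is a `k`-regular spanning subgraph of `G`. -/
def IsFactor (k : ℕ) (F G : Graph α β) : Prop :=
  F ≤s G ∧ IsRegular F k

end CircuitFactor

set_option linter.unusedSectionVars false

/-! The complement of a perfect matching of a cubic graph is a 2-factor, so the aim is a perfect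
matching whose complement has no 7-circuit through `v`. Only edge multiplicities matter for this. A
set of vertices `A` that spans no circuit has at most |A| - 1 inner edges and hence an edge-cut of
size at least |A| + 2, so the connectivity hypothesis becomes the inequality `CyclicSeven`. On fewer
than seven vertices any perfect matching works (`CyclicSeven.exists_isPM`); otherwise the inequality
forces the graph to be simple of girth at least seven (`CyclicSeven.girthGT_six`).

If a 7-circuit of the factor contains a path P = a' a v b b', then its two remaining vertices are a
child of a' and a child of b', and they are adjacent. Some P admits no such closing edge
(`CyclicSeven.exists_nonclosing_path`): otherwise the ball of radius three around `v` would be the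
whole graph, a cubic graph of girth seven on 22 vertices. There is none, by a trace computation
modulo 7 (`GirthGT.card_ne`). Fix P. A perfect matching that avoids the edges of P solves the
problem.

If there is none, Tutte's theorem gives a barrier for the graph without P. The cut condition makes
its parts singletons, with at most one exception of three vertices. The result is a partition of the
vertices into S and O with |O| = |S| + 2 such that all edges inside O lie on P
(`exists_almost_bipartition`). Counting degrees, O has exactly three more inner edges than S. So
either three edges of P lie in O and S is independent, or all four do and S contains one edge.

In such a graph a matching is found by Hall's theorem (`exists_isPM_of_hall`): one edge inside O is
prescribed, the rest of O is matched with S, and one further edge is forbidden so that the factor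
contains a path centred at `v` that cannot close. Let c be the third neighbour of `v`. In the main
case vb is prescribed (after exchanging a and b if necessary), cc' is forbidden, and the path is a'
a v c c' (`CyclicSeven.exists_avoidsSeven_of_path`). If the edge inside S is incident with c, then
`v` and c first exchange sides (`CyclicSeven.exists_avoidsSeven_of_claw`). Hall's condition holds
because a violating set T and its neighbourhood N give a set T ∪ N whose cut is too small for
`CyclicSeven` (`CyclicSeven.not_hall_violator`). -/

namespace CircuitFactor

/-! ### Counting edges between sets of vertices. -/

/-- Edge multiplicities of a finite cubic multigraph, every loop being counted twice. -/
structure CubicWeight (ι : Type*) [Fintype ι] where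
  /-- The number of edges joining two vertices. -/
  m : ι → ι → ℕ
  symm : ∀ x y, m x y = m y x
  even_self : ∀ x, Even (m x x)
  sum_eq : ∀ x, ∑ y, m x y = 3

namespace CubicWeight

variable {ι : Type*} [Fintype ι] [DecidableEq ι] (w : CubicWeight ι)

/-- The total weight between two sets of vertices. -/
def e (A B : Finset ι) : ℕ := ∑ x ∈ A, ∑ y ∈ B, w.m x y

/-- The size of the edge-cut determined by a set of vertices. -/
def cut (A : Finset ι) : ℕ := w.e A Aᶜ

/-- The numerical form of cyclic `7`-edge-connectivity. -/
def CyclicSeven : Prop := ∀ A : Finset ι, A.Nonempty → Aᶜ.Nonempty →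
  7 ≤ w.cut A ∨ A.card + 2 ≤ w.cut A ∨ Aᶜ.card + 2 ≤ w.cut A

lemma e_comm (A B : Finset ι) : w.e A B = w.e B A := by
  unfold e
  rw [Finset.sum_comm]
  simp only [w.symm]

lemma e_union_left {A B : Finset ι} (h : Disjoint A B) (C : Finset ι) :
    w.e (A ∪ B) C = w.e A C + w.e B C := Finset.sum_union h

lemma e_union_right {A B : Finset ι} (h : Disjoint A B) (C : Finset ι) :
    w.e C (A ∪ B) = w.e C A + w.e C B := by
  rw [w.e_comm, w.e_union_left h, w.e_comm A, w.e_comm B]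

lemma e_mono_left {A B : Finset ι} (h : A ⊆ B) (C : Finset ι) : w.e A C ≤ w.e B C :=
  Finset.sum_le_sum_of_subset h

lemma e_mono_right {A B : Finset ι} (h : A ⊆ B) (C : Finset ι) : w.e C A ≤ w.e C B := by
  rw [w.e_comm C A, w.e_comm C B]; exact w.e_mono_left h C

lemma e_univ (A : Finset ι) : w.e A Finset.univ = 3 * A.card := by
  simp [e, w.sum_eq, mul_comm]

lemma e_add_compl (A B : Finset ι) : w.e A B + w.e A Bᶜ = 3 * A.card := by
  rw [← w.e_union_right disjoint_compl_right, Finset.union_compl, w.e_univ]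

lemma e_self_add_cut (A : Finset ι) : w.e A A + w.cut A = 3 * A.card := w.e_add_compl A A

lemma cut_compl (A : Finset ι) : w.cut Aᶜ = w.cut A := by
  unfold cut; rw [compl_compl, w.e_comm]

lemma even_e_self (A : Finset ι) : Even (w.e A A) := by
  induction A using Finset.induction_on with
  | empty => simp [e]
  | insert a s ha ih =>
    have hd : Disjoint {a} s := by simpa using ha
    have : w.e (insert a s) (insert a s) = w.m a a + 2 * w.e {a} s + w.e s s := by
      rw [Finset.insert_eq, w.e_union_left hd, w.e_union_right hd, w.e_union_right hd,
        w.e_comm s {a}]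
      have : w.e {a} {a} = w.m a a := by simp [e]
      omega
    rw [this]
    exact ((w.even_self a).add (even_two_mul _)).add ih

lemma cut_odd {A : Finset ι} (hA : Odd A.card) : Odd (w.cut A) := by
  have h1 := w.e_self_add_cut A
  have h2 := w.even_e_self A
  rw [Nat.even_iff] at h2
  rw [Nat.odd_iff] at hA ⊢
  omega

lemma even_card (w : CubicWeight ι) : Even (Fintype.card ι) := by
  classical
  have h2 := w.even_e_self Finset.univ
  rw [w.e_univ, Finset.card_univ] at h2
  rw [Nat.even_iff] at *
  omega

variable {w}

/-- Each alternative of the cut condition is at least 3, as both sides have at least one vertex. -/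
lemma CyclicSeven.three_le (hw : w.CyclicSeven) {A : Finset ι} (hA : A.Nonempty)
    (hA' : Aᶜ.Nonempty) : 3 ≤ w.cut A := by
  have := hA.card_pos
  have := hA'.card_pos
  rcases hw A hA hA' with h | h | h <;> omega

/-! ### Tutte barriers and perfect matchings. -/

variable (w)

/-- A family of sets of vertices that are separated from each other after the deletion of the
vertices in `S` and the edges in `X`. -/
structure IsClosedFamily (X : ι → ι → Prop) (S : Finset ι) (K : Finset (Finset ι)) : Prop where
  disj : ∀ A ∈ K, ∀ B ∈ K, A ≠ B → Disjoint A B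
  disj_left : ∀ A ∈ K, Disjoint A S
  nonempty : ∀ A ∈ K, A.Nonempty
  closed : ∀ A ∈ K, ∀ x ∈ A, ∀ y, 0 < w.m x y → X x y ∨ y ∈ A ∨ y ∈ S

open Classical in
/-- The total weight of a relation. -/
noncomputable def weight (X : ι → ι → Prop) : ℕ := ∑ x, ∑ y, if X x y then w.m x y else 0

/-- An edge that leaves a part either ends in `S`, which receives at most `3 * S.card` edges, or
belongs to `X`. The weight of `X` counts ordered pairs, so an edge of `X` between two parts may be
charged once from each side. -/
lemma IsClosedFamily.sum_cut_le {X : ι → ι → Prop} {S : Finset ι} {K : Finset (Finset ι)}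
    (h : w.IsClosedFamily X S K) : ∑ A ∈ K, w.cut A ≤ 3 * S.card + w.weight X := by
  classical
  have hd : (K : Set (Finset ι)).PairwiseDisjoint id := fun A hA B hB hAB => h.disj A hA B hB hAB
  have hsum : ∀ f : ι → ℕ, ∑ A ∈ K, ∑ x ∈ A, f x = ∑ x ∈ K.biUnion id, f x := fun f => by
    rw [Finset.sum_biUnion hd]; rfl
  have h1 : ∀ A ∈ K, w.cut A ≤ ∑ x ∈ A, (∑ y ∈ S, w.m x y + ∑ y, if X x y then w.m x y else 0) := by
    intro A hA
    unfold cut e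
    refine Finset.sum_le_sum fun x hx => ?_
    have h2 : ∑ y ∈ S, w.m x y = ∑ y, if y ∈ S then w.m x y else 0 := by
      simp
    rw [h2, ← Finset.sum_add_distrib]
    refine (Finset.sum_le_sum fun y hy => ?_).trans
      (Finset.sum_le_sum_of_subset (Finset.subset_univ Aᶜ))
    rcases Nat.eq_zero_or_pos (w.m x y) with h0 | h0
    · simp [h0]
    · rcases h.closed A hA x hx y h0 with h3 | h3 | h3
      · simp [h3]
      · simp [h3] at hy
      · simp [h3]
  refine (Finset.sum_le_sum h1).trans ?_
  rw [hsum, Finset.sum_add_distrib]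
  refine add_le_add ?_ (Finset.sum_le_sum_of_subset (Finset.subset_univ _))
  rw [← w.e_univ S, w.e_comm]
  exact Finset.sum_le_sum_of_subset (Finset.subset_univ _)

variable {w}

lemma IsClosedFamily.card_le {X : ι → ι → Prop} {S : Finset ι} {K : Finset (Finset ι)}
    (hw : w.CyclicSeven) (h : w.IsClosedFamily X S K) (hK : ∀ A ∈ K, A ≠ Finset.univ) :
    3 * K.card ≤ 3 * S.card + w.weight X := by
  refine le_trans ?_ h.sum_cut_le
  rw [mul_comm, ← smul_eq_mul]
  refine Finset.card_nsmul_le_sum _ _ _ fun A hA => hw.three_le (h.nonempty A hA) ?_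
  rw [Finset.nonempty_iff_ne_empty, Ne, Finset.compl_eq_empty_iff]
  exact hK A hA

/-- The vertices that remain can be added to a closed family. -/
lemma IsClosedFamily.insert_rest {X : ι → ι → Prop} (hX : ∀ x y, X x y → X y x) {S : Finset ι}
    {K : Finset (Finset ι)} (h : w.IsClosedFamily X S K)
    (hne : (S ∪ K.biUnion id)ᶜ.Nonempty) :
    w.IsClosedFamily X S (insert (S ∪ K.biUnion id)ᶜ K) ∧ (S ∪ K.biUnion id)ᶜ ∉ K := by
  set E := (S ∪ K.biUnion id)ᶜ with hE
  have hES : Disjoint E S := by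
    rw [Finset.disjoint_left]; intro x hx hx'
    simp [hE, hx'] at hx
  have hEK : ∀ A ∈ K, Disjoint A E := by
    intro A hA
    rw [Finset.disjoint_left]; intro x hx hx'
    simp only [hE, Finset.mem_compl, Finset.mem_union, Finset.mem_biUnion, id] at hx'
    exact hx' (Or.inr ⟨A, hA, hx⟩)
  refine ⟨⟨?_, ?_, ?_, ?_⟩, ?_⟩
  · intro A hA B hB hAB
    rw [Finset.mem_insert] at hA hB
    rcases hA with rfl | hA <;> rcases hB with rfl | hB
    · exact absurd rfl hAB
    · exact (hEK B hB).symm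
    · exact hEK A hA
    · exact h.disj A hA B hB hAB
  · intro A hA
    rcases Finset.mem_insert.1 hA with rfl | hA
    exacts [hES, h.disj_left A hA]
  · intro A hA
    rcases Finset.mem_insert.1 hA with rfl | hA
    exacts [hne, h.nonempty A hA]
  · intro A hA x hx y hxy
    rcases Finset.mem_insert.1 hA with rfl | hA
    · by_cases hyE : y ∈ E
      · exact Or.inr (Or.inl hyE)
      by_cases hyS : y ∈ S
      · exact Or.inr (Or.inr hyS)
      rw [hE, Finset.mem_compl, not_not, Finset.mem_union, Finset.mem_biUnion] at hyE
      obtain ⟨B, hB, hy⟩ := hyE.resolve_left hyS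
      rcases h.closed B hB y hy x (by rwa [w.symm]) with h3 | h3 | h3
      · exact Or.inl (hX _ _ h3)
      · exact absurd hx (Finset.disjoint_left.1 (hEK B hB) h3)
      · exact absurd h3 (Finset.disjoint_left.1 hES hx)
    · exact h.closed A hA x hx y hxy
  · intro hmem
    exact hne.ne_empty (disjoint_self.1 (hEK E hmem))

variable (w)

/-- A perfect matching of the underlying graph, as a fixed-point free involution. -/
structure IsPM (σ : ι → ι) : Prop where
  invol : ∀ x, σ (σ x) = x
  ne : ∀ x, σ x ≠ x
  pos : ∀ x, 0 < w.m x (σ x)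

/-- Tutte's theorem for the edges outside `X`. -/
lemma exists_isPM_or_closedFamily (X : ι → ι → Prop) (hX : ∀ x y, X x y → X y x) :
    (∃ σ, w.IsPM σ ∧ ∀ x, ¬ X x (σ x)) ∨
    ∃ S K, w.IsClosedFamily X S K ∧ S.card < K.card ∧ ∀ A ∈ K, Odd A.card := by
  classical
  let H : SimpleGraph ι :=
    { Adj := fun x y => x ≠ y ∧ 0 < w.m x y ∧ ¬ X x y
      symm := ⟨fun x y h => ⟨h.1.symm, by rw [w.symm]; exact h.2.1, fun h' => h.2.2 (hX _ _ h')⟩⟩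
      loopless := ⟨fun x h => h.1 rfl⟩ }
  by_cases hM : ∃ M : H.Subgraph, M.IsPerfectMatching
  · left
    obtain ⟨M, hM⟩ := hM
    rw [SimpleGraph.Subgraph.isPerfectMatching_iff] at hM
    choose σ hσ hσu using hM
    have hH : ∀ x, H.Adj x (σ x) := fun x => (hσ x).adj_sub
    refine ⟨σ, ⟨fun x => ?_, fun x => (hH x).1.symm, fun x => (hH x).2.1⟩, fun x => (hH x).2.2⟩
    exact (hσu (σ x) x (hσ x).symm).symm
  · right
    rw [SimpleGraph.tutte] at hM
    push Not at hM
    obtain ⟨u, hu⟩ := hM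
    unfold SimpleGraph.IsTutteViolator at hu
    set D := ((⊤ : H.Subgraph).deleteVerts u) with hD
    let f : D.coe.ConnectedComponent → Finset ι := fun c => (Subtype.val '' c.supp).toFinset
    have hf : ∀ c x, x ∈ f c ↔ ∃ h : x ∈ D.verts, D.coe.connectedComponentMk ⟨x, h⟩ = c := by
      intro c x
      simp [f, SimpleGraph.ConnectedComponent.mem_supp_iff]
    have hverts : ∀ x, x ∈ D.verts ↔ x ∉ u := by intro x; simp [hD]
    have hne : ∀ c, (f c).Nonempty := by
      intro c
      induction c using SimpleGraph.ConnectedComponent.ind with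
      | h v => exact ⟨v, (hf _ _).2 ⟨v.2, rfl⟩⟩
    have hdisj : ∀ c d, c ≠ d → Disjoint (f c) (f d) := by
      intro c d hcd
      rw [Finset.disjoint_left]
      intro x hx hx'
      obtain ⟨h1, h2⟩ := (hf _ _).1 hx
      obtain ⟨h3, h4⟩ := (hf _ _).1 hx'
      exact hcd (h2.symm.trans h4)
    have hinj : Function.Injective f := by
      intro c d hcd
      by_contra hne'
      have := hdisj c d hne'
      rw [hcd, disjoint_self] at this
      exact (hne d).ne_empty this
    refine ⟨u.toFinset, D.coe.oddComponents.toFinset.image f, ⟨?_, ?_, ?_, ?_⟩, ?_, ?_⟩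
    · intro A hA B hB hAB
      obtain ⟨c, -, rfl⟩ := Finset.mem_image.1 hA
      obtain ⟨d, -, rfl⟩ := Finset.mem_image.1 hB
      exact hdisj c d fun h => hAB (by rw [h])
    · intro A hA
      obtain ⟨c, -, rfl⟩ := Finset.mem_image.1 hA
      rw [Finset.disjoint_left]
      intro x hx hx'
      obtain ⟨h1, -⟩ := (hf _ _).1 hx
      exact (hverts x).1 h1 (by simpa using hx')
    · intro A hA
      obtain ⟨c, -, rfl⟩ := Finset.mem_image.1 hA
      exact hne c
    · intro A hA x hx y hxy
      obtain ⟨c, -, rfl⟩ := Finset.mem_image.1 hA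
      by_cases hXxy : X x y
      · exact Or.inl hXxy
      by_cases hyS : y ∈ u
      · exact Or.inr (Or.inr (by simpa using hyS))
      by_cases hne' : x = y
      · exact Or.inr (Or.inl (hne' ▸ hx))
      refine Or.inr (Or.inl ?_)
      obtain ⟨h1, h2⟩ := (hf _ _).1 hx
      have hy := (hverts y).2 hyS
      refine (hf _ _).2 ⟨hy, ?_⟩
      rw [← h2]
      refine SimpleGraph.ConnectedComponent.sound (SimpleGraph.Adj.reachable ?_)
      have : H.Adj y x := SimpleGraph.Adj.symm (show H.Adj x y from ⟨hne', hxy, hXxy⟩)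
      simp only [hD, SimpleGraph.Subgraph.coe_adj, SimpleGraph.Subgraph.deleteVerts_adj,
        SimpleGraph.Subgraph.verts_top, Set.mem_univ, true_and, SimpleGraph.Subgraph.top_adj]
      exact ⟨hyS, (hverts x).1 h1, this⟩
    · rw [Finset.card_image_of_injective _ hinj]
      rwa [Set.ncard_eq_toFinset_card', Set.ncard_eq_toFinset_card'] at hu
    · intro A hA
      obtain ⟨c, hc, rfl⟩ := Finset.mem_image.1 hA
      have hc' : Odd c.supp.ncard := by simpa using hc
      have : (f c).card = c.supp.ncard := by
        simp only [f]
        rw [← Set.ncard_eq_toFinset_card', Set.ncard_image_of_injective _ Subtype.val_injective]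
      rwa [this]

variable {w}

/-- Petersen's argument: every odd part sends at least three edges to `S`, so there are at most
`S.card` of them. A part equal to the whole vertex set is excluded because a cubic graph has even
order. -/
theorem CyclicSeven.exists_isPM (hw : w.CyclicSeven) : ∃ σ, w.IsPM σ := by
  rcases w.exists_isPM_or_closedFamily (fun _ _ => False) (fun _ _ h => h) with
    ⟨σ, h, -⟩ | ⟨S, K, hK, hlt, hodd⟩
  · exact ⟨σ, h⟩
  exfalso
  by_cases huniv : ∀ A ∈ K, A ≠ Finset.univ
  · have := hK.card_le hw huniv
    simp [weight] at this
    omega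
  · push Not at huniv
    obtain ⟨A, hA, rfl⟩ := huniv
    have h1 := hodd _ hA
    have h2 := w.even_card
    rw [Finset.card_univ, ← Nat.not_even_iff_odd] at h1
    exact h1 h2

end CubicWeight

/-! ### Girth at least seven. -/

namespace CubicWeight

variable {ι : Type*} [Fintype ι] [DecidableEq ι] (w : CubicWeight ι)

/-- Adjacency in the underlying graph. -/
def Adj (x y : ι) : Prop := 0 < w.m x y

instance (x y : ι) : Decidable (w.Adj x y) := inferInstanceAs (Decidable (0 < _))

/-- The set of neighbours of a vertex. -/
def nbr (x : ι) : Finset ι := Finset.univ.filter (w.Adj x)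

/-- The neighbours of `y` other than `x`. -/
def children (x y : ι) : Finset ι := (w.nbr y).erase x

variable {w}

@[simp] lemma mem_nbr {x y : ι} : y ∈ w.nbr x ↔ w.Adj x y := by simp [nbr]

@[simp] lemma mem_children {x y z : ι} : z ∈ w.children x y ↔ z ≠ x ∧ w.Adj y z := by
  simp [children]

lemma Adj.symm {x y : ι} (h : w.Adj x y) : w.Adj y x := by
  unfold Adj at *; rwa [w.symm]

variable (w)

/-- `f 0, …, f k` is a walk without immediate reversals. -/
structure IsNonbacktracking (k : ℕ) (f : ℕ → ι) : Prop where
  adj : ∀ i < k, w.Adj (f i) (f (i + 1))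
  ne : ∀ i, i + 2 ≤ k → f i ≠ f (i + 2)

/-- The graph is simple and has girth greater than `k`. -/
structure GirthGT (k : ℕ) : Prop where
  self : ∀ x, w.m x x = 0
  le_one : ∀ x y, w.m x y ≤ 1
  ne : ∀ l, 1 ≤ l → l ≤ k → ∀ f, w.IsNonbacktracking l f → f 0 ≠ f l

variable {w}

lemma IsNonbacktracking.shift {k l i : ℕ} {f : ℕ → ι} (h : w.IsNonbacktracking k f)
    (hil : i + l ≤ k) : w.IsNonbacktracking l (fun j => f (i + j)) :=
  ⟨fun j hj => h.adj (i + j) (by omega), fun j hj => h.ne (i + j) (by omega)⟩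

lemma cut_le_of_two_le {W : Finset ι} (h : ∀ x ∈ W, 2 ≤ ∑ y ∈ W, w.m x y) :
    w.cut W ≤ W.card := by
  have h1 : W.card * 2 ≤ w.e W W := by
    rw [← smul_eq_mul]; exact Finset.card_nsmul_le_sum _ _ _ h
  have := w.e_self_add_cut W
  omega

/-- Such a set would have a cut of size at most `W.card`, which is below 7 and below `W.card + 2`.
The bound on `2 * W.card` rules out the alternative for the complement. -/
lemma CyclicSeven.not_two_le (hw : w.CyclicSeven) {W : Finset ι} (hne : W.Nonempty)
    (h6 : W.card ≤ 6) (hn : 2 * W.card ≤ Fintype.card ι + 1) (hn' : W.card < Fintype.card ι) :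
    ¬ ∀ x ∈ W, 2 ≤ ∑ y ∈ W, w.m x y := by
  intro h
  have h1 := cut_le_of_two_le h
  have h2 := Finset.card_compl W
  have h3 : Wᶜ.Nonempty := by rw [← Finset.card_pos]; omega
  rcases hw W hne h3 with h | h | h <;> omega

/-- For `k = 0` the condition on walks is void and only simplicity is asserted. -/
lemma CyclicSeven.girthGT_zero (hw : w.CyclicSeven) (hn : 7 ≤ Fintype.card ι) :
    w.GirthGT 0 := by
  have h0 : ∀ x, w.m x x = 0 := by
    intro x
    by_contra hx
    refine hw.not_two_le (W := {x}) (by simp) (by simp) (by simp; omega) (by simp; omega) ?_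
    have := w.even_self x
    rw [Nat.even_iff] at this
    simp
    omega
  refine ⟨h0, ?_, fun l h1 h2 => by omega⟩
  intro x y
  by_contra hxy
  have hne : x ≠ y := by rintro rfl; simp [h0] at hxy
  have hc : ({x, y} : Finset ι).card = 2 := Finset.card_pair hne
  refine hw.not_two_le (W := {x, y}) (by simp) (by omega) (by omega) (by omega) ?_
  intro z hz
  rw [Finset.sum_pair hne]
  rw [Finset.mem_insert, Finset.mem_singleton] at hz
  rcases hz with rfl | rfl
  · omega
  · rw [w.symm z x]; omega

/-- A closed nonbacktracking walk of the first possible length repeats no vertex before it closes.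
Its vertex set then has inner degrees at least two, which `CyclicSeven.not_two_le` forbids. -/
lemma GirthGT.succ (hw : w.CyclicSeven) {k : ℕ} (hg : w.GirthGT k) (hk : k + 1 ≤ 6)
    (hn : 2 * (k + 1) ≤ Fintype.card ι + 1) (hn' : 7 ≤ Fintype.card ι) : w.GirthGT (k + 1) := by
  refine ⟨hg.self, hg.le_one, fun l h1 h2 f hf h0 => ?_⟩
  rcases Nat.lt_or_ge k l with hlk | hlk
  swap
  · exact hg.ne l h1 hlk f hf h0
  have hl : l = k + 1 := by omega
  subst hl
  have hloop : ∀ x y, w.Adj x y → x ≠ y := by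
    rintro x y h rfl
    simp [Adj, hg.self] at h
  have hinj : ∀ i j, i < j → j < k + 1 → f i ≠ f j := by
    intro i j hij hj
    have := hg.ne (j - i) (by omega) (by omega) _ (hf.shift (i := i) (l := j - i) (by omega))
    simpa [show i + (j - i) = j by omega] using this
  have hk0 : k ≠ 0 := by
    rintro rfl
    exact hloop _ _ (hf.adj 0 (by omega)) h0
  have hk1 : k ≠ 1 := by
    rintro rfl
    exact hf.ne 0 (by omega) h0
  have hinjOn : Set.InjOn f (Finset.range (k + 1)) := by
    intro i hi j hj hij
    simp only [Finset.coe_range, Set.mem_Iio] at hi hj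
    rcases lt_trichotomy i j with h | h | h
    · exact absurd hij (hinj i j h hj)
    · exact h
    · exact absurd hij.symm (hinj j i h hi)
  have hcard : ((Finset.range (k + 1)).image f).card = k + 1 := by
    rw [Finset.card_image_of_injOn hinjOn, Finset.card_range]
  refine hw.not_two_le (W := (Finset.range (k + 1)).image f) (by simp) (by omega) (by omega)
    (by omega) ?_
  intro x hx
  obtain ⟨i, hi, rfl⟩ := Finset.mem_image.1 hx
  rw [Finset.mem_range] at hi
  have hmem : ∀ j, j ≤ k + 1 → f j ∈ (Finset.range (k + 1)).image f := by
    intro j hj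
    rcases Nat.lt_or_ge j (k + 1) with h | h
    · exact Finset.mem_image_of_mem _ (Finset.mem_range.2 h)
    · rw [show j = k + 1 by omega, ← h0]
      exact Finset.mem_image_of_mem _ (Finset.mem_range.2 (by omega))
  have key : ∀ y z, y ∈ (Finset.range (k + 1)).image f → z ∈ (Finset.range (k + 1)).image f →
      y ≠ z → w.Adj (f i) y → w.Adj (f i) z →
      2 ≤ ∑ y ∈ (Finset.range (k + 1)).image f, w.m (f i) y := by
    intro y z hy hz hyz h1 h2
    have : ∑ y ∈ ({y, z} : Finset ι), w.m (f i) y ≤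
        ∑ y ∈ (Finset.range (k + 1)).image f, w.m (f i) y := by
      refine Finset.sum_le_sum_of_subset ?_
      intro t ht
      rw [Finset.mem_insert, Finset.mem_singleton] at ht
      rcases ht with rfl | rfl
      exacts [hy, hz]
    rw [Finset.sum_pair hyz] at this
    unfold Adj at h1 h2
    omega
  rcases Nat.eq_zero_or_pos i with rfl | hi0
  · refine key (f 1) (f k) (hmem _ (by omega)) (hmem _ (by omega)) (hinj 1 k (by omega) (by omega))
      (hf.adj 0 (by omega)) ?_
    have := (hf.adj k (by omega)).symm
    rwa [← h0] at this
  · obtain ⟨j, rfl⟩ : ∃ j, i = j + 1 := ⟨i - 1, by omega⟩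
    exact key (f j) (f (j + 2)) (hmem _ (by omega)) (hmem _ (by omega)) (hf.ne j (by omega))
      (hf.adj j (by omega)).symm (hf.adj (j + 1) (by omega))

section walks

variable {k : ℕ} (hg : w.GirthGT k) {a b c d e f g : ι}
include hg

lemma GirthGT.adj_ne (hab : w.Adj a b) : a ≠ b := by
  rintro rfl
  simp [Adj, hg.self] at hab

lemma GirthGT.ne_three (hk : 3 ≤ k) (h1 : w.Adj a b) (h2 : w.Adj b c) (h3 : w.Adj c d)
    (n1 : a ≠ c) (n2 : b ≠ d) : a ≠ d :=
  hg.ne 3 (by omega) hk (fun i => [a, b, c, d].getD i a)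
    ⟨fun i hi => by interval_cases i <;> assumption,
      fun i hi => by
        have : i < 2 := by omega
        interval_cases i <;> assumption⟩

lemma GirthGT.ne_four (hk : 4 ≤ k) (h1 : w.Adj a b) (h2 : w.Adj b c) (h3 : w.Adj c d)
    (h4 : w.Adj d e) (n1 : a ≠ c) (n2 : b ≠ d) (n3 : c ≠ e) : a ≠ e :=
  hg.ne 4 (by omega) hk (fun i => [a, b, c, d, e].getD i a)
    ⟨fun i hi => by interval_cases i <;> assumption,
      fun i hi => by
        have : i < 3 := by omega
        interval_cases i <;> assumption⟩

lemma GirthGT.ne_five (hk : 5 ≤ k) (h1 : w.Adj a b) (h2 : w.Adj b c) (h3 : w.Adj c d)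
    (h4 : w.Adj d e) (h5 : w.Adj e f) (n1 : a ≠ c) (n2 : b ≠ d) (n3 : c ≠ e) (n4 : d ≠ f) :
    a ≠ f :=
  hg.ne 5 (by omega) hk (fun i => [a, b, c, d, e, f].getD i a)
    ⟨fun i hi => by interval_cases i <;> assumption,
      fun i hi => by
        have : i < 4 := by omega
        interval_cases i <;> assumption⟩

lemma GirthGT.ne_six (hk : 6 ≤ k) (h1 : w.Adj a b) (h2 : w.Adj b c) (h3 : w.Adj c d)
    (h4 : w.Adj d e) (h5 : w.Adj e f) (h6 : w.Adj f g) (n1 : a ≠ c) (n2 : b ≠ d) (n3 : c ≠ e)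
    (n4 : d ≠ f) (n5 : e ≠ g) : a ≠ g :=
  hg.ne 6 (by omega) hk (fun i => [a, b, c, d, e, f, g].getD i a)
    ⟨fun i hi => by interval_cases i <;> assumption,
      fun i hi => by
        have : i < 5 := by omega
        interval_cases i <;> assumption⟩

lemma GirthGT.m_eq (a b : ι) : w.m a b = if w.Adj a b then 1 else 0 := by
  have := hg.le_one a b
  split_ifs with h <;> unfold Adj at h <;> omega

lemma GirthGT.card_nbr (a : ι) : (w.nbr a).card = 3 := by
  rw [← w.sum_eq a, nbr, Finset.card_filter]
  exact Finset.sum_congr rfl fun b _ => (hg.m_eq a b).symm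

lemma GirthGT.card_children (hab : w.Adj a b) : (w.children a b).card = 2 := by
  rw [children, Finset.card_erase_of_mem (by simpa using hab.symm), hg.card_nbr]

end walks

/-! ### Spheres and balls around a vertex. -/

variable (w)

/-- The ends of the nonbacktracking walks of length two from a vertex. -/
def sphereTwo (x : ι) : Finset ι := (w.nbr x).biUnion (w.children x)

/-- The ends of the nonbacktracking walks of length three from a vertex. -/
def sphereThree (x : ι) : Finset ι :=
  (w.nbr x).biUnion fun y => (w.children x y).biUnion (w.children y)

/-- The ends of the nonbacktracking walks of length at most two from a vertex. -/
def ballTwo (x : ι) : Finset ι := insert x (w.nbr x ∪ w.sphereTwo x)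

variable {w}

lemma mem_sphereTwo {x z : ι} : z ∈ w.sphereTwo x ↔ ∃ y, w.Adj x y ∧ z ≠ x ∧ w.Adj y z := by
  simp [sphereTwo]

lemma mem_sphereThree {x t : ι} : t ∈ w.sphereThree x ↔
    ∃ y, w.Adj x y ∧ ∃ z, (z ≠ x ∧ w.Adj y z) ∧ t ≠ y ∧ w.Adj z t := by
  simp [sphereThree]

lemma GirthGT.card_ballTwo {k : ℕ} (hg : w.GirthGT k) (hk : 4 ≤ k) (x : ι) :
    (w.ballTwo x).card = 10 := by
  have h2 : (w.sphereTwo x).card = 6 := by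
    rw [sphereTwo, Finset.card_biUnion]
    · rw [Finset.sum_const_nat (m := 2), hg.card_nbr]
      intro y hy
      exact hg.card_children (mem_nbr.1 hy)
    · intro y hy y' hy' hne
      rw [Function.onFun, Finset.disjoint_left]
      intro z hz hz'
      rw [mem_children] at hz hz'
      rw [Finset.mem_coe, mem_nbr] at hy hy'
      exact hg.ne_four hk hy hz.2 hz'.2.symm hy'.symm hz.1.symm hne hz.1 rfl
  have hd : Disjoint (w.nbr x) (w.sphereTwo x) := by
    rw [Finset.disjoint_left]
    intro y hy hy'
    obtain ⟨z, h1, h2, h3⟩ := mem_sphereTwo.1 hy'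
    rw [mem_nbr] at hy
    exact hg.ne_three (by omega) h1 h3 hy.symm h2.symm (hg.adj_ne h1).symm rfl
  rw [ballTwo, Finset.card_insert_of_notMem, Finset.card_union_of_disjoint hd, h2, hg.card_nbr]
  rw [Finset.mem_union, mem_nbr, mem_sphereTwo]
  rintro (h | ⟨y, h1, h2, h3⟩)
  · exact hg.adj_ne h rfl
  · exact h2 rfl

lemma GirthGT.disjoint_ballTwo_sphereThree {k : ℕ} (hg : w.GirthGT k) (hk : 5 ≤ k) (x : ι) :
    Disjoint (w.ballTwo x) (w.sphereThree x) := by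
  rw [Finset.disjoint_left]
  intro t ht ht'
  obtain ⟨y, h1, z, ⟨h2, h3⟩, h4, h5⟩ := mem_sphereThree.1 ht'
  rw [ballTwo, Finset.mem_insert, Finset.mem_union, mem_nbr, mem_sphereTwo] at ht
  rcases ht with rfl | h | ⟨y', h6, h7, h8⟩
  · exact hg.ne_three (by omega) h1 h3 h5 h2.symm h4.symm rfl
  · exact hg.ne_four (by omega) h1 h3 h5 h.symm h2.symm h4.symm h2 rfl
  · by_cases hy : y = y'
    · subst hy
      exact hg.ne_three (by omega) h3 h5 h8.symm h4.symm (hg.adj_ne h3).symm rfl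
    · by_cases hz : z = y'
      · subst hz
        exact hg.ne_three (by omega) h1 h3 h6.symm h2.symm (hg.adj_ne h1).symm rfl
      · exact hg.ne_five hk h1 h3 h5 h8.symm h6.symm h2.symm h4.symm hz h7 rfl

lemma GirthGT.sphereThree_nonempty {k : ℕ} (hg : w.GirthGT k) (x : ι) :
    (w.sphereThree x).Nonempty := by
  have h0 : (w.nbr x).Nonempty := by rw [← Finset.card_pos, hg.card_nbr]; omega
  obtain ⟨y, hy⟩ := h0
  have h1 : (w.children x y).Nonempty := by
    rw [← Finset.card_pos, hg.card_children (mem_nbr.1 hy)]; omega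
  obtain ⟨z, hz⟩ := h1
  have h2 : (w.children y z).Nonempty := by
    rw [← Finset.card_pos, hg.card_children (mem_children.1 hz).2]; omega
  obtain ⟨t, ht⟩ := h2
  exact ⟨t, mem_sphereThree.2 ⟨y, mem_nbr.1 hy, z, mem_children.1 hz, mem_children.1 ht⟩⟩

/-- A bootstrap: excluding circuits of length k + 1 needs `2 * (k + 1) ≤ n + 1`. Seven vertices
suffice up to length 4; then the ball of radius two supplies 10 vertices, enough for length 5, and
one vertex at distance three gives the 11 needed for length 6. -/
theorem CyclicSeven.girthGT_six (hw : w.CyclicSeven) (hn : 7 ≤ Fintype.card ι) :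
    w.GirthGT 6 := by
  have h0 := hw.girthGT_zero hn
  have h1 := h0.succ hw (by omega) (by omega) hn
  have h2 := h1.succ hw (by omega) (by omega) hn
  have h3 := h2.succ hw (by omega) (by omega) hn
  have h4 := h3.succ hw (by omega) (by omega) hn
  obtain ⟨x⟩ : Nonempty ι := Fintype.card_pos_iff.1 (by omega)
  have hb := h4.card_ballTwo le_rfl x
  have hb' := Finset.card_le_univ (w.ballTwo x)
  have h5 := h4.succ hw (by omega) (by omega) hn
  have h11 : 11 ≤ Fintype.card ι := by
    have := Finset.card_le_univ (w.ballTwo x ∪ w.sphereThree x)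
    rw [Finset.card_union_of_disjoint (h5.disjoint_ballTwo_sphereThree le_rfl x), hb] at this
    have := (h5.sphereThree_nonempty x).card_pos
    omega
  exact h5.succ hw (by omega) (by omega) hn

end CubicWeight

/-! ### Closing a path to a 7-circuit; no cubic graph of girth seven has 22 vertices. -/

namespace CubicWeight

variable {ι : Type*} [Fintype ι] [DecidableEq ι] {w : CubicWeight ι}

/-- A set of vertices is closed under adjacency in the complement of the matching `σ`. -/
def IsFactorClosed (w : CubicWeight ι) (σ : ι → ι) (W : Finset ι) : Prop :=
  ∀ x ∈ W, ∀ y, w.Adj x y → y ≠ σ x → y ∈ W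

lemma exists_mem_ne_of_card {s : Finset ι} (a : ι) (h : 2 ≤ s.card) : ∃ b ∈ s, b ≠ a := by
  have : (s.erase a).Nonempty := by
    rw [← Finset.card_pos]
    have := Finset.pred_card_le_card_erase (s := s) (a := a)
    omega
  obtain ⟨b, hb⟩ := this
  exact ⟨b, Finset.mem_of_mem_erase hb, Finset.ne_of_mem_erase hb⟩

lemma exists_mem_ne_ne_of_card {s : Finset ι} (a b : ι) (h : 3 ≤ s.card) :
    ∃ c ∈ s, c ≠ a ∧ c ≠ b := by
  have : 2 ≤ (s.erase a).card := by
    have := Finset.pred_card_le_card_erase (s := s) (a := a)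
    omega
  obtain ⟨c, hc, hcb⟩ := exists_mem_ne_of_card b this
  exact ⟨c, Finset.mem_of_mem_erase hc, Finset.ne_of_mem_erase hc, hcb⟩

/-- If the complement of a matching contains a path of length four centred at `v`, then a closed
set of seven vertices containing `v` consists of a circuit that extends the path. -/
lemma GirthGT.exists_adj_of_isFactorClosed (hg : w.GirthGT 6) {σ : ι → ι} {v a b a' b' : ι}
    (hva : w.Adj v a) (hvb : w.Adj v b) (hab : a ≠ b) (haa : a' ∈ w.children v a)
    (hbb : b' ∈ w.children v b) (h1 : σ v ≠ a) (h2 : σ v ≠ b) (h3 : σ a ≠ a') (h4 : σ b ≠ b')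
    {W : Finset ι} (hv : v ∈ W) (hW : W.card = 7) (hcl : w.IsFactorClosed σ W) :
    ∃ k ∈ w.children a a', ∃ l ∈ w.children b b', σ a' ≠ k ∧ σ b' ≠ l ∧ w.Adj k l := by
  rw [mem_children] at haa hbb
  have haW := hcl v hv a hva h1.symm
  have hbW := hcl v hv b hvb h2.symm
  have haW' := hcl a haW a' haa.2 h3.symm
  have hbW' := hcl b hbW b' hbb.2 h4.symm
  obtain ⟨k, hk, hk'⟩ := exists_mem_ne_of_card (σ a') (hg.card_children haa.2).ge
  obtain ⟨l, hl, hl'⟩ := exists_mem_ne_of_card (σ b') (hg.card_children hbb.2).ge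
  refine ⟨k, hk, l, hl, hk'.symm, hl'.symm, ?_⟩
  rw [mem_children] at hk hl
  have hkW := hcl a' haW' k hk.2 hk'
  have hlW := hcl b' hbW' l hl.2 hl'
  let f : ℕ → ι := fun i => [k, a', a, v, b, b', l].getD i k
  have hf : w.IsNonbacktracking 6 f := by
    refine ⟨fun i hi => ?_, fun i hi => ?_⟩
    · interval_cases i
      exacts [hk.2.symm, haa.2.symm, hva.symm, hvb, hbb.2, hl.2]
    · have : i < 5 := by omega
      interval_cases i
      exacts [hk.1, haa.1, hab, hbb.1.symm, hl.1.symm]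
  have hinj : Set.InjOn f (Finset.range 7) := by
    have key : ∀ i j, i < j → j ≤ 6 → f i ≠ f j := by
      intro i j hij hj
      have := hg.ne (j - i) (by omega) (by omega) _ (hf.shift (i := i) (l := j - i) (by omega))
      simpa only [add_zero, show i + (j - i) = j by omega] using this
    intro i hi j hj hij
    simp only [Finset.coe_range, Set.mem_Iio] at hi hj
    rcases lt_trichotomy i j with h | h | h
    · exact absurd hij (key i j h (by omega))
    · exact h
    · exact absurd hij.symm (key j i h (by omega))
  have hsub : (Finset.range 7).image f ⊆ W := by
    intro x hx
    obtain ⟨i, hi, rfl⟩ := Finset.mem_image.1 hx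
    rw [Finset.mem_range] at hi
    interval_cases i
    exacts [hkW, haW', haW, hv, hbW, hbW', hlW]
  have hWeq : (Finset.range 7).image f = W := by
    refine Finset.eq_of_subset_of_card_le hsub ?_
    rw [Finset.card_image_of_injOn hinj, Finset.card_range, hW]
  -- The third neighbour of `k`, other than `a'` and `σ k`, must lie in `W`; the girth excludes
  -- every vertex of the path except `l`.
  obtain ⟨t, ht, ht1, ht2⟩ := exists_mem_ne_ne_of_card a' (σ k) (hg.card_nbr k).ge
  rw [mem_nbr] at ht
  have htW := hcl k hkW t ht ht2
  rw [← hWeq] at htW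
  obtain ⟨i, hi, hit⟩ := Finset.mem_image.1 htW
  rw [Finset.mem_range] at hi
  interval_cases i
  · exact absurd hit (hg.adj_ne ht)
  · exact absurd hit.symm ht1
  · exact absurd hit.symm (hg.ne_three (by omega) ht.symm hk.2.symm haa.2.symm ht1 hk.1)
  · exact absurd hit.symm
      (hg.ne_four (by omega) ht.symm hk.2.symm haa.2.symm hva.symm ht1 hk.1 haa.1)
  · exact absurd hit.symm
      (hg.ne_five (by omega) ht.symm hk.2.symm haa.2.symm hva.symm hvb ht1 hk.1 haa.1 hab)
  · exact absurd hit.symm (hg.ne_six (by omega) ht.symm hk.2.symm haa.2.symm hva.symm hvb hbb.2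
      ht1 hk.1 haa.1 hab hbb.1.symm)
  · have : l = t := hit
    rwa [this]

lemma GirthGT.card_sphereThree (hg : w.GirthGT 6) (x : ι) : (w.sphereThree x).card = 12 := by
  rw [sphereThree, Finset.card_biUnion]
  · rw [Finset.sum_const_nat (m := 4), hg.card_nbr]
    intro y hy
    rw [mem_nbr] at hy
    rw [Finset.card_biUnion]
    · rw [Finset.sum_const_nat (m := 2), hg.card_children hy]
      intro z hz
      exact hg.card_children (mem_children.1 hz).2
    · intro z hz z' hz' hne
      rw [Function.onFun, Finset.disjoint_left]
      intro t ht ht'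
      rw [Finset.mem_coe, mem_children] at hz hz'
      rw [mem_children] at ht ht'
      exact hg.ne_four (by omega) hz.2 ht.2 ht'.2.symm hz'.2.symm ht.1.symm hne ht.1 rfl
  · intro y hy y' hy' hne
    rw [Function.onFun, Finset.disjoint_left]
    intro t ht ht'
    rw [Finset.mem_coe, mem_nbr] at hy hy'
    obtain ⟨z, hz, hzt⟩ := Finset.mem_biUnion.1 ht
    obtain ⟨z', hz', hzt'⟩ := Finset.mem_biUnion.1 ht'
    rw [mem_children] at hz hz' hzt hzt'
    have hzz : z ≠ z' := by
      rintro rfl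
      exact hg.ne_four (by omega) hy hz.2 hz'.2.symm hy'.symm hz.1.symm hne hz.1 rfl
    exact hg.ne_six (by omega) hy hz.2 hzt.2 hzt'.2.symm hz'.2.symm hy'.symm hz.1.symm hzt.1.symm
      hzz hzt'.1 hz'.1 rfl

/-- The closed ball of radius three. -/
def ballThree (w : CubicWeight ι) (x : ι) : Finset ι := w.ballTwo x ∪ w.sphereThree x

lemma GirthGT.card_ballThree (hg : w.GirthGT 6) (x : ι) : (w.ballThree x).card = 22 := by
  rw [ballThree, Finset.card_union_of_disjoint (hg.disjoint_ballTwo_sphereThree (by omega) x),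
    hg.card_ballTwo (by omega), hg.card_sphereThree]

/-- The adjacency matrix modulo seven. -/
def adjMat (w : CubicWeight ι) : Matrix ι ι (ZMod 7) := Matrix.of fun x y => (w.m x y : ZMod 7)

lemma GirthGT.adjMat_sq_apply {k : ℕ} (hg : w.GirthGT k) (x y : ι) :
    (w.adjMat * w.adjMat) x y = ((w.nbr x ∩ w.nbr y).card : ZMod 7) := by
  have h : w.nbr x ∩ w.nbr y = Finset.univ.filter fun z => w.Adj x z ∧ w.Adj z y := by
    ext z
    simp only [Finset.mem_inter, mem_nbr, Finset.mem_filter, Finset.mem_univ, true_and]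
    exact and_congr_right fun _ => ⟨Adj.symm, Adj.symm⟩
  rw [Matrix.mul_apply, h, Finset.card_filter, Nat.cast_sum]
  refine Finset.sum_congr rfl fun z _ => ?_
  simp only [adjMat, Matrix.of_apply]
  rw [hg.m_eq x z, hg.m_eq z y]
  by_cases h1 : w.Adj x z <;> by_cases h2 : w.Adj z y <;> simp [h1, h2]

lemma GirthGT.adjMat_mul_apply {k : ℕ} (hg : w.GirthGT k) (B : Matrix ι ι (ZMod 7)) (x y : ι) :
    (w.adjMat * B) x y = ∑ z ∈ w.nbr x, B z y := by
  rw [Matrix.mul_apply, nbr, Finset.sum_filter]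
  refine Finset.sum_congr rfl fun z _ => ?_
  simp only [adjMat, Matrix.of_apply]
  rw [hg.m_eq x z]
  split_ifs <;> simp

lemma GirthGT.card_inter_nbr_of_mid (hg : w.GirthGT 6) {x y z : ι} (hxy : x ≠ y)
    (h1 : w.Adj x z) (h2 : w.Adj z y) : (w.nbr x ∩ w.nbr y).card = 1 := by
  rw [Finset.card_eq_one]
  refine ⟨z, ?_⟩
  ext t
  simp only [Finset.mem_inter, mem_nbr, Finset.mem_singleton]
  refine ⟨fun h => ?_, ?_⟩
  · by_contra hne
    exact hg.ne_four (by omega) h1 h2 h.2 h.1.symm hxy (Ne.symm hne) hxy.symm rfl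
  · rintro rfl
    exact ⟨h1, h2.symm⟩

lemma card_inter_nbr_of_forall {x y : ι} (h : ∀ z, w.Adj x z → ¬ w.Adj z y) :
    (w.nbr x ∩ w.nbr y).card = 0 := by
  rw [Finset.card_eq_zero, Finset.eq_empty_iff_forall_notMem]
  intro z hz
  simp only [Finset.mem_inter, mem_nbr] at hz
  exact h z hz.1 hz.2.symm

lemma GirthGT.card_inter_nbr_of_adj (hg : w.GirthGT 6) {x y : ι} (h : w.Adj x y) :
    (w.nbr x ∩ w.nbr y).card = 0 :=
  card_inter_nbr_of_forall fun _ h1 h2 => hg.ne_three (by omega) h1 h2 h.symm (hg.adj_ne h)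
    (hg.adj_ne h1).symm rfl

/-- The ball of radius three is everything, so each pair of vertices is joined by exactly one
nonbacktracking walk of length at most three. These walks are counted by I, A, A² - 3I and A³ - 5A,
whose sum is therefore J. Entrywise, this is checked at each of the four distances. -/
lemma GirthGT.adjMat_poly (hg : w.GirthGT 6) (hcard : Fintype.card ι = 22) :
    w.adjMat * (w.adjMat * w.adjMat) =
      Matrix.of (fun _ _ => 1) - w.adjMat * w.adjMat + (4 : ZMod 7) • w.adjMat +
        (2 : ZMod 7) • (1 : Matrix ι ι (ZMod 7)) := by
  ext x y
  have hy : y ∈ w.ballThree x := by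
    rw [(Finset.card_eq_iff_eq_univ _).1 ((hg.card_ballThree x).trans hcard.symm)]
    exact Finset.mem_univ y
  have hA : w.adjMat x y = if w.Adj x y then 1 else 0 := by
    simp only [adjMat, Matrix.of_apply]
    rw [hg.m_eq x y]
    split_ifs <;> simp
  rw [hg.adjMat_mul_apply]
  simp only [Matrix.add_apply, Matrix.sub_apply, Matrix.smul_apply, Matrix.of_apply,
    Matrix.one_apply, smul_eq_mul, hA, hg.adjMat_sq_apply]
  have hself : (w.nbr y ∩ w.nbr y).card = 3 := by rw [Finset.inter_self, hg.card_nbr]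
  rw [ballThree, ballTwo, Finset.mem_union, Finset.mem_insert, Finset.mem_union, mem_nbr] at hy
  rcases hy with (rfl | h1 | h2) | h3
  · have hn : ¬ w.Adj y y := fun h => hg.adj_ne h rfl
    rw [Finset.sum_eq_zero, hself, if_neg hn, if_pos rfl]
    · decide
    · intro z hz
      rw [mem_nbr] at hz
      rw [hg.card_inter_nbr_of_adj hz.symm, Nat.cast_zero]
  · have hne := hg.adj_ne h1
    have hy : y ∈ w.nbr x := mem_nbr.2 h1
    rw [hg.card_inter_nbr_of_adj h1, if_pos h1, if_neg hne, ← Finset.add_sum_erase _ _ hy, hself,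
      Finset.sum_congr rfl (g := fun _ => (1 : ZMod 7)), Finset.sum_const,
      Finset.card_erase_of_mem hy, hg.card_nbr]
    · decide
    · intro z hz
      simp only [Finset.mem_erase, mem_nbr] at hz
      rw [hg.card_inter_nbr_of_mid hz.1 hz.2.symm h1, Nat.cast_one]
  · obtain ⟨m, hm1, hyx, hm2⟩ := mem_sphereTwo.1 h2
    have hn : ¬ w.Adj x y := fun h =>
      hg.ne_three (by omega) hm1 hm2 h.symm hyx.symm (hg.adj_ne hm1).symm rfl
    rw [hg.card_inter_nbr_of_mid hyx.symm hm1 hm2, if_neg hn, if_neg hyx.symm, Finset.sum_eq_zero]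
    · decide
    · intro z hz
      rw [mem_nbr] at hz
      rw [card_inter_nbr_of_forall, Nat.cast_zero]
      intro t h4 h5
      by_cases hzm : z = m
      · subst hzm
        exact hg.ne_three (by omega) h4 h5 hm2.symm (by rintro rfl; exact hn hz)
          (hg.adj_ne h4).symm rfl
      · refine hg.ne_five (by omega) hz h4 h5 hm2.symm hm1.symm ?_ ?_ ?_ hyx rfl
        · rintro rfl; exact hn h5
        · rintro rfl; exact hn hz
        · rintro rfl
          exact hg.ne_three (by omega) hz h4 hm1.symm (hg.adj_ne hm1) (Ne.symm (hg.adj_ne hz)) rfl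
  · have hnot := Finset.disjoint_right.1 (hg.disjoint_ballTwo_sphereThree (by omega) x) h3
    rw [ballTwo, Finset.mem_insert, Finset.mem_union, mem_nbr, mem_sphereTwo] at hnot
    push Not at hnot
    obtain ⟨hyx, hn, hn2⟩ := hnot
    obtain ⟨z, hz1, t, ⟨htx, hzt⟩, hyz, hty⟩ := mem_sphereThree.1 h3
    rw [if_neg hn, if_neg (Ne.symm hyx), card_inter_nbr_of_forall (fun z h => hn2 z h hyx),
      Finset.sum_eq_single_of_mem z (mem_nbr.2 hz1),
      hg.card_inter_nbr_of_mid hyz.symm hzt hty]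
    · decide
    · intro z' hz' hne
      rw [mem_nbr] at hz'
      rw [card_inter_nbr_of_forall, Nat.cast_zero]
      intro t' h4 h5
      have htx' : t' ≠ x := by rintro rfl; exact hn h5
      have hyz' : y ≠ z' := by rintro rfl; exact hn hz'
      by_cases htt : t = t'
      · subst htt
        exact hg.ne_four (by omega) hz1 hzt h4.symm hz'.symm htx.symm (Ne.symm hne) htx rfl
      · exact hg.ne_six (by omega) hz1 hzt hty h5.symm h4.symm hz'.symm htx.symm hyz.symm htt hyz'
          htx' rfl

/-- There is no cubic graph of girth seven with `22` vertices. -/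
lemma GirthGT.card_ne (hg : w.GirthGT 6) : Fintype.card ι ≠ 22 := by
  intro hcard
  have hpoly := hg.adjMat_poly hcard
  set A := w.adjMat with hA
  set J : Matrix ι ι (ZMod 7) := Matrix.of fun _ _ => 1 with hJ
  have hAJ : A * J = (3 : ZMod 7) • J := by
    ext x y
    rw [hA, hg.adjMat_mul_apply]
    simp [hJ, hg.card_nbr]
  have hAkJ : ∀ k : ℕ, A ^ k * J = (3 ^ k : ZMod 7) • J := by
    intro k
    induction k with
    | zero => simp
    | succ k ih => rw [pow_succ, mul_assoc, hAJ, Matrix.mul_smul, ih, smul_smul, pow_succ, mul_comm]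
  have h22 : (22 : ZMod 7) = 1 := by decide
  have htJ : J.trace = 1 := by
    simp [Matrix.trace, hJ, hcard, h22]
  -- Multiplying the cubic relation by `A ^ k` gives a linear recurrence for the traces, which are
  -- then determined by the orders 0, 1 and 2.
  have hrec : ∀ k : ℕ, (A ^ (k + 3)).trace =
      3 ^ k - (A ^ (k + 2)).trace + 4 * (A ^ (k + 1)).trace + 2 * (A ^ k).trace := by
    intro k
    have : A ^ (k + 3) = (3 ^ k : ZMod 7) • J - A ^ (k + 2) + (4 : ZMod 7) • A ^ (k + 1) +
        (2 : ZMod 7) • A ^ k := by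
      rw [show A ^ (k + 3) = A ^ k * (A * (A * A)) by rw [pow_add, pow_succ A 2, pow_two, mul_assoc],
        hpoly, mul_add, mul_add, mul_sub, hAkJ, Matrix.mul_smul, Matrix.mul_smul, mul_one,
        pow_add A k 2, pow_two, pow_succ]
    rw [this, Matrix.trace_add, Matrix.trace_add, Matrix.trace_sub, Matrix.trace_smul,
      Matrix.trace_smul, Matrix.trace_smul, htJ]
    simp
  have h0 : (A ^ 0).trace = 1 := by simp [hcard, h22]
  have h1 : (A ^ 1).trace = 0 := by
    rw [pow_one]
    exact Finset.sum_eq_zero fun x _ => by simp [hA, adjMat, hg.self]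
  have h2 : (A ^ 2).trace = 3 := by
    rw [pow_two, Matrix.trace]
    simp only [Matrix.diag_apply, hA, hg.adjMat_sq_apply, Finset.inter_self, hg.card_nbr]
    simp [hcard, h22]
  have h3 := hrec 0
  have h4 := hrec 1
  have h5 := hrec 2
  have h6 := hrec 3
  have h7 := hrec 4
  simp only [zero_add, Nat.reduceAdd] at h3 h4 h5 h6 h7
  rw [h0, h1, h2] at h3
  rw [h1, h2, h3] at h4
  rw [h2, h3, h4] at h5
  rw [h3, h4, h5] at h6
  rw [h4, h5, h6] at h7
  have h7' : (A ^ 7).trace = 3 := h7.trans (by decide)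
  have h30 : (3 : ZMod 7) ≠ 0 := by decide
  have : Fact (Nat.Prime 7) := ⟨by norm_num⟩
  -- Over the field with seven elements tr(A⁷) = (tr A)⁷ = 0, whereas the recurrence gives 3.
  have h := ZMod.trace_pow_card (p := 7) A
  rw [h7', ← pow_one A, h1, zero_pow (by norm_num)] at h
  exact h30 h

lemma CyclicSeven.eq_univ_of_cut_eq_zero (hw : w.CyclicSeven) {A : Finset ι} (hA : A.Nonempty)
    (h : w.cut A = 0) : A = Finset.univ := by
  by_contra hne
  have := hw.three_le hA (by
    rw [Finset.nonempty_iff_ne_empty, Ne, Finset.compl_eq_empty_iff]; exact hne)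
  omega

/-- Some path of length four centred at `v` does not extend to a circuit of length seven. -/
theorem CyclicSeven.exists_nonclosing_path (hw : w.CyclicSeven) (hg : w.GirthGT 6) (v : ι) :
    ∃ a b a' b', w.Adj v a ∧ w.Adj v b ∧ a ≠ b ∧ a' ∈ w.children v a ∧ b' ∈ w.children v b ∧
      ∀ k ∈ w.children a a', ∀ l ∈ w.children b b', ¬ w.Adj k l := by
  by_contra hcon
  push Not at hcon
  -- If every path closes, no edge leaves the ball of radius three.
  have hclosed : ∀ t ∈ w.sphereThree v, ∀ u, w.Adj t u → u ∈ w.ballThree v := by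
    intro t ht u htu
    obtain ⟨y, hy, z, ⟨hzv, hyz⟩, hty, hzt⟩ := mem_sphereThree.1 ht
    by_cases huz : u = z
    · subst huz
      exact Finset.mem_union_left _ (Finset.mem_insert_of_mem (Finset.mem_union_right _
        (mem_sphereTwo.2 ⟨y, hy, hzv, hyz⟩)))
    refine Finset.mem_union_right _ ?_
    -- `T` collects the at most four grandchildren of `z`, among them `u`; `Z` consists of the four
    -- vertices at distance two from `v` in the other two branches.
    set T := (w.children y z).biUnion (w.children z) with hT
    set Z := ((w.nbr v).erase y).biUnion (w.children v) with hZ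
    have hTcard : T.card ≤ 4 := by
      refine Finset.card_biUnion_le.trans ?_
      rw [Finset.sum_const_nat (m := 2), hg.card_children hyz]
      intro s hs
      exact hg.card_children (mem_children.1 hs).2
    have hZcard : Z.card = 4 := by
      rw [hZ, Finset.card_biUnion]
      · rw [Finset.sum_const_nat (m := 2), Finset.card_erase_of_mem (mem_nbr.2 hy), hg.card_nbr]
        intro s hs
        exact hg.card_children (mem_nbr.1 (Finset.mem_of_mem_erase hs))
      · intro s hs s' hs' hne
        rw [Function.onFun, Finset.disjoint_left]
        intro r hr hr'
        rw [mem_children] at hr hr'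
        rw [Finset.mem_coe, Finset.mem_erase, mem_nbr] at hs hs'
        exact hg.ne_four (by omega) hs.2 hr.2 hr'.2.symm hs'.2.symm hr.1.symm hne hr.1 rfl
    -- The path z, y, v, y', z' closes by assumption, so some child of `z'` is also a grandchild of
    -- `z`.
    have hex : ∀ z' ∈ Z, ∃ l ∈ T, ∃ y', w.Adj v y' ∧ z' ≠ v ∧ w.Adj y' z' ∧ l ≠ y' ∧ w.Adj z' l := by
      intro z' hz'
      obtain ⟨y', hy', hz''⟩ := Finset.mem_biUnion.1 hz'
      rw [Finset.mem_erase, mem_nbr] at hy'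
      obtain ⟨k, hk, l, hl, hkl⟩ := hcon y y' z z' hy hy'.2 hy'.1.symm (mem_children.2 ⟨hzv, hyz⟩)
        hz''
      rw [mem_children] at hz'' hl hk
      refine ⟨l, Finset.mem_biUnion.2 ⟨k, mem_children.2 hk, mem_children.2 ⟨?_, hkl⟩⟩, y', hy'.2,
        hz''.1, hz''.2, hl⟩
      rintro rfl
      exact hg.ne_five (by omega) hy hyz hl.2.symm hz''.2.symm hy'.2.symm hzv.symm
        (fun h => hg.ne_three (by omega) hy (show w.Adj y y' from h ▸ hz''.2.symm) hy'.2.symm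
          (hg.adj_ne hy'.2) (hg.adj_ne hy).symm rfl) hl.1 hz''.1 rfl
    choose! g hgT y' hy1 hy2 hy3 hy4 hy5 using hex
    -- A coincidence would produce a closed walk of length 4 within a branch or of length 6 across
    -- two branches. Hence `g` is onto `T`, and every grandchild of `z` has distance three from `v`.
    have hinj : Set.InjOn g Z := by
      intro z1 hz1 z2 hz2 h12
      by_contra hne
      have e1 := hy5 z1 hz1
      have e2 := hy5 z2 hz2
      have f1 := hy4 z1 hz1
      rw [h12] at e1 f1
      by_cases hyy : y' z1 = y' z2
      · refine hg.ne_four (by omega) (hy3 z1 hz1) e1 e2.symm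
          (show w.Adj z2 (y' z1) by rw [hyy]; exact (hy3 z2 hz2).symm) f1.symm hne f1 rfl
      · exact hg.ne_six (by omega) (hy1 z1 hz1) (hy3 z1 hz1) e1 e2.symm (hy3 z2 hz2).symm
          (hy1 z2 hz2).symm (hy2 z1 hz1).symm f1.symm hne (hy4 z2 hz2) (hy2 z2 hz2) rfl
    have himg : Z.image g = T := by
      refine Finset.eq_of_subset_of_card_le ?_ ?_
      · intro l hl
        obtain ⟨z', hz', rfl⟩ := Finset.mem_image.1 hl
        exact hgT z' hz'
      · rw [Finset.card_image_of_injOn hinj, hZcard]; exact hTcard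
    have huT : u ∈ T := Finset.mem_biUnion.2
      ⟨t, mem_children.2 ⟨hty, hzt⟩, mem_children.2 ⟨huz, htu⟩⟩
    rw [← himg] at huT
    obtain ⟨z', hz', rfl⟩ := Finset.mem_image.1 huT
    exact mem_sphereThree.2 ⟨y' z', hy1 z' hz', z', ⟨hy2 z' hz', hy3 z' hz'⟩, hy4 z' hz', hy5 z' hz'⟩
  have hclosed2 : ∀ t ∈ w.ballThree v, ∀ u, w.Adj t u → u ∈ w.ballThree v := by
    intro t ht u htu
    rw [ballThree, Finset.mem_union] at ht
    rcases ht with ht | ht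
    · rw [ballTwo, Finset.mem_insert, Finset.mem_union, mem_nbr, mem_sphereTwo] at ht
      rw [ballThree, ballTwo, Finset.mem_union, Finset.mem_insert, Finset.mem_union, mem_nbr,
        mem_sphereTwo, mem_sphereThree]
      by_cases huv : u = v
      · exact Or.inl (Or.inl huv)
      rcases ht with rfl | ht | ⟨y, hy, htv, hyt⟩
      · exact Or.inl (Or.inr (Or.inl htu))
      · exact Or.inl (Or.inr (Or.inr ⟨t, ht, huv, htu⟩))
      · by_cases huy : u = y
        · subst huy
          exact Or.inl (Or.inr (Or.inl hy))
        · exact Or.inr ⟨y, hy, t, ⟨htv, hyt⟩, huy, htu⟩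
    · exact hclosed t ht u htu
  have hcut : w.cut (w.ballThree v) = 0 := by
    refine Finset.sum_eq_zero fun x hx => Finset.sum_eq_zero fun y hy => ?_
    by_contra h0
    exact (Finset.mem_compl.1 hy) (hclosed2 x hx y (Nat.pos_of_ne_zero h0))
  have huniv := hw.eq_univ_of_cut_eq_zero
    (Finset.card_pos.1 (by rw [hg.card_ballThree]; omega)) hcut
  refine hg.card_ne ?_
  rw [← Finset.card_univ, ← huniv, hg.card_ballThree]

end CubicWeight

/-! ### Deleting a path of length four: the almost bipartite structure. -/

namespace CubicWeight

variable {ι : Type*} [Fintype ι] [DecidableEq ι] {w : CubicWeight ι}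

/-- The neighbourhood of radius two of the vertex `v`. -/
structure IsLocalTree (w : CubicWeight ι) (v a b c a' a'' b' b'' c' c'' : ι) : Prop where
  nbr_v : w.nbr v = {a, b, c}
  nbr_a : w.nbr a = {v, a', a''}
  nbr_b : w.nbr b = {v, b', b''}
  nbr_c : w.nbr c = {v, c', c''}

/-- The edges of the path `a', a, v, b, b'`, in both directions. -/
def pathPairs (v a b a' b' : ι) : List (ι × ι) :=
  [(a', a), (a, a'), (a, v), (v, a), (v, b), (b, v), (b, b'), (b', b)]

/-- Adjacency in the path `a', a, v, b, b'`. -/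
def PathRel (v a b a' b' : ι) (x y : ι) : Prop := (x, y) ∈ pathPairs v a b a' b'

lemma pathRel_iff {v a b a' b' x y : ι} : PathRel v a b a' b' x y ↔
    (x = a' ∧ y = a) ∨ (x = a ∧ y = a') ∨ (x = a ∧ y = v) ∨ (x = v ∧ y = a) ∨
    (x = v ∧ y = b) ∨ (x = b ∧ y = v) ∨ (x = b ∧ y = b') ∨ (x = b' ∧ y = b) := by
  simp [PathRel, pathPairs]

lemma PathRel.symm {v a b a' b' x y : ι} (h : PathRel v a b a' b' x y) :
    PathRel v a b a' b' y x := by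
  rw [pathRel_iff] at *
  tauto

lemma ne_of_card_eq_three {x y z : ι} (h : ({x, y, z} : Finset ι).card = 3) :
    x ≠ y ∧ x ≠ z ∧ y ≠ z := by
  refine ⟨?_, ?_, ?_⟩
  · rintro rfl
    rw [Finset.insert_eq_of_mem (by simp)] at h
    have := Finset.card_le_two (a := x) (b := z)
    omega
  · rintro rfl
    rw [Finset.insert_eq_of_mem (by simp)] at h
    have := Finset.card_le_two (a := y) (b := x)
    omega
  · rintro rfl
    rw [Finset.pair_eq_singleton] at h
    have := Finset.card_le_two (a := x) (b := y)
    omega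

lemma exists_eq_insert_of_card_three {s : Finset ι} (h : s.card = 3) {a b : ι} (ha : a ∈ s)
    (hb : b ∈ s) (hab : a ≠ b) : ∃ c, s = {a, b, c} := by
  obtain ⟨c, hc, hca, hcb⟩ := exists_mem_ne_ne_of_card a b h.ge
  refine ⟨c, (Finset.eq_of_subset_of_card_le ?_ ?_).symm⟩
  · intro x hx
    simp only [Finset.mem_insert, Finset.mem_singleton] at hx
    rcases hx with rfl | rfl | rfl <;> assumption
  · rw [h, Finset.card_eq_three.2 ⟨a, b, c, hab, hca.symm, hcb.symm, rfl⟩]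

/-- Every path of length four extends to the neighbourhood of radius two of its centre. -/
lemma GirthGT.exists_isLocalTree {k : ℕ} (hg : w.GirthGT k) {v a b a' b' : ι} (hva : w.Adj v a)
    (hvb : w.Adj v b) (hab : a ≠ b) (haa : a' ∈ w.children v a) (hbb : b' ∈ w.children v b) :
    ∃ c a'' b'' c' c'', w.IsLocalTree v a b c a' a'' b' b'' c' c'' := by
  rw [mem_children] at haa hbb
  obtain ⟨c, hc⟩ := exists_eq_insert_of_card_three (hg.card_nbr v) (mem_nbr.2 hva) (mem_nbr.2 hvb)
    hab
  obtain ⟨a'', ha''⟩ := exists_eq_insert_of_card_three (hg.card_nbr a) (mem_nbr.2 hva.symm)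
    (mem_nbr.2 haa.2) haa.1.symm
  obtain ⟨b'', hb''⟩ := exists_eq_insert_of_card_three (hg.card_nbr b) (mem_nbr.2 hvb.symm)
    (mem_nbr.2 hbb.2) hbb.1.symm
  have hvc : w.Adj v c := by rw [← mem_nbr, hc]; simp
  obtain ⟨c', hc', hcv⟩ := exists_mem_ne_of_card v (s := w.nbr c) (by rw [hg.card_nbr]; omega)
  obtain ⟨c'', hc''⟩ := exists_eq_insert_of_card_three (hg.card_nbr c) (mem_nbr.2 hvc.symm)
    hc' hcv.symm
  exact ⟨c, a'', b'', c', c'', hc, ha'', hb'', hc''⟩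

namespace IsLocalTree

variable {v a b c a' a'' b' b'' c' c'' : ι}

lemma swap (h : w.IsLocalTree v a b c a' a'' b' b'' c' c'') :
    w.IsLocalTree v b a c b' b'' a' a'' c' c'' :=
  ⟨by rw [h.nbr_v]; exact Finset.insert_comm _ _ _, h.nbr_b, h.nbr_a, h.nbr_c⟩

lemma swap_bc (h : w.IsLocalTree v a b c a' a'' b' b'' c' c'') :
    w.IsLocalTree v a c b a' a'' c' c'' b' b'' :=
  ⟨by rw [h.nbr_v]; congr 1; exact Finset.pair_comm _ _, h.nbr_a, h.nbr_c, h.nbr_b⟩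

lemma swap_a (h : w.IsLocalTree v a b c a' a'' b' b'' c' c'') :
    w.IsLocalTree v a b c a'' a' b' b'' c' c'' :=
  ⟨h.nbr_v, by rw [h.nbr_a]; congr 1; exact Finset.pair_comm _ _, h.nbr_b, h.nbr_c⟩

lemma va (h : w.IsLocalTree v a b c a' a'' b' b'' c' c'') : w.Adj v a := by
  rw [← mem_nbr, h.nbr_v]; simp

lemma aa (h : w.IsLocalTree v a b c a' a'' b' b'' c' c'') : w.Adj a a' := by
  rw [← mem_nbr, h.nbr_a]; simp

lemma vb (h : w.IsLocalTree v a b c a' a'' b' b'' c' c'') : w.Adj v b := h.swap.va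
lemma vc (h : w.IsLocalTree v a b c a' a'' b' b'' c' c'') : w.Adj v c := h.swap_bc.vb
lemma aa2 (h : w.IsLocalTree v a b c a' a'' b' b'' c' c'') : w.Adj a a'' := h.swap_a.aa
lemma bb (h : w.IsLocalTree v a b c a' a'' b' b'' c' c'') : w.Adj b b' := h.swap.aa
lemma bb2 (h : w.IsLocalTree v a b c a' a'' b' b'' c' c'') : w.Adj b b'' := h.swap.aa2
lemma cc (h : w.IsLocalTree v a b c a' a'' b' b'' c' c'') : w.Adj c c' := h.swap_bc.bb
lemma cc2 (h : w.IsLocalTree v a b c a' a'' b' b'' c' c'') : w.Adj c c'' := h.swap_bc.bb2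

lemma ne_ab (h : w.IsLocalTree v a b c a' a'' b' b'' c' c'') {k : ℕ} (hg : w.GirthGT k) :
    a ≠ b ∧ a ≠ c ∧ b ≠ c :=
  ne_of_card_eq_three (by rw [← h.nbr_v, hg.card_nbr])

lemma ne_va (h : w.IsLocalTree v a b c a' a'' b' b'' c' c'') {k : ℕ} (hg : w.GirthGT k) :
    v ≠ a' ∧ v ≠ a'' ∧ a' ≠ a'' :=
  ne_of_card_eq_three (by rw [← h.nbr_a, hg.card_nbr])

lemma ne_vb (h : w.IsLocalTree v a b c a' a'' b' b'' c' c'') {k : ℕ} (hg : w.GirthGT k) :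
    v ≠ b' ∧ v ≠ b'' ∧ b' ≠ b'' := h.swap.ne_va hg

lemma ne_vc (h : w.IsLocalTree v a b c a' a'' b' b'' c' c'') {k : ℕ} (hg : w.GirthGT k) :
    v ≠ c' ∧ v ≠ c'' ∧ c' ≠ c'' := h.swap_bc.ne_vb hg

lemma mem_a' (h : w.IsLocalTree v a b c a' a'' b' b'' c' c'') {k : ℕ} (hg : w.GirthGT k) :
    a' ∈ w.children v a := mem_children.2 ⟨(h.ne_va hg).1.symm, h.aa⟩

lemma eq_of_adj_v (h : w.IsLocalTree v a b c a' a'' b' b'' c' c'') {y : ι} (hy : w.Adj v y) :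
    y = a ∨ y = b ∨ y = c := by
  rw [← mem_nbr, h.nbr_v] at hy; simpa using hy

lemma eq_of_adj_a (h : w.IsLocalTree v a b c a' a'' b' b'' c' c'') {y : ι} (hy : w.Adj a y) :
    y = v ∨ y = a' ∨ y = a'' := by
  rw [← mem_nbr, h.nbr_a] at hy; simpa using hy

lemma eq_of_adj_b (h : w.IsLocalTree v a b c a' a'' b' b'' c' c'') {y : ι} (hy : w.Adj b y) :
    y = v ∨ y = b' ∨ y = b'' := h.swap.eq_of_adj_a hy

lemma eq_of_adj_c (h : w.IsLocalTree v a b c a' a'' b' b'' c' c'') {y : ι} (hy : w.Adj c y) :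
    y = v ∨ y = c' ∨ y = c'' := h.swap_bc.eq_of_adj_b hy

/-- A vertex one step away from `v` is different from the vertices two steps away from `v`. -/
lemma level_one_ne_level_two {k : ℕ} (hg : w.GirthGT k) (hk : 3 ≤ k) {v x y z : ι}
    (hx : w.Adj v x) (hy : w.Adj v y) (hz : w.Adj y z) (hzv : v ≠ z) : x ≠ z := by
  rintro rfl
  exact hg.ne_three hk hy hz hx.symm hzv (hg.adj_ne hy).symm rfl

/-- Vertices two steps away from `v` in different branches are different. -/
lemma level_two_ne {k : ℕ} (hg : w.GirthGT k) (hk : 4 ≤ k) {v x y z t : ι}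
    (hx : w.Adj v x) (hy : w.Adj v y) (hz : w.Adj y z) (ht : w.Adj x t) (hxy : x ≠ y)
    (hzv : v ≠ z) : t ≠ z := by
  rintro rfl
  exact hg.ne_four hk hx ht hz.symm hy.symm hzv hxy hzv.symm rfl

/-- If all but one of the neighbours of `o` are joined to `o` by edges of the path, then `o` is an
inner vertex of the path. -/
lemma eq_of_forall_adj (h : w.IsLocalTree v a b c a' a'' b' b'' c' c'') (hg : w.GirthGT 6)
    {o s : ι} (ho : ∀ y, w.Adj o y → PathRel v a b a' b' o y ∨ y = s) :
    (o = a ∧ s = a'') ∨ (o = v ∧ s = c) ∨ (o = b ∧ s = b'') := by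
  obtain ⟨nab, nac, nbc⟩ := h.ne_ab hg
  obtain ⟨va1, va2, na⟩ := h.ne_va hg
  obtain ⟨vb1, vb2, nb⟩ := h.ne_vb hg
  have hva := hg.adj_ne h.va
  have hvb := hg.adj_ne h.vb
  have haa := hg.adj_ne h.aa
  have hbb := hg.adj_ne h.bb
  have hab' := level_one_ne_level_two hg (by omega) h.va h.vb h.bb vb1
  have hab'' := level_one_ne_level_two hg (by omega) h.va h.vb h.bb2 vb2
  have hba' := level_one_ne_level_two hg (by omega) h.vb h.va h.aa va1
  have hba'' := level_one_ne_level_two hg (by omega) h.vb h.va h.aa2 va2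
  have ha'b' := level_two_ne hg (by omega) h.va h.vb h.bb h.aa nab vb1
  by_cases h1 : o = a
  · subst h1
    left
    rcases ho _ h.aa2 with h2 | h2
    · rw [pathRel_iff] at h2
      grind
    · exact ⟨rfl, h2.symm⟩
  by_cases h2 : o = v
  · subst h2
    right; left
    rcases ho _ h.vc with h2 | h2
    · rw [pathRel_iff] at h2
      grind
    · exact ⟨rfl, h2.symm⟩
  by_cases h3 : o = b
  · subst h3
    right; right
    rcases ho _ h.bb2 with h2 | h2
    · rw [pathRel_iff] at h2
      grind
    · exact ⟨rfl, h2.symm⟩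
  exfalso
  -- Outside the three inner vertices the path has at most one edge at `o`, which would leave `o`
  -- with at most two neighbours.
  have key : ∃ t, ∀ y, w.Adj o y → y = t ∨ y = s := by
    by_cases h4 : o = a'
    · refine ⟨a, fun y hy => (ho y hy).imp_left fun h5 => ?_⟩
      rw [pathRel_iff] at h5
      grind
    · refine ⟨b, fun y hy => (ho y hy).imp_left fun h5 => ?_⟩
      rw [pathRel_iff] at h5
      grind
  obtain ⟨t, ht⟩ := key
  have : w.nbr o ⊆ {t, s} := by
    intro y hy
    simpa using ht y (mem_nbr.1 hy)
  have := Finset.card_le_card this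
  have := Finset.card_le_two (a := t) (b := s)
  have := hg.card_nbr o
  omega

end IsLocalTree

lemma sum_sum_if_le_length {k : ℕ} (hg : w.GirthGT k) (l : List (ι × ι)) (A B : Finset ι)
    (h : ∀ x ∈ A, ∀ y ∈ B, w.Adj x y → (x, y) ∈ l) : w.e A B ≤ l.length := by
  rw [e, ← Finset.sum_product']
  refine le_trans ?_ l.toFinset_card_le
  rw [Finset.card_eq_sum_ones, ← Finset.sum_filter_ne_zero]
  refine (Finset.sum_le_sum (g := fun _ => 1) fun p _ => hg.le_one _ _).trans
    (Finset.sum_le_sum_of_subset ?_)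
  intro p hp
  rw [Finset.mem_filter, Finset.mem_product] at hp
  rw [List.mem_toFinset]
  exact h p.1 hp.1.1 p.2 hp.1.2 (Nat.pos_of_ne_zero hp.2)

/-- The four edges of the path, each in two directions. -/
lemma weight_pathRel_le {k : ℕ} (hg : w.GirthGT k) (v a b a' b' : ι) :
    w.weight (PathRel v a b a' b') ≤ 8 := by
  classical
  have h8 : (pathPairs v a b a' b').length = 8 := rfl
  rw [weight, ← Finset.sum_product', ← h8]
  refine le_trans ?_ (pathPairs v a b a' b').toFinset_card_le
  rw [← Finset.sum_filter, Finset.card_eq_sum_ones]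
  refine (Finset.sum_le_sum (g := fun _ => 1) fun p _ => hg.le_one _ _).trans
    (Finset.sum_le_sum_of_subset ?_)
  intro p hp
  rw [List.mem_toFinset]
  exact (Finset.mem_filter.1 hp).2

lemma GirthGT.cut_singleton {k : ℕ} (hg : w.GirthGT k) (x : ι) : w.cut {x} = 3 := by
  have := w.e_self_add_cut {x}
  simp [e, hg.self] at this
  exact this

lemma IsClosedFamily.card_union {X : ι → ι → Prop} {S : Finset ι} {K : Finset (Finset ι)}
    (h : w.IsClosedFamily X S K) :
    (S ∪ K.biUnion id).card = S.card + ∑ A ∈ K, A.card := by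
  rw [Finset.card_union_of_disjoint, Finset.card_biUnion]
  · rfl
  · exact fun A hA B hB hAB => h.disj A hA B hB hAB
  · rw [Finset.disjoint_biUnion_right]
    exact fun A hA => (h.disj_left A hA).symm

lemma even_sum_add_card {κ : Type*} (K : Finset κ) (f : κ → ℕ) (h : ∀ A ∈ K, Odd (f A)) :
    Even (∑ A ∈ K, f A + K.card) := by
  rw [Finset.card_eq_sum_ones, ← Finset.sum_add_distrib]
  exact Finset.even_sum _ fun A hA => (h A hA).add_odd odd_one

/-- A Tutte barrier for the deletion of a path of length four can be chosen to cover all vertices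
with odd parts. -/
lemma exists_closedFamily_cover (hw : w.CyclicSeven) {X : ι → ι → Prop}
    (hX : ∀ x y, X x y → X y x) (hX8 : w.weight X ≤ 8)
    (hno : ¬ ∃ σ, w.IsPM σ ∧ ∀ x, ¬ X x (σ x)) :
    ∃ S K, w.IsClosedFamily X S K ∧ K.card = S.card + 2 ∧ (∀ A ∈ K, Odd A.card) ∧
      S ∪ K.biUnion id = Finset.univ := by
  rcases w.exists_isPM_or_closedFamily X hX with h | ⟨S, K, hK, hlt, hodd⟩
  · exact absurd h hno
  have hnu : ∀ A ∈ K, A ≠ Finset.univ := by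
    rintro A hA rfl
    have h1 := hodd _ hA
    rw [Finset.card_univ, ← Nat.not_even_iff_odd] at h1
    exact h1 w.even_card
  have hcard := hK.card_union
  have hpar := even_sum_add_card K Finset.card hodd
  have heven := w.even_card
  rw [Nat.even_iff] at hpar heven
  -- With weight at most 8 this yields `K.card ≤ S.card + 2`. If vertices are left over, parity
  -- makes their number odd when `K.card = S.card + 1`, and they serve as the missing part; if none
  -- are left, parity itself forces `S.card + 2`.
  have hle := hK.card_le hw hnu
  by_cases hE : (S ∪ K.biUnion id)ᶜ.Nonempty
  · obtain ⟨hK', hnot⟩ := hK.insert_rest hX hE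
    have hEc := Finset.card_compl (S ∪ K.biUnion id)
    have hEle := Finset.card_le_univ (S ∪ K.biUnion id)
    set E := (S ∪ K.biUnion id)ᶜ with hEdef
    have hcK' : (insert E K).card = K.card + 1 := Finset.card_insert_of_notMem hnot
    have hle' := hK'.card_le hw (by
      intro A hA
      rcases Finset.mem_insert.1 hA with rfl | hA
      · intro h
        obtain ⟨B, hB⟩ := Finset.card_pos.1 (lt_of_le_of_lt (Nat.zero_le _) hlt)
        obtain ⟨x, hx⟩ := hK.nonempty B hB
        have hxE : x ∈ E := by rw [h]; exact Finset.mem_univ x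
        rw [hEdef, Finset.mem_compl] at hxE
        exact hxE (Finset.mem_union_right _ (Finset.mem_biUnion.2 ⟨B, hB, hx⟩))
      · exact hnu A hA)
    refine ⟨S, insert E K, hK', by omega, ?_, ?_⟩
    · intro A hA
      rcases Finset.mem_insert.1 hA with rfl | hA
      · rw [Nat.odd_iff]; omega
      · exact hodd A hA
    · rw [Finset.biUnion_insert, id, Finset.union_left_comm, hEdef, Finset.union_comm]
      exact Finset.union_compl _
  · rw [Finset.not_nonempty_iff_eq_empty, Finset.compl_eq_empty_iff] at hE
    refine ⟨S, K, hK, ?_, hodd, hE⟩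
    rw [hE, Finset.card_univ] at hcard
    omega

/-- Three vertices span no triangle, so one of them covers all edges among them. -/
lemma GirthGT.exists_erase_indep (hg : w.GirthGT 6) {A : Finset ι} (hA : A.card = 3) :
    ∃ k ∈ A, ∀ x ∈ A, ∀ y ∈ A, x ≠ k → y ≠ k → ¬ w.Adj x y := by
  obtain ⟨x, y, z, hxy, hxz, hyz, rfl⟩ := Finset.card_eq_three.1 hA
  have hsy : ∀ p q, w.Adj p q → w.Adj q p := fun _ _ h => h.symm
  have hlo : ∀ p, ¬ w.Adj p p := fun _ h => hg.adj_ne h rfl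
  by_cases h1 : w.Adj x y
  · by_cases h2 : w.Adj y z
    · have h3 : ¬ w.Adj x z := fun h => hg.ne_three (by omega) h1 h2 h.symm hxz hxy.symm rfl
      refine ⟨y, by simp, ?_⟩
      intro p hp q hq
      simp only [Finset.mem_insert, Finset.mem_singleton] at hp hq
      grind
    · refine ⟨x, by simp, ?_⟩
      intro p hp q hq
      simp only [Finset.mem_insert, Finset.mem_singleton] at hp hq
      grind
  · refine ⟨z, by simp, ?_⟩
    intro p hp q hq
    simp only [Finset.mem_insert, Finset.mem_singleton] at hp hq
    grind

/-- If no perfect matching avoids the path `a', a, v, b, b'`, then the graph is bipartite up to the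
edges of this path and at most one further edge. -/
theorem exists_almost_bipartition (hw : w.CyclicSeven) (hg : w.GirthGT 6)
    {v a b c a' a'' b' b'' c' c'' : ι} (hT : w.IsLocalTree v a b c a' a'' b' b'' c' c'')
    (hno : ¬ ∃ σ, w.IsPM σ ∧ ∀ x, ¬ PathRel v a b a' b' x (σ x)) :
    ∃ O : Finset ι, O.card = Oᶜ.card + 2 ∧
      ∀ x ∈ O, ∀ y ∈ O, w.Adj x y → PathRel v a b a' b' x y := by
  obtain ⟨S, K, hK, hcK, hodd, hcov⟩ := exists_closedFamily_cover hw (fun _ _ h => h.symm)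
    (weight_pathRel_le hg v a b a' b') hno
  have hsum := hK.sum_cut_le.trans (Nat.add_le_add_left (weight_pathRel_le hg v a b a' b') _)
  have hcu := hK.card_union
  rw [hcov, Finset.card_univ] at hcu
  -- The complement contains `S` and the other `S.card + 1` parts, all nonempty.
  have hcompl : ∀ A ∈ K, 2 * S.card + 1 ≤ Aᶜ.card := by
    intro A hA
    have h1 : ∑ B ∈ K.erase A, 1 ≤ ∑ B ∈ K.erase A, B.card :=
      Finset.sum_le_sum fun B hB => (hK.nonempty B (Finset.mem_of_mem_erase hB)).card_pos
    rw [← Finset.card_eq_sum_ones, Finset.card_erase_of_mem hA] at h1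
    have h2 := Finset.add_sum_erase K Finset.card hA
    have h3 := Finset.card_compl A
    omega
  have hcompl_ne : ∀ A ∈ K, Aᶜ.Nonempty := fun A hA => Finset.card_pos.1 (by
    have := hcompl A hA; omega)
  have h3le : ∀ A ∈ K, 3 ≤ w.cut A := fun A hA => hw.three_le (hK.nonempty A hA) (hcompl_ne A hA)
  -- The total is at most `3 * S.card + 8 = 3 * K.card + 2`. Cuts of odd sets are odd, so at most
  -- one of them is 5 and all others are 3.
  have hsum' : ∑ A ∈ K, (w.cut A - 3) ≤ 2 := by
    have h1 : ∑ A ∈ K, w.cut A = ∑ A ∈ K, (w.cut A - 3) + ∑ A ∈ K, 3 := by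
      rw [← Finset.sum_add_distrib]
      exact Finset.sum_congr rfl fun A hA => (Nat.sub_add_cancel (h3le A hA)).symm
    rw [Finset.sum_const, smul_eq_mul] at h1
    omega
  have hcut : ∀ A ∈ K, w.cut A = 3 ∨ w.cut A = 5 := by
    intro A hA
    have h1 := Finset.single_le_sum (f := fun A => w.cut A - 3) (fun _ _ => Nat.zero_le _) hA
    have h2 := w.cut_odd (hodd A hA)
    have h3 := h3le A hA
    rw [Nat.odd_iff] at h2
    omega
  have hcut_unique : ∀ A ∈ K, ∀ B ∈ K, A ≠ B → w.cut A = 5 → w.cut B = 3 := by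
    intro A hA B hB hAB h5
    have h1 : ∑ A ∈ {A, B}, (w.cut A - 3) ≤ ∑ A ∈ K, (w.cut A - 3) := by
      refine Finset.sum_le_sum_of_subset ?_
      intro C hC
      simp only [Finset.mem_insert, Finset.mem_singleton] at hC
      rcases hC with rfl | rfl <;> assumption
    rw [Finset.sum_pair hAB] at h1
    have := h3le B hB
    omega
  -- the local structure around a singleton
  have hsing_empty : S = ∅ → ∀ z, ({z} : Finset ι) ∉ K := by
    rintro rfl z hz
    -- With `S` empty every edge at `z` would belong to the path. The exceptional neighbour is given
    -- the dummy value `v`, which is none of `a''`, `c`, `b''`.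
    have := hT.eq_of_forall_adj hg (o := z) (s := v) (fun y hy => by
      rcases hK.closed _ hz z (by simp) y hy with h | h | h
      · exact Or.inl h
      · exact absurd (Finset.mem_singleton.1 h).symm (hg.adj_ne hy)
      · simp at h)
    rcases this with h | h | h
    · exact (hT.ne_va hg).2.1 h.2
    · exact hg.adj_ne hT.vc h.2
    · exact (hT.ne_vb hg).2.1 h.2
  have hcard_one : ∀ A ∈ K, w.cut A = 3 → A.card = 1 := by
    intro A hA h3
    have hpos := (hK.nonempty A hA).card_pos
    rcases hw A (hK.nonempty A hA) (hcompl_ne A hA) with h | h | h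
    · omega
    · omega
    · exfalso
      have h1 := hcompl A hA
      have hS : S = ∅ := by rw [← Finset.card_eq_zero]; omega
      obtain ⟨B, hB, hBA⟩ := exists_mem_ne_of_card A (s := K) (by omega)
      have h2 : B ⊆ Aᶜ := by
        intro x hx
        rw [Finset.mem_compl]
        exact Finset.disjoint_left.1 (hK.disj B hB A hA hBA) hx
      have h4 := Finset.card_le_card h2
      have h5 := (hK.nonempty B hB).card_pos
      obtain ⟨z, rfl⟩ := Finset.card_eq_one.1 (show B.card = 1 by omega)
      exact hsing_empty hS z hB
  have hloop : ∀ x y, w.Adj x y → x ≠ y := fun x y h => hg.adj_ne h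
  have hmem : ∀ x, x ∉ S → ∃ A ∈ K, x ∈ A := by
    intro x hx
    have : x ∈ S ∪ K.biUnion id := by rw [hcov]; exact Finset.mem_univ x
    rw [Finset.mem_union, Finset.mem_biUnion] at this
    exact this.resolve_left hx
  by_cases hall : ∀ A ∈ K, w.cut A = 3
  · refine ⟨Sᶜ, ?_, ?_⟩
    · have : ∑ A ∈ K, A.card = ∑ A ∈ K, 1 :=
        Finset.sum_congr rfl fun A hA => hcard_one A hA (hall A hA)
      rw [← Finset.card_eq_sum_ones] at this
      rw [compl_compl, Finset.card_compl]
      omega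
    · intro x hx y hy hxy
      rw [Finset.mem_compl] at hx hy
      obtain ⟨A, hA, hxA⟩ := hmem x hx
      rcases hK.closed A hA x hxA y hxy with h | h | h
      · exact h
      · exact absurd (Finset.card_le_one.1 (hcard_one A hA (hall A hA)).le x hxA y h) (hloop x y hxy)
      · exact absurd h hy
  · push Not at hall
    obtain ⟨A, hA, hA3⟩ := hall
    have hA5 := (hcut A hA).resolve_left hA3
    have hother : ∀ B ∈ K, B ≠ A → B.card = 1 := fun B hB hBA =>
      hcard_one B hB (hcut_unique A hA B hB hBA.symm hA5)
    -- A cut of size 5 allows at most three vertices on one side; one vertex would give a cut of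
    -- size 3. If the complement were the small side, then `S` would have at most one vertex, and
    -- the singleton parts contradict the shape of the path.
    have hAcard : A.card = 3 := by
      rcases hw A (hK.nonempty A hA) (hcompl_ne A hA) with h | h | h
      · omega
      · have h1 := hodd A hA
        rw [Nat.odd_iff] at h1
        have h2 : A.card ≠ 1 := by
          intro h2
          obtain ⟨x, rfl⟩ := Finset.card_eq_one.1 h2
          exact hA3 (hg.cut_singleton x)
        omega
      · exfalso
        have h1 := hcompl A hA
        have h2 : (K.erase A).card = S.card + 1 := by
          rw [Finset.card_erase_of_mem hA]; omega
        have hS0 : S ≠ ∅ := by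
          intro hS
          obtain ⟨B, hB⟩ := Finset.card_pos.1 (show 0 < (K.erase A).card by omega)
          rw [Finset.mem_erase] at hB
          obtain ⟨z, rfl⟩ := Finset.card_eq_one.1 (hother B hB.2 hB.1)
          exact hsing_empty hS z hB.2
        have hS1 : S.card = 1 := by
          have := Finset.card_pos.2 (Finset.nonempty_iff_ne_empty.2 hS0)
          omega
        obtain ⟨s, rfl⟩ := Finset.card_eq_one.1 hS1
        obtain ⟨B, hB, C, hC, hBC⟩ := Finset.one_lt_card.1 (show 1 < (K.erase A).card by omega)
        rw [Finset.mem_erase] at hB hC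
        obtain ⟨o, rfl⟩ := Finset.card_eq_one.1 (hother B hB.2 hB.1)
        obtain ⟨o', rfl⟩ := Finset.card_eq_one.1 (hother C hC.2 hC.1)
        have hloc : ∀ o, ({o} : Finset ι) ∈ K → (o = a ∧ s = a'') ∨ (o = v ∧ s = c) ∨
            (o = b ∧ s = b'') := by
          intro o ho
          refine hT.eq_of_forall_adj hg fun y hy => ?_
          rcases hK.closed _ ho o (by simp) y hy with h | h | h
          · exact Or.inl h
          · exact absurd (Finset.mem_singleton.1 h).symm (hg.adj_ne hy)
          · exact Or.inr (Finset.mem_singleton.1 h)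
        have e1 : a'' ≠ b'' := IsLocalTree.level_two_ne hg (by omega) hT.va hT.vb hT.bb2 hT.aa2
          (hT.ne_ab hg).1 (hT.ne_vb hg).2.1
        have e2 : c ≠ a'' := IsLocalTree.level_one_ne_level_two hg (by omega) hT.vc hT.va hT.aa2
          (hT.ne_va hg).2.1
        have e3 : c ≠ b'' := IsLocalTree.level_one_ne_level_two hg (by omega) hT.vc hT.vb hT.bb2
          (hT.ne_vb hg).2.1
        have f1 := hloc o hB.2
        have f2 := hloc o' hC.2
        have hoo : o ≠ o' := fun h => hBC (by rw [h])
        grind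
    -- Moving `k` to the smaller side keeps the difference 2: the larger side has `S.card + 1`
    -- singletons and two vertices of `A`.
    obtain ⟨k, hkA, hk⟩ := hg.exists_erase_indep hAcard
    have hkS : k ∉ S := Finset.disjoint_left.1 (hK.disj_left A hA) hkA
    refine ⟨(insert k S)ᶜ, ?_, ?_⟩
    · have h1 : ∑ B ∈ K.erase A, B.card = ∑ B ∈ K.erase A, 1 :=
        Finset.sum_congr rfl fun B hB => by
          rw [Finset.mem_erase] at hB
          exact hother B hB.2 hB.1
      rw [← Finset.card_eq_sum_ones, Finset.card_erase_of_mem hA] at h1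
      have h2 := Finset.add_sum_erase K Finset.card hA
      rw [compl_compl, Finset.card_compl, Finset.card_insert_of_notMem hkS]
      omega
    · intro x hx y hy hxy
      rw [Finset.mem_compl, Finset.mem_insert, not_or] at hx hy
      obtain ⟨B, hB, hxB⟩ := hmem x hx.2
      rcases hK.closed B hB x hxB y hxy with h | h | h
      · exact h
      · by_cases hBA : B = A
        · subst hBA
          exact absurd hxy (hk x hxB y h hx.1 hy.1)
        · exact absurd (Finset.card_le_one.1 (hother B hB hBA).le x hxB y h) (hloop x y hxy)
      · exact absurd h hy.2

end CubicWeight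

/-! ### Perfect matchings by Hall's theorem in an almost bipartite graph. -/

namespace CubicWeight

variable {ι : Type*} [Fintype ι] [DecidableEq ι] {w : CubicWeight ι}

/-- A perfect matching whose complement has no circuit of length seven through `v`. -/
structure AvoidsSeven (w : CubicWeight ι) (v : ι) (σ : ι → ι) : Prop where
  isPM : w.IsPM σ
  not_closed : ∀ W : Finset ι, v ∈ W → W.card = 7 → ¬ w.IsFactorClosed σ W

/-- Hall's theorem for a perfect matching that contains the edge `pq` and matches `S` with the
remaining vertices by edges in `R`. -/
lemma exists_isPM_of_hall {S : Finset ι} {p q : ι} (hpq : w.Adj p q) (hne : p ≠ q) (hp : p ∉ S)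
    (hq : q ∉ S) (hcard : Sᶜ.card = S.card + 2) {R : ι → ι → Prop} (hR : ∀ x y, R x y → w.Adj x y)
    (hall : ∀ T ⊆ S, ∀ N ⊆ Sᶜ, p ∉ N → q ∉ N →
      (∀ x ∈ T, ∀ y, R x y → y ∉ S → y ≠ p → y ≠ q → y ∈ N) → T.card ≤ N.card) :
    ∃ σ, w.IsPM σ ∧ σ p = q ∧ (∀ x ∈ S, R x (σ x)) ∧ ∀ x ∉ S, x ≠ p → x ≠ q → σ x ∈ S := by
  classical
  set D := (Sᶜ.erase p).erase q with hD
  have hmemD : ∀ y, y ∈ D ↔ y ≠ q ∧ y ≠ p ∧ y ∉ S := by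
    intro y; simp [hD]
  have hDcard : D.card = S.card := by
    rw [hD, Finset.card_erase_of_mem, Finset.card_erase_of_mem, hcard]
    · omega
    · simpa using hp
    · simp [hq, hne.symm]
  obtain ⟨g, hg, hgR⟩ := (Finset.all_card_le_biUnion_card_iff_exists_injective
    (fun x : S => D.filter (R x))).1 (by
      intro T
      rw [← Finset.card_map (Function.Embedding.subtype _)]
      refine hall _ ?_ _ ?_ ?_ ?_ ?_
      · intro x hx
        obtain ⟨y, -, rfl⟩ := Finset.mem_map.1 hx
        exact y.2
      · intro y hy
        obtain ⟨x, -, hy⟩ := Finset.mem_biUnion.1 hy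
        exact Finset.mem_compl.2 ((hmemD y).1 (Finset.mem_filter.1 hy).1).2.2
      · intro hy
        obtain ⟨x, -, hy⟩ := Finset.mem_biUnion.1 hy
        exact ((hmemD p).1 (Finset.mem_filter.1 hy).1).2.1 rfl
      · intro hy
        obtain ⟨x, -, hy⟩ := Finset.mem_biUnion.1 hy
        exact ((hmemD q).1 (Finset.mem_filter.1 hy).1).1 rfl
      · intro x hx y hxy hyS hyp hyq
        obtain ⟨x, hx', rfl⟩ := Finset.mem_map.1 hx
        exact Finset.mem_biUnion.2 ⟨x, hx', Finset.mem_filter.2 ⟨(hmemD y).2 ⟨hyq, hyp, hyS⟩, hxy⟩⟩)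
  have hgD : ∀ x, g x ∈ D := fun x => (Finset.mem_filter.1 (hgR x)).1
  have hgR' : ∀ x : S, R x (g x) := fun x => (Finset.mem_filter.1 (hgR x)).2
  have himg : Finset.univ.image g = D := by
    refine Finset.eq_of_subset_of_card_le ?_ ?_
    · intro y hy
      obtain ⟨x, -, rfl⟩ := Finset.mem_image.1 hy
      exact hgD x
    · rw [Finset.card_image_of_injective _ hg, Finset.card_univ, Fintype.card_coe, hDcard]
  have hsurj : ∀ y ∈ D, ∃ x, ∃ hx : x ∈ S, g ⟨x, hx⟩ = y := by
    intro y hy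
    rw [← himg] at hy
    obtain ⟨x, -, hx⟩ := Finset.mem_image.1 hy
    exact ⟨x, x.2, hx⟩
  have : Nonempty ι := ⟨p⟩
  choose! g' hg'S hg' using hsurj
  let σ : ι → ι := fun x => if hx : x ∈ S then g ⟨x, hx⟩ else if x = p then q else
    if x = q then p else g' x
  have hσS : ∀ x (hx : x ∈ S), σ x = g ⟨x, hx⟩ := fun x hx => dif_pos hx
  have hσp : σ p = q := by simp [σ, hp]
  have hσq : σ q = p := by simp [σ, hq, hne.symm]
  have hσD : ∀ x ∈ D, σ x = g' x := by
    intro x hx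
    rw [hmemD] at hx
    simp [σ, hx]
  have hcases : ∀ x, x ∈ S ∨ x = p ∨ x = q ∨ x ∈ D := by
    intro x
    rw [hmemD]
    tauto
  have key : ∀ x, w.Adj x (σ x) ∧ σ (σ x) = x := by
    intro x
    rcases hcases x with hx | rfl | rfl | hx
    · rw [hσS x hx]
      refine ⟨hR _ _ (hgR' ⟨x, hx⟩), ?_⟩
      rw [hσD _ (hgD _)]
      exact congrArg Subtype.val (hg (hg' _ (hgD ⟨x, hx⟩)))
    · rw [hσp]
      exact ⟨hpq, hσq⟩
    · rw [hσq]
      exact ⟨hpq.symm, hσp⟩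
    · rw [hσD x hx, hσS _ (hg'S x hx), hg' x hx]
      refine ⟨?_, rfl⟩
      have := hR _ _ (hgR' ⟨g' x, hg'S x hx⟩)
      rw [hg' x hx] at this
      exact this.symm
  have hσne : ∀ x, σ x ≠ x := by
    intro x
    rcases hcases x with hx | rfl | rfl | hx
    · rw [hσS x hx]
      intro h
      exact ((hmemD _).1 (hgD ⟨x, hx⟩)).2.2 (by rw [h]; exact hx)
    · rw [hσp]; exact hne.symm
    · rw [hσq]; exact hne
    · rw [hσD x hx]
      intro h
      exact ((hmemD _).1 hx).2.2 (by rw [← h]; exact hg'S x hx)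
  refine ⟨σ, ⟨fun x => (key x).2, hσne, fun x => (key x).1⟩, hσp, ?_, ?_⟩
  · intro x hx
    rw [hσS x hx]
    exact hgR' ⟨x, hx⟩
  · intro x hx hxp hxq
    have hxD := (hmemD x).2 ⟨hxq, hxp, hx⟩
    rw [hσD x hxD]
    exact hg'S x hxD

lemma cut_union_add {T N : Finset ι} (hd : Disjoint T N) :
    w.cut (T ∪ N) + (w.e T T + w.e N N + 2 * w.e T N) = 3 * (T.card + N.card) := by
  have h := w.e_self_add_cut (T ∪ N)
  rw [Finset.card_union_of_disjoint hd, w.e_union_left hd, w.e_union_right hd, w.e_union_right hd,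
    w.e_comm N T] at h
  omega

/-- An edge from `T` is lost if it misses `N`. When few edges are lost, almost all degrees of `T`
are absorbed by the smaller set `N`, so `T ∪ N` sends out few edges. -/
lemma cut_union_le {T N : Finset ι} (hd : Disjoint T N) (hlt : N.card < T.card) :
    w.cut (T ∪ N) + w.e T T + 3 ≤ 2 * w.e T Nᶜ ∧ 3 * T.card ≤ w.e T Nᶜ + 3 * N.card := by
  have h1 := cut_union_add (w := w) hd
  have h2 := w.e_add_compl T N
  have h3 := w.e_add_compl N T
  rw [w.e_comm N T] at h3
  omega

/-- A set `T` violating Hall's condition cannot have few edges that miss its neighbourhood `N`. -/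
lemma CyclicSeven.not_hall_violator (hw : w.CyclicSeven) (hg : w.GirthGT 6) {T N : Finset ι}
    (hd : Disjoint T N) (hlt : N.card < T.card)
    (hloss : w.e T Nᶜ ≤ 4 ∨ (w.e T Nᶜ ≤ 5 ∧ 2 ≤ w.e T T)) (hbig : 4 ≤ (T ∪ N)ᶜ.card)
    (htwo : ∀ x ∈ T, w.e {x} Nᶜ ≤ 2)
    (hpair : ∀ x ∈ T, ∀ y ∈ T, x ≠ y → 2 ≤ w.e {x} Nᶜ → 2 ≤ w.e {y} Nᶜ →
      ∀ z, w.Adj x z → ¬ w.Adj y z) : False := by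
  obtain ⟨h1, h2⟩ := cut_union_le (w := w) hd hlt
  have hTne : T.Nonempty := Finset.card_pos.1 (by omega)
  have hcu := Finset.card_union_of_disjoint hd
  have h3 : T.card + N.card ≤ 3 := by
    rcases hw (T ∪ N) (hTne.mono Finset.subset_union_left) (Finset.card_pos.1 (by omega)) with
      h | h | h <;> omega
  -- One vertex would lose three edges; two vertices would each lose exactly two and share the only
  -- vertex of `N` as a neighbour.
  obtain ⟨hT, hN⟩ | ⟨hT, hN⟩ : (T.card = 1 ∧ N.card = 0) ∨ (T.card = 2 ∧ N.card = 1) := by omega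
  · obtain ⟨x, rfl⟩ := Finset.card_eq_one.1 hT
    have := htwo x (by simp)
    omega
  · obtain ⟨x, y, hxy, rfl⟩ := Finset.card_eq_two.1 hT
    obtain ⟨z, rfl⟩ := Finset.card_eq_one.1 hN
    have hx := htwo x (by simp)
    have hy := htwo y (by simp)
    have hx' := w.e_add_compl {x} {z}
    have hy' := w.e_add_compl {y} {z}
    simp only [Finset.card_singleton] at hx' hy'
    have hx1 : w.e {x} {z} = w.m x z := by simp [e]
    have hy1 : w.e {y} {z} = w.m y z := by simp [e]
    have hx2 := hg.le_one x z
    have hy2 := hg.le_one y z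
    refine hpair x (by simp) y (by simp) hxy (by omega) (by omega) z ?_ ?_ <;> unfold Adj <;> omega

lemma e_le_length {k : ℕ} (hg : w.GirthGT k) {A B : Finset ι} (l : List (ι × ι))
    (h : ∀ x ∈ A, ∀ y ∈ B, w.Adj x y → (x, y) ∈ l) {n : ℕ} (hn : l.length ≤ n) : w.e A B ≤ n :=
  (sum_sum_if_le_length hg l A B h).trans hn

/-- The case of an almost bipartite graph in which the edge `cc'` can be used to leave the path of
the edges inside the larger part. -/
theorem CyclicSeven.exists_avoidsSeven_of_path (hw : w.CyclicSeven) (hg : w.GirthGT 6)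
    {v a b c a' a'' b' b'' c' c'' : ι} (hT : w.IsLocalTree v a b c a' a'' b' b'' c' c'')
    {S : Finset ι} (hcard : Sᶜ.card = S.card + 2)
    (hO : ∀ x ∉ S, ∀ y ∉ S, w.Adj x y → PathRel v a b a' b' x y)
    (hv : v ∉ S) (ha : a ∉ S) (hb : b ∉ S) (ha' : a' ∉ S) (hc' : c' ∉ S)
    (hS : (∀ x ∈ S, ∀ y ∈ S, ¬ w.Adj x y) ∨ (b' ∉ S ∧ ∃ f g, w.Adj f g ∧ f ≠ c ∧ g ≠ c ∧
      ∀ x ∈ S, ∀ y ∈ S, w.Adj x y → (x = f ∧ y = g) ∨ (x = g ∧ y = f)))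
    (hnc : ∀ k ∈ w.children a a', ∀ l ∈ w.children c c', ¬ w.Adj k l) :
    ∃ σ, w.AvoidsSeven v σ := by
  obtain ⟨nab, nac, nbc⟩ := hT.ne_ab hg
  obtain ⟨va1, va2, na⟩ := hT.ne_va hg
  obtain ⟨vb1, vb2, nb⟩ := hT.ne_vb hg
  obtain ⟨vc1, vc2, nc⟩ := hT.ne_vc hg
  have hva := hg.adj_ne hT.va
  have hvb := hg.adj_ne hT.vb
  have hvc := hg.adj_ne hT.vc
  have haa := hg.adj_ne hT.aa
  have hab' := IsLocalTree.level_one_ne_level_two hg (by omega) hT.va hT.vb hT.bb vb1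
  have hcb' := IsLocalTree.level_one_ne_level_two hg (by omega) hT.vc hT.vb hT.bb vb1
  have hcb'' := IsLocalTree.level_one_ne_level_two hg (by omega) hT.vc hT.vb hT.bb2 vb2
  have hba' := IsLocalTree.level_one_ne_level_two hg (by omega) hT.vb hT.va hT.aa va1
  have hca' := IsLocalTree.level_one_ne_level_two hg (by omega) hT.vc hT.va hT.aa va1
  have hca'' := IsLocalTree.level_one_ne_level_two hg (by omega) hT.vc hT.va hT.aa2 va2
  have hba'' := IsLocalTree.level_one_ne_level_two hg (by omega) hT.vb hT.va hT.aa2 va2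
  have hac' := IsLocalTree.level_one_ne_level_two hg (by omega) hT.va hT.vc hT.cc vc1
  have ha'b' := IsLocalTree.level_two_ne hg (by omega) hT.va hT.vb hT.bb hT.aa nab vb1
  have haS : a'' ∈ S := by
    by_contra h
    have := hO a ha a'' h hT.aa2
    rw [pathRel_iff] at this
    grind
  have hlost : ∀ T ⊆ S, ∀ N : Finset ι,
      (∀ x ∈ T, ∀ y, (w.Adj x y ∧ ¬ (x = c ∧ y = c')) → y ∉ S → y ≠ v → y ≠ b → y ∈ N) →
      ∀ x ∈ T, ∀ y ∈ Nᶜ, w.Adj x y → (y ∈ S ∨ (x = c ∧ y = v) ∨ (x = c ∧ y = c') ∨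
        (x = b'' ∧ y = b) ∨ (x = b' ∧ y = b)) := by
    intro T hTS N hN x hx y hy hxy
    by_cases hyS : y ∈ S
    · exact Or.inl hyS
    have hxS := hTS hx
    by_cases hyv : y = v
    · subst hyv
      rcases hT.eq_of_adj_v hxy.symm with rfl | rfl | rfl
      · exact absurd hxS ha
      · exact absurd hxS hb
      · exact Or.inr (Or.inl ⟨rfl, rfl⟩)
    by_cases hyb : y = b
    · subst hyb
      rcases hT.eq_of_adj_b hxy.symm with rfl | rfl | rfl
      · exact absurd hxS hv
      · simp
      · simp
    by_cases hcc : x = c ∧ y = c'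
    · simp [hcc]
    · exact absurd (hN x hx y ⟨hxy, hcc⟩ hyS hyv hyb) (Finset.mem_compl.1 hy)
  -- Prescribing `vb` puts `va` and `vc` into the factor; forbidding `cc'` puts it there too. The
  -- edge `aa'` lies inside the larger part, whose remaining vertices are all matched into `S`, so
  -- it is in the factor as well.
  obtain ⟨σ, hσ, hσv, hσS, hσO⟩ := exists_isPM_of_hall (w := w) (S := S) hT.vb hvb hv hb hcard
    (R := fun x y => w.Adj x y ∧ ¬ (x = c ∧ y = c')) (fun x y h => h.1) (by
      intro T hTS N hNS hvN hbN hN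
      by_contra! hlt
      have hd : Disjoint T N := by
        rw [Finset.disjoint_left]
        intro x hx hx'
        exact (Finset.mem_compl.1 (hNS hx')) (hTS hx)
      have hlostT := hlost T hTS N hN
      -- Every vertex outside `S` other than `v` and `b` has a neighbour in `S` different from `c`,
      -- so `T = S` is no violation. Without this strictness the complement of `T ∪ N` could have
      -- only three vertices.
      have hproper : T ≠ S := by
        rintro rfl
        have hsub : (Tᶜ.erase v).erase b ⊆ N := by
          intro y hy
          simp only [Finset.mem_erase, Finset.mem_compl] at hy
          obtain ⟨hyb, hyv, hyT⟩ := hy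
          obtain ⟨x, hxT, hxy, hxc⟩ : ∃ x, x ∈ T ∧ w.Adj x y ∧ x ≠ c := by
            by_cases hya : y = a
            · subst hya
              exact ⟨a'', haS, hT.aa2.symm, hca''.symm⟩
            · by_cases hya' : y = a'
              · obtain ⟨x, hx, hxc, hxa⟩ := exists_mem_ne_ne_of_card c a (hg.card_nbr y).ge
                rw [mem_nbr] at hx
                refine ⟨x, ?_, hx.symm, hxc⟩
                by_contra hxT
                have := hO y hyT x hxT hx
                rw [pathRel_iff] at this
                grind
              · obtain ⟨x, hx, hxc, hxb⟩ := exists_mem_ne_ne_of_card c b (hg.card_nbr y).ge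
                rw [mem_nbr] at hx
                refine ⟨x, ?_, hx.symm, hxc⟩
                by_contra hxT
                have := hO y hyT x hxT hx
                rw [pathRel_iff] at this
                grind
          exact hN x hxT y ⟨hxy, fun h => hxc h.1⟩ hyT hyv hyb
        have := Finset.card_le_card hsub
        rw [Finset.card_erase_of_mem (by simp [hb, hvb.symm]),
          Finset.card_erase_of_mem (by simpa using hv)] at this
        omega
      have hTcard := Finset.card_lt_card (Finset.ssubset_iff_subset_ne.2 ⟨hTS, hproper⟩)
      have hbig : 4 ≤ (T ∪ N)ᶜ.card := by
        have h1 := Finset.card_compl (T ∪ N)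
        have h2 := Finset.card_compl S
        rw [Finset.card_union_of_disjoint hd] at h1
        omega
      rcases hS with hS | ⟨hb', f, g, hfg, hfc, hgc, hS⟩
      · have hlost' : ∀ x ∈ T, ∀ y ∈ Nᶜ, w.Adj x y → ((x = c ∧ y = v) ∨ (x = c ∧ y = c') ∨
            (x = b'' ∧ y = b) ∨ (x = b' ∧ y = b)) := fun x hx y hy hxy =>
          (hlostT x hx y hy hxy).resolve_left fun hyS => hS x (hTS hx) y hyS hxy
        have hone : ∀ x ∈ T, x ≠ c → w.e {x} Nᶜ ≤ 1 := by
          intro x hx hxc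
          refine e_le_length hg [(x, b)] ?_ le_rfl
          intro z hz y hy hzy
          rw [Finset.mem_singleton] at hz
          subst hz
          have := hlost' z hx y hy hzy
          simp only [List.mem_singleton, Prod.mk.injEq, true_and]
          tauto
        refine hw.not_hall_violator hg hd hlt (Or.inl ?_) hbig ?_ ?_
        · refine e_le_length hg [(c, v), (c, c'), (b'', b), (b', b)] ?_ le_rfl
          intro x hx y hy hxy
          simpa using hlost' x hx y hy hxy
        · intro x hx
          by_cases hxc : x = c
          · subst hxc
            refine e_le_length hg [(x, v), (x, c')] ?_ le_rfl
            intro z hz y hy hzy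
            rw [Finset.mem_singleton] at hz
            subst hz
            have := hlost' z hx y hy hzy
            simp only [List.mem_cons, Prod.mk.injEq, List.not_mem_nil, or_false, true_and]
            tauto
          · have := hone x hx hxc
            omega
        · intro x hx y hy hxy h1 h2
          by_cases hxc : x = c
          · have := hone y hy fun h => hxy (hxc.trans h.symm)
            omega
          · have := hone x hx hxc
            omega
      · have hlost' : ∀ x ∈ T, ∀ y ∈ Nᶜ, w.Adj x y → ((x = c ∧ y = v) ∨ (x = c ∧ y = c') ∨
            (x = b'' ∧ y = b) ∨ (x = f ∧ y = g) ∨ (x = g ∧ y = f)) := by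
          intro x hx y hy hxy
          rcases hlostT x hx y hy hxy with h | h | h | h | h
          · rcases hS x (hTS hx) y h hxy with h | h <;> simp [h]
          · simp [h]
          · simp [h]
          · simp [h]
          · rw [h.1] at hx
            exact absurd (hTS hx) hb'
        have hfg' := hg.adj_ne hfg
        have hone : ∀ x ∈ T, x ≠ c → x ≠ b'' → w.e {x} Nᶜ ≤ 1 := by
          intro x hx hxc hxb
          refine e_le_length hg [if x = f then (x, g) else (x, f)] ?_ le_rfl
          intro z hz y hy hzy
          rw [Finset.mem_singleton] at hz
          subst hz
          have := hlost' z hx y hy hzy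
          rw [List.mem_singleton]
          split_ifs with hzf
          · rw [Prod.mk.injEq]
            grind
          · rw [Prod.mk.injEq]
            grind
        refine hw.not_hall_violator hg hd hlt ?_ hbig ?_ ?_
        -- The inner edge can be lost in both directions only if both its ends lie in `T`; then it
        -- contributes 2 to `w.e T T`, which compensates for the fifth lost edge.
        · by_cases hf : f ∈ T
          · by_cases hgT : g ∈ T
            · right
              constructor
              · refine e_le_length hg [(c, v), (c, c'), (b'', b), (f, g), (g, f)] ?_ le_rfl
                intro x hx y hy hxy
                simpa using hlost' x hx y hy hxy
              · have h1 : w.e {f} {g} + w.e {g} {f} ≤ w.e T T := by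
                  have hdis : Disjoint ({f} : Finset ι) {g} := by simpa using hfg'
                  refine le_trans (add_le_add (w.e_mono_right (B := T) ?_ _)
                    (w.e_mono_right (B := T) ?_ _)) ?_
                  · simpa using hgT
                  · simpa using hf
                  · rw [← w.e_union_left hdis]
                    refine w.e_mono_left ?_ _
                    intro x hx
                    simp only [Finset.mem_union, Finset.mem_singleton] at hx
                    rcases hx with rfl | rfl <;> assumption
                have h2 : 0 < w.m f g := hfg
                have h3 : 0 < w.m g f := hfg.symm
                simp only [e, Finset.sum_singleton] at h1
                simp only [e]
                omega
            · left
              refine e_le_length hg [(c, v), (c, c'), (b'', b), (f, g)] ?_ le_rfl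
              intro x hx y hy hxy
              have := hlost' x hx y hy hxy
              simp only [List.mem_cons, Prod.mk.injEq, List.not_mem_nil, or_false]
              grind
          · left
            refine e_le_length hg [(c, v), (c, c'), (b'', b), (g, f)] ?_ le_rfl
            intro x hx y hy hxy
            have := hlost' x hx y hy hxy
            simp only [List.mem_cons, Prod.mk.injEq, List.not_mem_nil, or_false]
            grind
        · intro x hx
          by_cases hxc : x = c
          · subst hxc
            refine e_le_length hg [(x, v), (x, c')] ?_ le_rfl
            intro z hz y hy hzy
            rw [Finset.mem_singleton] at hz
            subst hz
            have := hlost' z hx y hy hzy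
            simp only [List.mem_cons, Prod.mk.injEq, List.not_mem_nil, or_false, true_and]
            grind
          · refine e_le_length hg [(x, b), if x = f then (x, g) else (x, f)] ?_ le_rfl
            intro z hz y hy hzy
            rw [Finset.mem_singleton] at hz
            subst hz
            have := hlost' z hx y hy hzy
            split_ifs with hzf <;>
            simp only [List.mem_cons, Prod.mk.injEq, List.not_mem_nil, or_false, true_and] <;> grind
        -- Only `c` and `b''` can lose two edges, and a common neighbour of theirs would close a
        -- circuit of length 5 through `v` and `b`.
        · have hcb : ∀ z, w.Adj c z → ¬ w.Adj b'' z := by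
            intro z h1 h2
            refine hg.ne_five (by omega) hT.vc h1 h2.symm hT.bb2.symm hT.vb.symm ?_ hcb'' ?_
              vb2.symm rfl
            · rintro rfl
              exact hg.ne_three (by omega) hT.vb hT.bb2 h2 vb2 hvb.symm rfl
            · rintro rfl
              exact hg.ne_three (by omega) hT.vc h1 hT.vb.symm hvb hvc.symm rfl
          intro x hx y hy hxy h1 h2 z hxz hyz
          have h3 : x = c ∨ x = b'' := by
            by_contra! h
            have := hone x hx h.1 h.2
            omega
          have h4 : y = c ∨ y = b'' := by
            by_contra! h
            have := hone y hy h.1 h.2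
            omega
          rcases h3 with rfl | rfl <;> rcases h4 with rfl | rfl
          · exact hxy rfl
          · exact hcb z hxz hyz
          · exact hcb z hyz hxz
          · exact hxy rfl)
  refine ⟨σ, hσ, fun W hvW hW hcl => ?_⟩
  have hcS : c ∈ S := by
    by_contra h
    have := hO v hv c h hT.vc
    rw [pathRel_iff] at this
    grind
  obtain ⟨k, hk, l, hl, -, -, hkl⟩ := hg.exists_adj_of_isFactorClosed hT.va hT.vc nac
    (hT.mem_a' hg) (mem_children.2 ⟨vc1.symm, hT.cc⟩) (by rw [hσv]; exact nab.symm)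
    (by rw [hσv]; exact nbc) (fun h => ha' (h ▸ hσO a ha hva.symm nab))
    (fun h => (hσS c hcS).2 ⟨rfl, h⟩) hvW hW hcl
  exact hnc k hk l hl hkl

end CubicWeight

/-! ### The case of three edges inside the larger part, one in each branch. -/

namespace CubicWeight

variable {ι : Type*} [Fintype ι] [DecidableEq ι] {w : CubicWeight ι}

/-- Of two siblings, one has no neighbour among the children of a given nonadjacent vertex. -/
lemma GirthGT.exists_child_not_adj (hg : w.GirthGT 6) {a a'' b b' : ι} (ha : w.Adj a a'')
    (hnadj : ¬ w.Adj a'' b') :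
    ∃ t s, t ≠ s ∧ w.nbr a'' = {a, t, s} ∧ ∀ l ∈ w.children b b', ¬ w.Adj t l := by
  obtain ⟨t, ht, hta⟩ := exists_mem_ne_of_card a (s := w.nbr a'') (by rw [hg.card_nbr]; omega)
  obtain ⟨s, hs⟩ := exists_eq_insert_of_card_three (hg.card_nbr a'') (mem_nbr.2 ha.symm) ht
    hta.symm
  obtain ⟨hat, has, hts⟩ := ne_of_card_eq_three (by rw [← hs, hg.card_nbr])
  have ht' : w.Adj a'' t := mem_nbr.1 ht
  have hs' : w.Adj a'' s := by rw [← mem_nbr, hs]; simp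
  by_cases h : ∀ l ∈ w.children b b', ¬ w.Adj t l
  · exact ⟨t, s, hts, hs, h⟩
  -- If both siblings had such neighbours, there would be a closed walk of length 4 through `a''` or
  -- of length 6 through `a''` and `b'`.
  refine ⟨s, t, hts.symm, by rw [hs]; congr 1; exact Finset.pair_comm _ _, ?_⟩
  push Not at h
  obtain ⟨l, hl, htl⟩ := h
  intro l' hl' hsl'
  rw [mem_children] at hl hl'
  have h1 : ∀ z, w.Adj b' z → a'' ≠ z := by
    rintro z hz rfl
    exact hnadj hz.symm
  by_cases hll : l = l'
  · subst hll
    exact hg.ne_four (by omega) hs' hsl' htl.symm ht'.symm (h1 _ hl.2) hts.symm (h1 _ hl.2).symm rfl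
  · exact hg.ne_six (by omega) hs' hsl' hl'.2.symm hl.2 htl.symm ht'.symm (h1 _ hl'.2)
      (by rintro rfl; exact hnadj hs') (Ne.symm hll) (by rintro rfl; exact hnadj ht')
      (h1 _ hl.2).symm rfl

/-- The case of a graph that is bipartite up to one edge at distance one from `v` in each of the
three branches at `v`. -/
theorem CyclicSeven.exists_avoidsSeven_of_claw (hw : w.CyclicSeven) (hg : w.GirthGT 6)
    {v a b c a' a'' b' b'' c' c'' : ι} (hT : w.IsLocalTree v a b c a' a'' b' b'' c' c'')
    {S : Finset ι} (hcard : Sᶜ.card = S.card + 2)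
    (hO : ∀ x ∉ S, ∀ y ∉ S, w.Adj x y → (x = a ∧ y = a') ∨ (x = a' ∧ y = a) ∨
      (x = b ∧ y = b') ∨ (x = b' ∧ y = b) ∨ (x = c ∧ y = c') ∨ (x = c' ∧ y = c))
    (hS : ∀ x ∈ S, ∀ y ∈ S, ¬ w.Adj x y)
    (hv : v ∈ S) (ha' : a' ∉ S) (hb' : b' ∉ S) (hc' : c' ∉ S) :
    ∃ σ, w.AvoidsSeven v σ := by
  obtain ⟨nab, nac, nbc⟩ := hT.ne_ab hg
  obtain ⟨va1, va2, na⟩ := hT.ne_va hg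
  obtain ⟨vb1, vb2, nb⟩ := hT.ne_vb hg
  obtain ⟨vc1, vc2, nc⟩ := hT.ne_vc hg
  have hva := hg.adj_ne hT.va
  have hvb := hg.adj_ne hT.vb
  have hvc := hg.adj_ne hT.vc
  have haa := hg.adj_ne hT.aa
  have hbb := hg.adj_ne hT.bb
  have hab' := IsLocalTree.level_one_ne_level_two hg (by omega) hT.va hT.vb hT.bb vb1
  have hab'' := IsLocalTree.level_one_ne_level_two hg (by omega) hT.va hT.vb hT.bb2 vb2
  have hba' := IsLocalTree.level_one_ne_level_two hg (by omega) hT.vb hT.va hT.aa va1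
  have hba'' := IsLocalTree.level_one_ne_level_two hg (by omega) hT.vb hT.va hT.aa2 va2
  have hca' := IsLocalTree.level_one_ne_level_two hg (by omega) hT.vc hT.va hT.aa va1
  have hca'' := IsLocalTree.level_one_ne_level_two hg (by omega) hT.vc hT.va hT.aa2 va2
  have hcb' := IsLocalTree.level_one_ne_level_two hg (by omega) hT.vc hT.vb hT.bb vb1
  have hcb'' := IsLocalTree.level_one_ne_level_two hg (by omega) hT.vc hT.vb hT.bb2 vb2
  have hac' := IsLocalTree.level_one_ne_level_two hg (by omega) hT.va hT.vc hT.cc vc1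
  have hbc' := IsLocalTree.level_one_ne_level_two hg (by omega) hT.vb hT.vc hT.cc vc1
  have ha'c' := IsLocalTree.level_two_ne hg (by omega) hT.va hT.vc hT.cc hT.aa nac vc1
  have hb'c' := IsLocalTree.level_two_ne hg (by omega) hT.vb hT.vc hT.cc hT.bb nbc vc1
  have ha'b' := IsLocalTree.level_two_ne hg (by omega) hT.va hT.vb hT.bb hT.aa nab vb1
  have ha''b'' := IsLocalTree.level_two_ne hg (by omega) hT.va hT.vb hT.bb2 hT.aa2 nab vb2
  have ha''b' := IsLocalTree.level_two_ne hg (by omega) hT.va hT.vb hT.bb hT.aa2 nab vb1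
  have ha''c'' := IsLocalTree.level_two_ne hg (by omega) hT.va hT.vc hT.cc2 hT.aa2 nac vc2
  have ha : a ∉ S := fun h => hS v hv a h hT.va
  have hb : b ∉ S := fun h => hS v hv b h hT.vb
  have hc : c ∉ S := fun h => hS v hv c h hT.vc
  have haS : a'' ∈ S := by
    by_contra h
    have := hO a ha a'' h hT.aa2
    grind
  have hbS : b'' ∈ S := by
    by_contra h
    have := hO b hb b'' h hT.bb2
    grind
  obtain ⟨t, s, hts, hnt, htl⟩ := hg.exists_child_not_adj (b := b) (b' := b') hT.aa2 (by
    intro h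
    exact hg.ne_five (by omega) hT.va hT.aa2 h hT.bb.symm hT.vb.symm va2 hab' hba''.symm
      vb1.symm rfl)
  obtain ⟨p, hp, hpa⟩ := exists_mem_ne_of_card a (s := w.nbr a') (by rw [hg.card_nbr]; omega)
  obtain ⟨q, hpq⟩ := exists_eq_insert_of_card_three (hg.card_nbr a') (mem_nbr.2 hT.aa.symm) hp
    hpa.symm
  obtain ⟨hap, haq, hpq'⟩ := ne_of_card_eq_three (by rw [← hpq, hg.card_nbr])
  have hp' : w.Adj a' p := mem_nbr.1 hp
  have hq' : w.Adj a' q := by rw [← mem_nbr, hpq]; simp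
  have hchild : ∀ r, w.Adj a' r → r ≠ a → r ≠ a'' ∧ r ≠ c'' := by
    intro r hr hra
    refine ⟨?_, ?_⟩
    · rintro rfl
      exact hg.ne_three (by omega) hT.aa hr hT.aa2.symm hra.symm haa.symm rfl
    · rintro rfl
      exact hg.ne_five (by omega) hT.va hT.aa hr hT.cc2.symm hT.vc.symm va1 hra.symm hca'.symm
        vc2.symm rfl
  obtain ⟨hpa'', hpc''⟩ := hchild p hp' hpa
  obtain ⟨hqa'', hqc''⟩ := hchild q hq' haq.symm
  -- With `aa'` and `vc` in the matching, the factor contains a'' a v b b'. Forbidding `a''t` leaves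
  -- `s` as the partner of `a''`, so the path continues to `t`, which has no neighbour among the
  -- children of `b'`.
  obtain ⟨σ, hσ, hσa, hσS, hσO⟩ := exists_isPM_of_hall (w := w) (S := S) hT.aa haa ha ha' hcard
    (R := fun x y => w.Adj x y ∧ (x = v → y = c) ∧ ¬ (x = a'' ∧ y = t)) (fun x y h => h.1) (by
      intro T₀ hTS N₀ hNS haN ha'N hN
      by_contra! hlt₀
      -- The only permitted partner of `v` is `c`, so deleting both from a violating pair keeps it
      -- violating.
      set T := T₀.erase v with hTdef
      set N := N₀.erase c with hNdef
      have hlt : N.card < T.card := by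
        by_cases hvT : v ∈ T₀
        · have hcN : c ∈ N₀ := hN v hvT c ⟨hT.vc, fun _ => rfl, fun h => va2 h.1⟩ hc nac.symm hca'
          rw [hTdef, hNdef, Finset.card_erase_of_mem hvT, Finset.card_erase_of_mem hcN]
          have := Finset.card_pos.2 ⟨c, hcN⟩
          omega
        · rw [hTdef, Finset.erase_eq_of_notMem hvT]
          exact lt_of_le_of_lt (Finset.card_le_card (Finset.erase_subset _ _)) hlt₀
      have hTS' : T ⊆ S.erase v := Finset.erase_subset_erase v hTS
      have hd : Disjoint T N := by
        rw [Finset.disjoint_left]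
        intro x hx hx'
        exact (Finset.mem_compl.1 (hNS (Finset.mem_of_mem_erase hx')))
          (hTS (Finset.mem_of_mem_erase hx))
      have hlost : ∀ x ∈ T, ∀ y ∈ Nᶜ, w.Adj x y → ((x = a'' ∧ y = a) ∨ (x = a'' ∧ y = t) ∨
          (x = p ∧ y = a') ∨ (x = q ∧ y = a') ∨ (x = c'' ∧ y = c)) := by
        intro x hx y hy hxy
        rw [hTdef, Finset.mem_erase] at hx
        rw [hNdef, Finset.mem_compl, Finset.mem_erase, not_and] at hy
        have hxS := hTS hx.2
        have hyS : y ∉ S := fun h => hS x hxS y h hxy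
        by_cases hya : y = a
        · subst hya
          rcases hT.eq_of_adj_a hxy.symm with rfl | rfl | rfl
          · exact absurd rfl hx.1
          · exact absurd hxS ha'
          · simp
        by_cases hya' : y = a'
        · subst hya'
          have := mem_nbr.2 hxy.symm
          rw [hpq] at this
          simp only [Finset.mem_insert, Finset.mem_singleton] at this
          rcases this with rfl | rfl | rfl
          · exact absurd hxS ha
          · simp
          · simp
        by_cases hyc : y = c
        · subst hyc
          rcases hT.eq_of_adj_c hxy.symm with rfl | rfl | rfl
          · exact absurd rfl hx.1
          · exact absurd hxS hc'
          · simp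
        by_cases hat : x = a'' ∧ y = t
        · simp [hat]
        · exact absurd (hN x hx.2 y ⟨hxy, fun h => absurd h hx.1, hat⟩ hyS hya hya') (hy hyc)
      have hproper : T ≠ S.erase v := by
        intro hTeq
        have hsub : ((Sᶜ.erase a).erase a').erase c ⊆ N := by
          intro y hy
          simp only [Finset.mem_erase, Finset.mem_compl] at hy
          obtain ⟨hyc, hya', hya, hyS⟩ := hy
          obtain ⟨x, hxS, hxy, hxa, hxv⟩ : ∃ x, x ∈ S ∧ w.Adj x y ∧ x ≠ a'' ∧ x ≠ v := by
            by_cases hyb : y = b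
            · subst hyb
              exact ⟨b'', hbS, hT.bb2.symm, ha''b''.symm, vb2.symm⟩
            · have hyv : ¬ w.Adj v y := fun h => by
                rcases hT.eq_of_adj_v h with h | h | h
                exacts [hya h, hyb h, hyc h]
              by_cases hyb' : y = b'
              · obtain ⟨x, hx, hxb, hxa⟩ := exists_mem_ne_ne_of_card b a'' (hg.card_nbr y).ge
                rw [mem_nbr] at hx
                refine ⟨x, ?_, hx.symm, hxa, ?_⟩
                · by_contra hxT
                  have := hO y hyS x hxT hx
                  grind
                · rintro rfl
                  exact hyv hx.symm
              · obtain ⟨x, hx, hxb, hxa⟩ := exists_mem_ne_ne_of_card c a'' (hg.card_nbr y).ge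
                rw [mem_nbr] at hx
                refine ⟨x, ?_, hx.symm, hxa, ?_⟩
                · by_contra hxT
                  have := hO y hyS x hxT hx
                  grind
                · rintro rfl
                  exact hyv hx.symm
          have hxT : x ∈ T := by rw [hTeq, Finset.mem_erase]; exact ⟨hxv, hxS⟩
          exact Finset.mem_erase.2 ⟨hyc, hN x (Finset.mem_of_mem_erase hxT) y
            ⟨hxy, fun h => absurd h hxv, fun h => hxa h.1⟩ hyS hya hya'⟩
        have h1 := Finset.card_le_card hsub
        rw [Finset.card_erase_of_mem (by simp [hc, hca', nac.symm]),
          Finset.card_erase_of_mem (by simp [ha', haa.symm]),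
          Finset.card_erase_of_mem (by simpa using ha)] at h1
        rw [hTeq, Finset.card_erase_of_mem hv] at hlt
        omega
      have hTcard := Finset.card_lt_card (Finset.ssubset_iff_subset_ne.2 ⟨hTS', hproper⟩)
      rw [Finset.card_erase_of_mem hv] at hTcard
      have hbig : 7 ≤ (T ∪ N)ᶜ.card := by
        have h1 := Finset.card_compl (T ∪ N)
        have h2 := Finset.card_compl S
        rw [Finset.card_union_of_disjoint hd] at h1
        omega
      have hone : ∀ x ∈ T, x ≠ a'' → w.e {x} Nᶜ ≤ 1 := by
        intro x hx hxa
        refine e_le_length hg [if x = c'' then (x, c) else (x, a')] ?_ le_rfl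
        intro z hz y hy hzy
        rw [Finset.mem_singleton] at hz
        subst hz
        have := hlost z hx y hy hzy
        rw [List.mem_singleton]
        split_ifs with hzf
        · rw [Prod.mk.injEq]
          grind
        · rw [Prod.mk.injEq]
          grind
      by_cases h5 : w.e T Nᶜ ≤ 4
      · refine hw.not_hall_violator hg hd hlt (Or.inl h5) (by omega) ?_ ?_
        · intro x hx
          by_cases hxa : x = a''
          · subst hxa
            refine e_le_length hg [(x, a), (x, t)] ?_ le_rfl
            intro z hz y hy hzy
            rw [Finset.mem_singleton] at hz
            subst hz
            have := hlost z hx y hy hzy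
            simp only [List.mem_cons, Prod.mk.injEq, List.not_mem_nil, or_false, true_and]
            grind
          · have := hone x hx hxa
            omega
        · intro x hx y hy hxy h1 h2
          by_cases hxa : x = a''
          · have := hone y hy fun h => hxy (hxa.trans h.symm)
            omega
          · have := hone x hx hxa
            omega
      -- With five lost edges the cut of `T ∪ N` is only bounded by 7, which is no contradiction
      -- yet. But then all five edges start in `T`, and three of them end in `{a, a'}`.
      · have hle : w.e T Nᶜ ≤ 5 := by
          refine e_le_length hg [(a'', a), (a'', t), (p, a'), (q, a'), (c'', c)] ?_ le_rfl
          intro x hx y hy hxy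
          simpa using hlost x hx y hy hxy
        have hmem : a'' ∈ T ∧ p ∈ T ∧ q ∈ T ∧ c'' ∈ T := by
          refine ⟨?_, ?_, ?_, ?_⟩
          · by_contra h
            refine h5 (e_le_length hg [(p, a'), (q, a'), (c'', c)] ?_ (by simp))
            intro x hx y hy hxy
            have := hlost x hx y hy hxy
            simp only [List.mem_cons, Prod.mk.injEq, List.not_mem_nil, or_false]
            grind
          · by_contra h
            refine h5 (e_le_length hg [(a'', a), (a'', t), (q, a'), (c'', c)] ?_ (by simp))
            intro x hx y hy hxy
            have := hlost x hx y hy hxy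
            simp only [List.mem_cons, Prod.mk.injEq, List.not_mem_nil, or_false]
            grind
          · by_contra h
            refine h5 (e_le_length hg [(a'', a), (a'', t), (p, a'), (c'', c)] ?_ (by simp))
            intro x hx y hy hxy
            have := hlost x hx y hy hxy
            simp only [List.mem_cons, Prod.mk.injEq, List.not_mem_nil, or_false]
            grind
          · by_contra h
            refine h5 (e_le_length hg [(a'', a), (a'', t), (p, a'), (q, a')] ?_ (by simp))
            intro x hx y hy hxy
            have := hlost x hx y hy hxy
            simp only [List.mem_cons, Prod.mk.injEq, List.not_mem_nil, or_false]
            grind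
        obtain ⟨hm1, hm2, hm3, hm4⟩ := hmem
        obtain ⟨hcut, -⟩ := cut_union_le (w := w) hd hlt
        have hdA : Disjoint (T ∪ N) {a, a'} := by
          rw [Finset.disjoint_right]
          intro x hx
          rw [Finset.mem_union, not_or]
          have hxS : x ∉ S ∧ x ∉ N₀ := by
            simp only [Finset.mem_insert, Finset.mem_singleton] at hx
            rcases hx with rfl | rfl
            exacts [⟨ha, haN⟩, ⟨ha', ha'N⟩]
          exact ⟨fun h => hxS.1 (hTS (Finset.mem_of_mem_erase h)),
            fun h => hxS.2 (Finset.mem_of_mem_erase h)⟩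
        have hcu := cut_union_add (w := w) hdA
        have hself := w.e_self_add_cut (T ∪ N)
        have hpair : ({a, a'} : Finset ι).card = 2 := Finset.card_pair haa
        have hAA : 2 ≤ w.e {a, a'} {a, a'} := by
          have h1 : 0 < w.m a a' := hT.aa
          have h2 : 0 < w.m a' a := hT.aa.symm
          simp only [e, Finset.sum_pair haa]
          omega
        have hsub : ({a'', p, q} : Finset ι) ⊆ T ∪ N := by
          intro x hx
          simp only [Finset.mem_insert, Finset.mem_singleton] at hx
          refine Finset.mem_union_left _ ?_
          rcases hx with rfl | rfl | rfl <;> assumption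
        have hTA : 3 ≤ w.e (T ∪ N) {a, a'} := by
          refine le_trans ?_ (w.e_mono_left hsub _)
          have h1 : 0 < w.m a'' a := hT.aa2.symm
          have h2 : 0 < w.m p a' := hp'.symm
          have h3 : 0 < w.m q a' := hq'.symm
          simp only [e, Finset.sum_pair haa]
          rw [Finset.sum_insert (by simp [hpa''.symm, hqa''.symm]), Finset.sum_pair hpq']
          omega
        have h4 : 4 ≤ T.card := by
          have h1 : ({a'', p, q, c''} : Finset ι) ⊆ T := by
            intro x hx
            simp only [Finset.mem_insert, Finset.mem_singleton] at hx
            rcases hx with rfl | rfl | rfl | rfl <;> assumption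
          have h2 : ({a'', p, q, c''} : Finset ι).card = 4 := by
            rw [Finset.card_insert_of_notMem (by simp [hpa''.symm, hqa''.symm, ha''c'']),
              Finset.card_insert_of_notMem (by simp [hpq', hpc'']), Finset.card_pair hqc'']
          rw [← h2]
          exact Finset.card_le_card h1
        have hTN := Finset.card_union_of_disjoint hd
        have hTNA := Finset.card_union_of_disjoint hdA
        have hcompl := Finset.card_compl (T ∪ N ∪ {a, a'})
        have hcompl' := Finset.card_compl (T ∪ N)
        -- Adding `a` and `a'` contributes a cut of at most 4 and cancels at least three edges
        -- twice, so the new cut is at most 7 + 4 - 6 = 5, while both sides have more than three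
        -- vertices.
        rcases hw (T ∪ N ∪ {a, a'}) (Finset.card_pos.1 (by omega)) (Finset.card_pos.1 (by omega))
          with h | h | h <;> omega)
  refine ⟨σ, hσ, fun W hvW hW hcl => ?_⟩
  have hσv : σ v = c := (hσS v hv).2.1 rfl
  obtain ⟨k, hk, l, hl, hk', -, hkl⟩ := hg.exists_adj_of_isFactorClosed hT.va hT.vb nab
    (mem_children.2 ⟨va2.symm, hT.aa2⟩) (mem_children.2 ⟨vb1.symm, hT.bb⟩)
    (by rw [hσv]; exact nac.symm) (by rw [hσv]; exact nbc.symm) (by rw [hσa]; exact na)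
    (fun h => hb' (h ▸ hσO b hb nab.symm hba')) hvW hW hcl
  have h1 := hσS a'' haS
  have h2 : σ a'' = a ∨ σ a'' = t ∨ σ a'' = s := by
    have := mem_nbr.2 h1.1
    rw [hnt] at this
    simpa using this
  have h3 : σ a'' ≠ a := by
    intro h
    have := hσ.invol a''
    rw [h, hσa] at this
    exact na this
  have h4 : σ a'' = s := by
    rcases h2 with h | h | h
    · exact absurd h h3
    · exact absurd ⟨rfl, h⟩ h1.2.2
    · exact h
  rw [children, hnt] at hk
  simp only [Finset.mem_erase, Finset.mem_insert, Finset.mem_singleton] at hk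
  rcases hk with ⟨hka, h | h | h⟩
  · exact hka h
  · exact htl l hl (h ▸ hkl)
  · exact hk' (h4.trans h.symm)

end CubicWeight

/-! ### Case analysis on the edges inside the two parts. -/

namespace CubicWeight

variable {ι : Type*} [Fintype ι] [DecidableEq ι] {w : CubicWeight ι}

lemma IsLocalTree.swap_c {v a b c a' a'' b' b'' c' c'' : ι}
    (h : w.IsLocalTree v a b c a' a'' b' b'' c' c'') :
    w.IsLocalTree v a b c a' a'' b' b'' c'' c' :=
  h.swap_bc.swap.swap_a.swap.swap_bc

lemma PathRel.reverse {v a b a' b' x y : ι} (h : PathRel v a b a' b' x y) :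
    PathRel v b a b' a' x y := by
  rw [pathRel_iff] at *
  tauto

lemma eq_or_eq_of_e_self_le_two {S : Finset ι} (hS : w.e S S ≤ 2) {f g x y : ι} (hf : f ∈ S)
    (hg : g ∈ S) (hne : f ≠ g) (hfg : w.Adj f g) (hx : x ∈ S) (hy : y ∈ S) (hxy : w.Adj x y) :
    (x = f ∧ y = g) ∨ (x = g ∧ y = f) := by
  by_contra hcon
  have h1 : ∑ p ∈ ({(x, y), (f, g), (g, f)} : Finset (ι × ι)), w.m p.1 p.2 ≤ w.e S S := by
    rw [e, ← Finset.sum_product']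
    refine Finset.sum_le_sum_of_subset ?_
    intro p hp
    simp only [Finset.mem_insert, Finset.mem_singleton] at hp
    rcases hp with rfl | rfl | rfl <;> simp [hf, hg, hx, hy]
  rw [Finset.sum_insert (by simpa using hcon), Finset.sum_pair (by simp [hne])] at h1
  have h2 : 0 < w.m f g := hfg
  have h3 : 0 < w.m g f := hfg.symm
  have h4 : 0 < w.m x y := hxy
  simp only at h1
  omega

/-- Both parts have the same cut, and their degree sums differ by 6. So the larger part has exactly
six more ordered adjacent pairs than `S`, that is, three more inner edges; `l` lists the candidates.
-/
lemma add_six_le_length {k : ℕ} (hg : w.GirthGT k) {S : Finset ι} (hcard : Sᶜ.card = S.card + 2)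
    (l : List (ι × ι)) (hl : ∀ x ∉ S, ∀ y ∉ S, w.Adj x y → (x, y) ∈ l) :
    w.e S S + 6 ≤ l.length := by
  have h1 := w.e_self_add_cut S
  have h2 := w.e_self_add_cut Sᶜ
  rw [w.cut_compl] at h2
  have h3 := e_le_length (A := Sᶜ) (B := Sᶜ) hg l (fun x hx y hy => hl x (Finset.mem_compl.1 hx) y
    (Finset.mem_compl.1 hy)) le_rfl
  omega

section

variable {v a b c a' a'' b' b'' c' c'' : ι} {S : Finset ι}

/-- If `a` or `v` were in `S`, two edges of the path would not lie in the larger part, leaving fewer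
than the three required. -/
lemma not_mem_of_pathRel (hg : w.GirthGT 6) (hcard : Sᶜ.card = S.card + 2)
    (hO : ∀ x ∉ S, ∀ y ∉ S, w.Adj x y → PathRel v a b a' b' x y) : a ∉ S ∧ v ∉ S := by
  constructor
  · intro h
    have := add_six_le_length hg hcard [(v, b), (b, v), (b, b'), (b', b)] fun x hx y hy hxy => by
      rcases pathRel_iff.1 (hO x hx y hy hxy) with
        ⟨rfl, rfl⟩ | ⟨rfl, rfl⟩ | ⟨rfl, rfl⟩ | ⟨rfl, rfl⟩ | ⟨rfl, rfl⟩ | ⟨rfl, rfl⟩ | ⟨rfl, rfl⟩ |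
        ⟨rfl, rfl⟩ <;> first | exact absurd h hx | exact absurd h hy | simp
    simp at this
  · intro h
    have := add_six_le_length hg hcard [(b, b'), (b', b), (a, a'), (a', a)] fun x hx y hy hxy => by
      rcases pathRel_iff.1 (hO x hx y hy hxy) with
        ⟨rfl, rfl⟩ | ⟨rfl, rfl⟩ | ⟨rfl, rfl⟩ | ⟨rfl, rfl⟩ | ⟨rfl, rfl⟩ | ⟨rfl, rfl⟩ | ⟨rfl, rfl⟩ |
        ⟨rfl, rfl⟩ <;> first | exact absurd h hx | exact absurd h hy | simp
    simp at this

/-- Three edges of the path are left for the larger part, exactly the excess over `S`. -/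
lemma e_self_eq_zero_of_mem (hg : w.GirthGT 6) (hcard : Sᶜ.card = S.card + 2)
    (hO : ∀ x ∉ S, ∀ y ∉ S, w.Adj x y → PathRel v a b a' b' x y) (h : a' ∈ S) :
    w.e S S = 0 := by
  have := add_six_le_length hg hcard [(a, v), (v, a), (v, b), (b, v), (b, b'), (b', b)]
    fun x hx y hy hxy => by
      rcases pathRel_iff.1 (hO x hx y hy hxy) with
        ⟨rfl, rfl⟩ | ⟨rfl, rfl⟩ | ⟨rfl, rfl⟩ | ⟨rfl, rfl⟩ | ⟨rfl, rfl⟩ | ⟨rfl, rfl⟩ | ⟨rfl, rfl⟩ |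
        ⟨rfl, rfl⟩ <;> first | exact absurd h hx | exact absurd h hy | simp
  simpa using this

lemma not_mem_or_not_mem_of_pathRel (hg : w.GirthGT 6) (hcard : Sᶜ.card = S.card + 2)
    (hO : ∀ x ∉ S, ∀ y ∉ S, w.Adj x y → PathRel v a b a' b' x y) : a' ∉ S ∨ b' ∉ S := by
  by_contra! h
  obtain ⟨h, h'⟩ := h
  have := add_six_le_length hg hcard [(a, v), (v, a), (v, b), (b, v)]
    fun x hx y hy hxy => by
      rcases pathRel_iff.1 (hO x hx y hy hxy) with
        ⟨rfl, rfl⟩ | ⟨rfl, rfl⟩ | ⟨rfl, rfl⟩ | ⟨rfl, rfl⟩ | ⟨rfl, rfl⟩ | ⟨rfl, rfl⟩ | ⟨rfl, rfl⟩ |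
        ⟨rfl, rfl⟩ <;> first | exact absurd h hx | exact absurd h hy | exact absurd h' hx |
          exact absurd h' hy | simp
  simp at this

lemma e_self_le_two (hg : w.GirthGT 6) (hcard : Sᶜ.card = S.card + 2)
    (hO : ∀ x ∉ S, ∀ y ∉ S, w.Adj x y → PathRel v a b a' b' x y) : w.e S S ≤ 2 := by
  have := add_six_le_length hg hcard (pathPairs v a b a' b') hO
  simpa [pathPairs] using this

lemma not_adj_of_e_self_eq_zero (h : w.e S S = 0) : ∀ x ∈ S, ∀ y ∈ S, ¬ w.Adj x y := by
  intro x hx y hy hxy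
  rw [e, Finset.sum_eq_zero_iff] at h
  have := Finset.sum_eq_zero_iff.1 (h x hx) y hy
  unfold Adj at hxy
  omega

variable (hg : w.GirthGT 6) (hT : w.IsLocalTree v a b c a' a'' b' b'' c' c'')
  (hO : ∀ x ∉ S, ∀ y ∉ S, w.Adj x y → PathRel v a b a' b' x y)

include hg hT hO

lemma center_mem_of_pathRel (hv : v ∉ S) : c ∈ S := by
  by_contra h
  obtain ⟨nab, nac, nbc⟩ := hT.ne_ab hg
  have hva := hg.adj_ne hT.va
  have hvb := hg.adj_ne hT.vb
  obtain ⟨va1, va2, na⟩ := hT.ne_va hg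
  obtain ⟨vb1, vb2, nb⟩ := hT.ne_vb hg
  rcases pathRel_iff.1 (hO v hv c h hT.vc) with
    ⟨h1, h2⟩ | ⟨h1, h2⟩ | ⟨h1, h2⟩ | ⟨h1, h2⟩ | ⟨h1, h2⟩ | ⟨h1, h2⟩ | ⟨h1, h2⟩ | ⟨h1, h2⟩
  exacts [va1 h1, hva h1, hva h1, nac h2.symm, nbc h2.symm, hvb h1, hvb h1, vb1 h1]

/-- The children of `a'` belong to the independent part. -/
lemma children_mem_of_pathRel (ha' : a' ∉ S) {k : ι} (hk : k ∈ w.children a a') : k ∈ S := by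
  by_contra h
  obtain ⟨nab, nac, nbc⟩ := hT.ne_ab hg
  obtain ⟨va1, va2, na⟩ := hT.ne_va hg
  obtain ⟨vb1, vb2, nb⟩ := hT.ne_vb hg
  have haa := hg.adj_ne hT.aa
  have hba' := IsLocalTree.level_one_ne_level_two hg (by omega) hT.vb hT.va hT.aa va1
  have ha'b' := IsLocalTree.level_two_ne hg (by omega) hT.va hT.vb hT.bb hT.aa nab vb1
  rw [mem_children] at hk
  rcases pathRel_iff.1 (hO a' ha' k h hk.2) with
    ⟨h1, h2⟩ | ⟨h1, h2⟩ | ⟨h1, h2⟩ | ⟨h1, h2⟩ | ⟨h1, h2⟩ | ⟨h1, h2⟩ | ⟨h1, h2⟩ | ⟨h1, h2⟩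
  exacts [hk.1 h2, haa h1.symm, haa h1.symm, va1 h1.symm, va1 h1.symm, hba' h1.symm, hba' h1.symm,
    ha'b' h1]

/-- The children of `c'` belong to the independent part. -/
lemma children_mem_of_pathRel' (hc' : c' ∉ S) {k : ι} (hk : w.Adj c' k) : k ∈ S := by
  by_contra h
  obtain ⟨nab, nac, nbc⟩ := hT.ne_ab hg
  obtain ⟨va1, va2, na⟩ := hT.ne_va hg
  obtain ⟨vb1, vb2, nb⟩ := hT.ne_vb hg
  obtain ⟨vc1, vc2, nc⟩ := hT.ne_vc hg
  have hac' := IsLocalTree.level_one_ne_level_two hg (by omega) hT.va hT.vc hT.cc vc1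
  have hbc' := IsLocalTree.level_one_ne_level_two hg (by omega) hT.vb hT.vc hT.cc vc1
  have ha'c' := IsLocalTree.level_two_ne hg (by omega) hT.va hT.vc hT.cc hT.aa nac vc1
  have hb'c' := IsLocalTree.level_two_ne hg (by omega) hT.vb hT.vc hT.cc hT.bb nbc vc1
  rcases pathRel_iff.1 (hO c' hc' k h hk) with
    ⟨h1, h2⟩ | ⟨h1, h2⟩ | ⟨h1, h2⟩ | ⟨h1, h2⟩ | ⟨h1, h2⟩ | ⟨h1, h2⟩ | ⟨h1, h2⟩ | ⟨h1, h2⟩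
  exacts [ha'c' h1.symm, hac' h1.symm, hac' h1.symm, vc1 h1.symm, vc1 h1.symm, hbc' h1.symm,
    hbc' h1.symm, hb'c' h1.symm]

/-- If `fg` is the only edge inside the smaller part, then it does not join children of `a'` both to
children of `c'` and to children of `c''`. -/
lemma not_adj_children_or (ha' : a' ∉ S) (hc' : c' ∉ S) (hc'' : c'' ∉ S) {f g : ι}
    (hfg : ∀ x ∈ S, ∀ y ∈ S, w.Adj x y → (x = f ∧ y = g) ∨ (x = g ∧ y = f)) :
    (∀ k ∈ w.children a a', ∀ l ∈ w.children c c', ¬ w.Adj k l) ∨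
    (∀ k ∈ w.children a a', ∀ l ∈ w.children c c'', ¬ w.Adj k l) := by
  by_contra! h
  obtain ⟨⟨k, hk, l, hl, hkl⟩, k2, hk2, l2, hl2, hkl2⟩ := h
  have kS := children_mem_of_pathRel hg hT hO ha' hk
  have k2S := children_mem_of_pathRel hg hT hO ha' hk2
  rw [mem_children] at hk hl hk2 hl2
  have lS := children_mem_of_pathRel' hg hT hO hc' hl.2
  have l2S := children_mem_of_pathRel' hg hT.swap_c hO hc'' hl2.2
  obtain ⟨nab, nac, nbc⟩ := hT.ne_ab hg
  obtain ⟨va1, va2, na⟩ := hT.ne_va hg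
  obtain ⟨vc1, vc2, nc⟩ := hT.ne_vc hg
  have hll : l ≠ l2 := by
    rintro rfl
    exact hg.ne_four (by omega) hT.cc hl.2 hl2.2.symm hT.cc2.symm hl.1.symm nc hl2.1 rfl
  -- Both closing edges lie inside `S`, hence both are `fg`. As `l ≠ l2`, they are the same edge
  -- traversed in opposite directions, so `a'` and `c'` have a common neighbour and a circuit of
  -- length 6 through `v` arises.
  have hlk : l = k2 := by
    rcases hfg k kS l lS hkl with ⟨h1, h2⟩ | ⟨h1, h2⟩ <;>
    rcases hfg k2 k2S l2 l2S hkl2 with ⟨h3, h4⟩ | ⟨h3, h4⟩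
    · exact absurd (h2.trans h4.symm) hll
    · exact h2.trans h3.symm
    · exact h2.trans h3.symm
    · exact absurd (h2.trans h4.symm) hll
  have ha'c' := IsLocalTree.level_two_ne hg (by omega) hT.va hT.vc hT.cc hT.aa nac vc1
  subst hlk
  exact hg.ne_six le_rfl hT.va hT.aa hk2.2 hl.2.symm hT.cc.symm hT.vc.symm va1 hk2.1.symm ha'c'
    hl.1 vc1.symm rfl

/-- The case of a bipartition without edges inside the smaller part. -/
lemma CyclicSeven.exists_avoidsSeven_of_indep (hw : w.CyclicSeven) (hcard : Sᶜ.card = S.card + 2)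
    (hv : v ∉ S) (ha : a ∉ S) (hb : b ∉ S) (ha' : a' ∉ S)
    (hS : ∀ x ∈ S, ∀ y ∈ S, ¬ w.Adj x y) : ∃ σ, w.AvoidsSeven v σ := by
  have hc := center_mem_of_pathRel hg hT hO hv
  have hc' : c' ∉ S := fun h => hS c hc c' h hT.cc
  refine hw.exists_avoidsSeven_of_path hg hT hcard hO hv ha hb ha' hc' (Or.inl hS) ?_
  intro k hk l hl
  exact hS k (children_mem_of_pathRel hg hT hO ha' hk) l
    (children_mem_of_pathRel' hg hT hO hc' (mem_children.1 hl).2)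

/-- The case of an edge `cc''` inside the smaller part. -/
lemma CyclicSeven.exists_avoidsSeven_of_center (hw : w.CyclicSeven)
    (hcard : Sᶜ.card = S.card + 2) (hv : v ∉ S) (ha : a ∉ S) (hb : b ∉ S) (ha' : a' ∉ S)
    (hb' : b' ∉ S) (hc : c ∈ S) (hcS : c'' ∈ S)
    (hS : ∀ x ∈ S, ∀ y ∈ S, w.Adj x y → (x = c ∧ y = c'') ∨ (x = c'' ∧ y = c)) :
    ∃ σ, w.AvoidsSeven v σ := by
  obtain ⟨nab, nac, nbc⟩ := hT.ne_ab hg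
  obtain ⟨va1, va2, na⟩ := hT.ne_va hg
  obtain ⟨vb1, vb2, nb⟩ := hT.ne_vb hg
  obtain ⟨vc1, vc2, nc⟩ := hT.ne_vc hg
  have hcc2 := hg.adj_ne hT.cc2
  have hc' : c' ∉ S := by
    intro h
    rcases hS c hc c' h hT.cc with ⟨-, h1⟩ | ⟨h1, -⟩
    exacts [nc h1, hcc2 h1]
  have hnot : ∀ {x}, x ∉ insert v (S.erase c) → x ≠ v ∧ (x ∉ S ∨ x = c) := by
    intro x hx
    simp only [Finset.mem_insert, Finset.mem_erase, not_or, not_and] at hx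
    refine ⟨hx.1, ?_⟩
    by_cases h : x = c
    · exact Or.inr h
    · exact Or.inl (hx.2 h)
  have hin : ∀ {x}, x ∈ insert v (S.erase c) → x = v ∨ (x ∈ S ∧ x ≠ c) := by
    intro x hx
    simp only [Finset.mem_insert, Finset.mem_erase] at hx
    exact hx.imp_right And.symm
  have hnv : ∀ y ∈ S, y ≠ c → ¬ w.Adj v y := by
    intro y hy hyc hvy
    rcases hT.eq_of_adj_v hvy with rfl | rfl | rfl
    exacts [ha hy, hb hy, hyc rfl]
  have hnc : ∀ y, (y ∉ S ∨ y = c) → y ≠ v → w.Adj c y → y = c' := by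
    intro y hy hyv hcy
    rcases hT.eq_of_adj_c hcy with h | h | h
    · exact absurd h hyv
    · exact h
    · exfalso
      rcases hy with hy | hy
      · exact hy (h ▸ hcS)
      · exact hg.adj_ne hcy hy.symm
  -- After `v` and `c` exchange sides, `va`, `vb` and `cc''` run between the parts, while `cc'`
  -- comes to lie inside the larger one, next to `aa'` and `bb'`.
  refine hw.exists_avoidsSeven_of_claw hg hT (S := insert v (S.erase c)) ?_ ?_ ?_ (by simp)
    (by simp [va1.symm, ha']) (by simp [vb1.symm, hb']) (by simp [vc1.symm, hc'])
  · have h1 : (insert v (S.erase c)).card = S.card := by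
      rw [Finset.card_insert_of_notMem (by simp [hv]), Finset.card_erase_of_mem hc]
      have := Finset.card_pos.2 ⟨c, hc⟩
      omega
    rw [Finset.card_compl] at hcard ⊢
    rw [h1, hcard]
  · intro x hx y hy hxy
    obtain ⟨hxv, hxS⟩ := hnot hx
    obtain ⟨hyv, hyS⟩ := hnot hy
    rcases hxS with hxS | rfl
    · rcases hyS with hyS | rfl
      · rcases pathRel_iff.1 (hO x hxS y hyS hxy) with
          ⟨h1, h2⟩ | ⟨h1, h2⟩ | ⟨h1, h2⟩ | ⟨h1, h2⟩ | ⟨h1, h2⟩ | ⟨h1, h2⟩ | ⟨h1, h2⟩ | ⟨h1, h2⟩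
        exacts [Or.inr (Or.inl ⟨h1, h2⟩), Or.inl ⟨h1, h2⟩, absurd h2 hyv, absurd h1 hxv,
          absurd h1 hxv, absurd h2 hyv, Or.inr (Or.inr (Or.inl ⟨h1, h2⟩)),
          Or.inr (Or.inr (Or.inr (Or.inl ⟨h1, h2⟩)))]
      · exact Or.inr (Or.inr (Or.inr (Or.inr (Or.inr ⟨hnc x (Or.inl hxS) hxv hxy.symm, rfl⟩))))
    · exact Or.inr (Or.inr (Or.inr (Or.inr (Or.inl ⟨rfl, hnc y hyS hyv hxy⟩))))
  · intro x hx y hy hxy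
    rcases hin hx with rfl | ⟨hxS, hxc⟩
    · rcases hin hy with rfl | ⟨hyS, hyc⟩
      · exact hg.adj_ne hxy rfl
      · exact hnv y hyS hyc hxy
    · rcases hin hy with rfl | ⟨hyS, hyc⟩
      · exact hnv x hxS hxc hxy.symm
      · rcases hS x hxS y hyS hxy with ⟨h1, -⟩ | ⟨-, h1⟩
        exacts [hxc h1, hyc h1]

/-- The case of one edge inside the smaller part. -/
lemma CyclicSeven.exists_avoidsSeven_of_edge (hw : w.CyclicSeven) (hcard : Sᶜ.card = S.card + 2)
    (hv : v ∉ S) (ha : a ∉ S) (hb : b ∉ S) (ha' : a' ∉ S) (hb' : b' ∉ S) {f g : ι}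
    (hf : f ∈ S) (hgS : g ∈ S) (hfg : w.Adj f g)
    (hS : ∀ x ∈ S, ∀ y ∈ S, w.Adj x y → (x = f ∧ y = g) ∨ (x = g ∧ y = f)) :
    ∃ σ, w.AvoidsSeven v σ := by
  have hc := center_mem_of_pathRel hg hT hO hv
  have key : ∀ g, g ∈ S → w.Adj c g →
      (∀ x ∈ S, ∀ y ∈ S, w.Adj x y → (x = c ∧ y = g) ∨ (x = g ∧ y = c)) →
      ∃ σ, w.AvoidsSeven v σ := by
    intro g hgS hcg hS
    rcases hT.eq_of_adj_c hcg with rfl | rfl | rfl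
    · exact absurd hgS hv
    · exact exists_avoidsSeven_of_center hg hT.swap_c hO hw hcard hv ha hb ha' hb' hc hgS hS
    · exact exists_avoidsSeven_of_center hg hT hO hw hcard hv ha hb ha' hb' hc hgS hS
  by_cases h1 : f = c
  · subst h1
    exact key g hgS hfg hS
  by_cases h2 : g = c
  · subst h2
    exact key f hf hfg.symm fun x hx y hy hxy => (hS x hx y hy hxy).symm
  have hcn : ∀ x, w.Adj c x → x ∉ S := by
    intro x hcx hx
    rcases hS c hc x hx hcx with ⟨h, -⟩ | ⟨h, -⟩
    exacts [h1 h.symm, h2 h.symm]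
  -- The factor may leave `c` through `c'` or through `c''`; one of the two paths does not close.
  rcases not_adj_children_or hg hT hO ha' (hcn _ hT.cc) (hcn _ hT.cc2) hS with h | h
  · exact hw.exists_avoidsSeven_of_path hg hT hcard hO hv ha hb ha' (hcn _ hT.cc)
      (Or.inr ⟨hb', f, g, hfg, h1, h2, hS⟩) h
  · exact hw.exists_avoidsSeven_of_path hg hT.swap_c hcard hO hv ha hb ha' (hcn _ hT.cc2)
      (Or.inr ⟨hb', f, g, hfg, h1, h2, hS⟩) h

end

/-- The case in which no perfect matching avoids the path `a', a, v, b, b'`. -/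
theorem CyclicSeven.exists_avoidsSeven_of_forall (hw : w.CyclicSeven) (hg : w.GirthGT 6)
    {v a b c a' a'' b' b'' c' c'' : ι} (hT : w.IsLocalTree v a b c a' a'' b' b'' c' c'')
    (hno : ¬ ∃ σ, w.IsPM σ ∧ ∀ x, ¬ PathRel v a b a' b' x (σ x)) :
    ∃ σ, w.AvoidsSeven v σ := by
  obtain ⟨O, hcard, hO⟩ := exists_almost_bipartition hw hg hT hno
  obtain ⟨S, rfl⟩ : ∃ S, O = Sᶜ := ⟨Oᶜ, (compl_compl O).symm⟩
  rw [compl_compl] at hcard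
  replace hO : ∀ x ∉ S, ∀ y ∉ S, w.Adj x y → PathRel v a b a' b' x y := fun x hx y hy =>
    hO x (Finset.mem_compl.2 hx) y (Finset.mem_compl.2 hy)
  have hO' : ∀ x ∉ S, ∀ y ∉ S, w.Adj x y → PathRel v b a b' a' x y := fun x hx y hy hxy =>
    (hO x hx y hy hxy).reverse
  obtain ⟨ha, hv⟩ := not_mem_of_pathRel hg hcard hO
  obtain ⟨hb, -⟩ := not_mem_of_pathRel hg hcard hO'
  by_cases h0 : ∀ x ∈ S, ∀ y ∈ S, ¬ w.Adj x y
  · rcases not_mem_or_not_mem_of_pathRel hg hcard hO with h | h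
    · exact exists_avoidsSeven_of_indep hg hT hO hw hcard hv ha hb h h0
    · exact exists_avoidsSeven_of_indep hg hT.swap hO' hw hcard hv hb ha h h0
  · have ha' : a' ∉ S := fun h =>
      h0 (not_adj_of_e_self_eq_zero (e_self_eq_zero_of_mem hg hcard hO h))
    have hb' : b' ∉ S := fun h =>
      h0 (not_adj_of_e_self_eq_zero (e_self_eq_zero_of_mem hg hcard hO' h))
    push Not at h0
    obtain ⟨f, hf, g, hgS, hfg⟩ := h0
    exact exists_avoidsSeven_of_edge hg hT hO hw hcard hv ha hb ha' hb' hf hgS hfg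
      fun x hx y hy hxy => eq_or_eq_of_e_self_le_two (e_self_le_two hg hcard hO) hf hgS
        (hg.adj_ne hfg) hfg hx hy hxy

/-- A cubic multigraph that satisfies the cut condition has a perfect matching whose complement
does not contain a circuit of length seven through a given vertex. -/
theorem CyclicSeven.exists_avoidsSeven (hw : w.CyclicSeven) (v : ι) :
    ∃ σ, w.AvoidsSeven v σ := by
  rcases lt_or_ge (Fintype.card ι) 7 with hn | hn
  · obtain ⟨σ, hσ⟩ := hw.exists_isPM
    exact ⟨σ, hσ, fun W _ hW _ => by have := W.card_le_univ; omega⟩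
  have hg := hw.girthGT_six hn
  obtain ⟨a, b, a', b', hva, hvb, hab, haa, hbb, hnadj⟩ := hw.exists_nonclosing_path hg v
  obtain ⟨c, a'', b'', c', c'', hT⟩ := hg.exists_isLocalTree hva hvb hab haa hbb
  by_cases h : ∃ σ, w.IsPM σ ∧ ∀ x, ¬ PathRel v a b a' b' x (σ x)
  · obtain ⟨σ, hσ, hP⟩ := h
    refine ⟨σ, hσ, fun W hv hW hcl => ?_⟩
    obtain ⟨k, hk, l, hl, -, -, hkl⟩ := hg.exists_adj_of_isFactorClosed hva hvb hab haa hbb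
      (fun h => hP v (pathRel_iff.2 (by simp [h]))) (fun h => hP v (pathRel_iff.2 (by simp [h])))
      (fun h => hP a (pathRel_iff.2 (by simp [h]))) (fun h => hP b (pathRel_iff.2 (by simp [h])))
      hv hW hcl
    exact hnadj k hk l hl hkl
  · exact hw.exists_avoidsSeven_of_forall hg hT h

end CubicWeight

/-! ### Degrees and edge counts in multigraphs. -/

variable {α β : Type*} {G H : Graph α β}

/-- The number of ends of the edge `i` at the vertex `x`. -/
noncomputable def endCount (G : Graph α β) (i : β) (x : α) : ℕ := by
  classical exact (if G.Inc i x then 1 else 0) + (if G.IsLoopAt i x then 1 else 0)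

/-- The contribution of the edge `i` to the multiplicity of the pair of vertices `x`, `y`. -/
noncomputable def linkCount (G : Graph α β) (i : β) (x y : α) : ℕ := by
  classical exact if G.IsLink i x y then (if x = y then 2 else 1) else 0

lemma linkCount_comm (i : β) (x y : α) : linkCount G i x y = linkCount G i y x := by
  unfold linkCount
  classical exact if_congr G.isLink_comm (if_congr eq_comm rfl rfl) rfl

lemma linkCount_pos {i : β} {x y : α} : 0 < linkCount G i x y ↔ G.IsLink i x y := by
  unfold linkCount
  split_ifs <;> simp_all

lemma even_linkCount_self (i : β) (x : α) : Even (linkCount G i x x) := by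
  unfold linkCount
  split_ifs <;> simp_all

lemma linkCount_eq_zero {i : β} {x y : α} (h : ¬ G.IsLink i x y) : linkCount G i x y = 0 := by
  simp [linkCount, h]

lemma sum_linkCount {i : β} {x u v : α} (h : G.IsLink i u v) {s : Finset α} (hu : u ∈ s)
    (hv : v ∈ s) : ∑ y ∈ s, linkCount G i x y = endCount G i x := by
  classical
  by_cases hx : G.Inc i x
  · obtain ⟨z, hz⟩ := hx
    have hzs : z ∈ s := by
      rcases hz.symm.left_eq_or_eq h with rfl | rfl <;> assumption
    rw [Finset.sum_eq_single_of_mem z hzs fun y _ hy => linkCount_eq_zero fun hxy =>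
      hy (hxy.right_unique hz)]
    have hl : G.IsLoopAt i x ↔ x = z := by
      rw [← Graph.isLink_self_iff]
      refine ⟨fun hxx => hxx.right_unique hz, ?_⟩
      rintro rfl
      exact hz
    simp only [linkCount, endCount, hz, hz.inc_left, hl, if_true]
    split_ifs <;> rfl
  · have hl : ¬ G.IsLoopAt i x := fun hl => hx hl.inc
    rw [Finset.sum_eq_zero fun y _ => linkCount_eq_zero fun hxy => hx hxy.inc_left]
    simp [endCount, hx, hl]

lemma sum_endCount {i : β} {u v : α} (h : G.IsLink i u v) {s : Finset α} (hu : u ∈ s)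
    (hv : v ∈ s) : ∑ x ∈ s, endCount G i x = 2 := by
  classical
  have hi : ∀ x, G.Inc i x ↔ x = u ∨ x = v := by
    intro x
    refine ⟨fun hx => hx.eq_or_eq_of_isLink h, ?_⟩
    rintro (rfl | rfl)
    exacts [h.inc_left, h.inc_right]
  by_cases huv : u = v
  · subst huv
    have hl : ∀ x, G.IsLoopAt i x ↔ x = u := by
      intro x
      refine ⟨fun hx => by simpa using (hi x).1 hx.inc, ?_⟩
      rintro rfl
      exact h
    simp [endCount, hi, hl, Finset.sum_add_distrib, hu]
  · have hl : ∀ x, ¬ G.IsLoopAt i x := by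
      intro x hx
      exact huv ((hx.eq_of_inc h.inc_left).symm.trans (hx.eq_of_inc h.inc_right))
    have hf : s.filter (fun x => x = u ∨ x = v) = {u, v} := by
      ext x
      simp only [Finset.mem_filter, Finset.mem_insert, Finset.mem_singleton]
      refine ⟨And.right, fun hx => ⟨?_, hx⟩⟩
      rcases hx with rfl | rfl <;> assumption
    simp only [endCount, hi, hl, if_false, add_zero]
    rw [← Finset.sum_filter, hf, Finset.sum_const, Finset.card_pair huv]
    rfl

lemma degree_eq_sum (hE : E(G).Finite) (x : α) :
    degree G x = ((∑ i ∈ hE.toFinset, endCount G i x : ℕ) : ℕ∞) := by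
  classical
  have h1 : (G.incidenceSet x) = ↑(hE.toFinset.filter fun i => G.Inc i x) := by
    ext i
    simp only [Graph.mem_incidenceSet, Finset.coe_filter, Set.Finite.mem_toFinset,
      Set.mem_ofPred_eq]
    exact ⟨fun h => ⟨h.edge_mem, h⟩, And.right⟩
  have h2 : (G.loopSet x) = ↑(hE.toFinset.filter fun i => G.IsLoopAt i x) := by
    ext i
    simp only [Graph.mem_loopSet, Finset.coe_filter, Set.Finite.mem_toFinset, Set.mem_ofPred_eq]
    exact ⟨fun h => ⟨h.edge_mem, h⟩, And.right⟩
  rw [degree, h1, h2, Set.encard_coe_eq_coe_finsetCard, Set.encard_coe_eq_coe_finsetCard]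
  simp only [endCount, Finset.sum_add_distrib, Finset.sum_boole, Nat.cast_id, Nat.cast_add]

/-- The handshake lemma. -/
lemma sum_sum_endCount (hV : V(G).Finite) (hE : E(G).Finite) :
    ∑ x ∈ hV.toFinset, ∑ i ∈ hE.toFinset, endCount G i x = 2 * E(G).ncard := by
  rw [Finset.sum_comm, Finset.sum_congr rfl (g := fun _ => 2), Finset.sum_const,
    Set.ncard_eq_toFinset_card _ hE, smul_eq_mul, mul_comm]
  intro i hi
  obtain ⟨u, v, huv⟩ := Graph.exists_isLink_of_mem_edgeSet (hE.mem_toFinset.1 hi)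
  exact sum_endCount huv (hV.mem_toFinset.2 huv.left_mem) (hV.mem_toFinset.2 huv.right_mem)

lemma IsRegular.mul_ncard_eq {d : ℕ} (h : IsRegular G d) (hV : V(G).Finite) (hE : E(G).Finite) :
    d * V(G).ncard = 2 * E(G).ncard := by
  rw [← sum_sum_endCount hV hE, Finset.sum_congr rfl (g := fun _ => d), Finset.sum_const,
    Set.ncard_eq_toFinset_card _ hV, smul_eq_mul, mul_comm]
  intro x hx
  have := h x (hV.mem_toFinset.1 hx)
  rw [degree_eq_sum hE] at this
  exact_mod_cast this

lemma IsRegular.finite_edgeSet {d : ℕ} (h : IsRegular G d) (hV : V(G).Finite) : E(G).Finite := by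
  refine (hV.biUnion (t := fun x => G.incidenceSet x) fun x hx => ?_).subset ?_
  · refine Set.encard_lt_top_iff.1 (lt_of_le_of_lt (b := (d : ℕ∞)) ?_ (ENat.natCast_lt_top d))
    rw [← h x hx]
    exact le_self_add
  · intro i hi
    obtain ⟨u, v, huv⟩ := Graph.exists_isLink_of_mem_edgeSet hi
    exact Set.mem_biUnion huv.left_mem huv.inc_left

/-! ### Circuits in graphs with at least as many edges as vertices. -/

lemma ContainsCircuit.mono (h : ContainsCircuit H) (hle : H ≤ G) : ContainsCircuit G := by
  obtain ⟨C, hC, hC'⟩ := h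
  exact ⟨C, hC.trans hle, hC'⟩

/-- A graph without smaller dense subgraphs is connected. -/
lemma isConnected_of_minimal (hV : V(G).Finite) (hE : E(G).Finite) (hne : V(G).Nonempty)
    (hcard : V(G).ncard ≤ E(G).ncard)
    (hmin : ∀ K ≤ G, V(K).Nonempty → V(K).ncard ≤ E(K).ncard → V(K).ncard < V(G).ncard → False) :
    IsConnected G := by
  refine ⟨hne, fun x hx y hy => ?_⟩
  by_contra hxy
  set R : Set α := {z | z ∈ V(G) ∧ Relation.ReflTransGen G.Adj x z} with hR
  have hRV : R ⊆ V(G) := fun z hz => hz.1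
  have hxR : x ∈ R := ⟨hx, .refl⟩
  have hyR : y ∉ R := fun h => hxy h.2
  have hsub : E(G) ⊆ E(G.induce R) ∪ E(G.deleteVerts R) := by
    intro i hi
    obtain ⟨u, z, h⟩ := Graph.exists_isLink_of_mem_edgeSet hi
    rw [Graph.edgeSet_induce, Graph.edgeSet_deleteVerts]
    by_cases hu : u ∈ R
    · exact Or.inl ⟨u, z, h, hu, h.right_mem, hu.2.tail h.adj⟩
    · refine Or.inr ⟨u, z, h, hu, fun hz => hu ⟨h.left_mem, hz.2.tail h.symm.adj⟩⟩
  have h1 : E(G).ncard ≤ E(G.induce R).ncard + E(G.deleteVerts R).ncard :=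
    (Set.ncard_le_ncard hsub ((hE.subset (Graph.induce_le hRV).edgeSet_mono).union
      (hE.subset Graph.deleteVerts_le.edgeSet_mono))).trans (Set.ncard_union_le _ _)
  have h2 : (V(G) \ R).ncard + R.ncard = V(G).ncard := Set.ncard_sdiff_add_ncard_of_subset hRV hV
  have h3 : 0 < R.ncard := (Set.ncard_pos (hV.subset hRV)).2 ⟨x, hxR⟩
  have h4 : 0 < (V(G) \ R).ncard := (Set.ncard_pos (hV.subset Set.sdiff_subset)).2 ⟨y, hy, hyR⟩
  -- No edge joins the component `R` to the rest, so one of the two sides has at least as many edges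
  -- as vertices.
  rcases le_or_gt R.ncard E(G.induce R).ncard with h | h
  · exact hmin (G.induce R) (Graph.induce_le hRV) ⟨x, hxR⟩ h (by rw [Graph.vertexSet_induce]; omega)
  · refine hmin (G.deleteVerts R) Graph.deleteVerts_le ?_ ?_ ?_ <;>
      rw [Graph.vertexSet_deleteVerts]
    · exact ⟨y, hy, hyR⟩
    · omega
    · omega

lemma ncard_le_ncard_edgeSet_deleteVerts (hE : E(G).Finite) (x : α) :
    E(G).ncard ≤ E(G.deleteVerts {x}).ncard + (G.incidenceSet x).ncard := by
  refine (Set.ncard_le_ncard ?_ ((hE.subset Graph.deleteVerts_le.edgeSet_mono).union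
      (hE.subset (G.incidenceSet_subset_edgeSet x)))).trans (Set.ncard_union_le _ _)
  intro i hi
  obtain ⟨u, z, h⟩ := Graph.exists_isLink_of_mem_edgeSet hi
  by_cases hu : u = x
  · exact Or.inr ⟨z, hu ▸ h⟩
  by_cases hz : z = x
  · exact Or.inr ⟨u, hz ▸ h.symm⟩
  · rw [Graph.edgeSet_deleteVerts]
    exact Or.inl ⟨u, z, h, hu, hz⟩

/-- A graph without smaller dense subgraphs has minimum degree at least two. -/
lemma two_le_sum_endCount_of_minimal (hV : V(G).Finite) (hE : E(G).Finite)
    (hcard : V(G).ncard ≤ E(G).ncard)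
    (hmin : ∀ K ≤ G, V(K).Nonempty → V(K).ncard ≤ E(K).ncard → V(K).ncard < V(G).ncard → False)
    {x : α} (hx : x ∈ V(G)) : 2 ≤ ∑ i ∈ hE.toFinset, endCount G i x := by
  classical
  by_contra! hlt
  have hdeg := degree_eq_sum hE x
  have hinc : (G.incidenceSet x).ncard ≤ 1 := by
    have h1 : (G.incidenceSet x).encard ≤ degree G x := le_self_add
    rw [hdeg, ← (hE.subset (G.incidenceSet_subset_edgeSet x)).cast_ncard_eq] at h1
    have : (G.incidenceSet x).ncard ≤ ∑ i ∈ hE.toFinset, endCount G i x := by exact_mod_cast h1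
    omega
  have h2 := ncard_le_ncard_edgeSet_deleteVerts hE x
  have h3 : (V(G) \ {x}).ncard + 1 = V(G).ncard := Set.ncard_sdiff_singleton_add_one hx hV
  refine hmin (G.deleteVerts {x}) Graph.deleteVerts_le ?_ ?_ ?_ <;>
    rw [Graph.vertexSet_deleteVerts]
  -- If `x` is the only vertex, any edge is a loop and already contributes two ends.
  · by_contra hne
    rw [Set.not_nonempty_iff_eq_empty] at hne
    rw [hne, Set.ncard_empty] at h3
    obtain ⟨i, hi⟩ := (Set.ncard_pos hE).1 (by omega)
    obtain ⟨u, z, h⟩ := Graph.exists_isLink_of_mem_edgeSet hi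
    have hall : ∀ y ∈ V(G), y = x := by
      intro y hy
      by_contra hyx
      exact (hne ▸ (⟨hy, hyx⟩ : y ∈ V(G) \ {x}) : y ∈ (∅ : Set α))
    rw [hall u h.left_mem, hall z h.right_mem] at h
    have h4 : endCount G i x = 2 := by simp [endCount, h.inc_left, Graph.isLink_self_iff.1 h]
    have h5 := Finset.single_le_sum (f := fun i => endCount G i x) (fun _ _ => Nat.zero_le _)
      (hE.mem_toFinset.2 hi)
    omega
  · omega
  · omega

/-- A nonempty finite graph with at least as many edges as vertices contains a circuit. -/
theorem containsCircuit_of_ncard_le (hV : V(G).Finite) (hE : E(G).Finite) (hne : V(G).Nonempty)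
    (hcard : V(G).ncard ≤ E(G).ncard) : ContainsCircuit G := by
  induction hn : V(G).ncard using Nat.strong_induction_on generalizing G with
  | _ n ih =>
  subst hn
  by_contra hcon
  -- it suffices to look at graphs with as many edges as vertices
  obtain ⟨s, hsE, hs⟩ := Set.exists_subset_card_eq hcard
  set H := G.restrict s with hH
  have hHV : V(H) = V(G) := rfl
  have hHE : E(H) = s := by rw [hH, Graph.edgeSet_restrict, Set.inter_eq_right.2 hsE]
  have hHG : H ≤ G := Graph.restrict_le
  have hHVf : V(H).Finite := hV
  have hHEf : E(H).Finite := hE.subset hHG.edgeSet_mono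
  have hHcard : V(H).ncard ≤ E(H).ncard := by rw [hHE, hs, hHV]
  have hmin : ∀ K ≤ H, V(K).Nonempty → V(K).ncard ≤ E(K).ncard → V(K).ncard < V(H).ncard →
      False := fun K hK h1 h2 h3 => hcon ((ih _ h3 (hV.subset (hK.trans hHG).vertexSet_mono)
        (hE.subset (hK.trans hHG).edgeSet_mono) h1 h2 rfl).mono (hK.trans hHG))
  refine hcon ⟨H, hHG, hV, isConnected_of_minimal hHVf hHEf hne hHcard hmin, ?_⟩
  have h2 : ∀ x ∈ (Set.Finite.toFinset hHVf),
      2 ≤ ∑ i ∈ hHEf.toFinset, endCount H i x := fun x hx =>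
    two_le_sum_endCount_of_minimal (G := H) hHVf hHEf hHcard hmin (hHVf.mem_toFinset.1 hx)
  have h3 := sum_sum_endCount (G := H) hHVf hHEf
  have h4 : ∑ x ∈ (Set.Finite.toFinset hHVf), 2 = 2 * E(H).ncard := by
    rw [Finset.sum_const, ← Set.ncard_eq_toFinset_card _ hHVf, hHE, hs, hHV, smul_eq_mul, mul_comm]
  -- With equally many edges and vertices the average degree is 2, so the lower bound 2 is attained
  -- at every vertex.
  have h5 := (Finset.sum_eq_sum_iff_of_le h2).1 (h4.trans h3.symm)
  intro x hx
  rw [degree_eq_sum hHEf, ← h5 x (hHVf.mem_toFinset.2 hx)]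

/-! ### From a cubic graph to its multiplicities. -/

variable {α β : Type*} {G : Graph α β}

/-- The edge multiplicities of a finite cubic graph. -/
noncomputable def cubicWeight [Fintype V(G)] (hE : E(G).Finite) (hG : IsCubic G) :
    CubicWeight V(G) where
  m x y := ∑ i ∈ hE.toFinset, linkCount G i x y
  symm x y := Finset.sum_congr rfl fun i _ => linkCount_comm i _ _
  even_self x := Finset.even_sum _ fun i _ => even_linkCount_self i _
  sum_eq x := by
    rw [Finset.sum_comm]
    have h1 := hG x x.2
    rw [degree_eq_sum hE] at h1
    have h2 : ∑ i ∈ hE.toFinset, endCount G i x = 3 := by exact_mod_cast h1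
    rw [← h2]
    refine Finset.sum_congr rfl fun i hi => ?_
    obtain ⟨u, v, huv⟩ := Graph.exists_isLink_of_mem_edgeSet (hE.mem_toFinset.1 hi)
    rw [← sum_linkCount huv (s := V(G).toFinset) (Set.mem_toFinset.2 huv.left_mem)
      (Set.mem_toFinset.2 huv.right_mem)]
    exact (Finset.sum_subtype _ (fun y => Set.mem_toFinset) _).symm

section

variable [Fintype V(G)] (hE : E(G).Finite) (hG : IsCubic G)

lemma adj_cubicWeight {x y : V(G)} : (cubicWeight hE hG).Adj x y ↔ G.Adj (x : α) y := by
  unfold CubicWeight.Adj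
  rw [cubicWeight, Finset.sum_pos_iff]
  constructor
  · rintro ⟨i, -, hi⟩
    exact ⟨i, linkCount_pos.1 hi⟩
  · rintro ⟨i, hi⟩
    exact ⟨i, hE.mem_toFinset.2 hi.edge_mem, linkCount_pos.2 hi⟩

variable [DecidableEq V(G)]

lemma encard_edgeCut_le_cut (A : Finset V(G)) :
    (edgeCut G (Subtype.val '' (A : Set V(G)))).encard ≤ (cubicWeight hE hG).cut A := by
  classical
  have h1 : edgeCut G (Subtype.val '' (A : Set V(G))) =
      ↑(hE.toFinset.filter fun i => i ∈ edgeCut G (Subtype.val '' (A : Set V(G)))) := by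
    ext i
    simp only [Finset.coe_filter, Set.Finite.mem_toFinset, Set.mem_ofPred_eq]
    exact ⟨fun h => ⟨by obtain ⟨_, -, _, -, h⟩ := h; exact h.edge_mem, h⟩, And.right⟩
  rw [h1, Set.encard_coe_eq_coe_finsetCard, Nat.cast_le, Finset.card_filter]
  have h2 : (cubicWeight hE hG).cut A =
      ∑ i ∈ hE.toFinset, ∑ x ∈ A, ∑ y ∈ Aᶜ, linkCount G i x y := by
    rw [Finset.sum_comm]
    refine Finset.sum_congr rfl fun x _ => ?_
    rw [Finset.sum_comm]
    rfl
  rw [h2]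
  refine Finset.sum_le_sum fun i _ => ?_
  split_ifs with h
  · obtain ⟨_, ⟨x, hx, rfl⟩, y, hy, hxy⟩ := h
    have hyA : (⟨y, hxy.right_mem⟩ : V(G)) ∈ Aᶜ := by
      rw [Finset.mem_compl]
      exact fun h => hy ⟨_, h, rfl⟩
    calc 1 ≤ linkCount G i x y := linkCount_pos.2 hxy
      _ ≤ ∑ y ∈ Aᶜ, linkCount G i x y :=
        Finset.single_le_sum (f := fun y : V(G) => linkCount G i x y) (fun _ _ => Nat.zero_le _) hyA
      _ ≤ _ := Finset.single_le_sum (f := fun x : V(G) => ∑ y ∈ Aᶜ, linkCount G i x y)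
        (fun _ _ => Nat.zero_le _) hx
  · exact Nat.zero_le _

lemma e_self_le_mul_ncard (A : Finset V(G)) :
    (cubicWeight hE hG).e A A ≤ 2 * E(G.induce (Subtype.val '' (A : Set V(G)))).ncard := by
  classical
  set R : Set α := Subtype.val '' (A : Set V(G)) with hR
  have hRV : R ⊆ V(G) := by
    rintro _ ⟨x, -, rfl⟩
    exact x.2
  have h1 : E(G.induce R) = ↑(hE.toFinset.filter fun i => i ∈ E(G.induce R)) := by
    ext i
    simp only [Finset.coe_filter, Set.Finite.mem_toFinset, Set.mem_ofPred_eq]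
    exact ⟨fun h => ⟨(Graph.induce_le hRV).edgeSet_mono h, h⟩, And.right⟩
  have h2 : (cubicWeight hE hG).e A A =
      ∑ i ∈ hE.toFinset, ∑ x ∈ A, ∑ y ∈ A, linkCount G i x y := by
    rw [Finset.sum_comm]
    refine Finset.sum_congr rfl fun x _ => ?_
    rw [Finset.sum_comm]
    rfl
  rw [h2, h1, Set.ncard_coe_finset, Finset.card_filter, Finset.mul_sum]
  refine Finset.sum_le_sum fun i _ => ?_
  split_ifs with h
  · obtain ⟨u, v, huv, hu, hv⟩ := h
    have hmem : ∀ {x}, x ∈ R → x ∈ A.map (Function.Embedding.subtype _) := by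
      rintro _ ⟨x, hx, rfl⟩
      exact Finset.mem_map.2 ⟨x, hx, rfl⟩
    rw [← sum_endCount huv (hmem hu) (hmem hv), Finset.sum_map, mul_one]
    refine (Finset.sum_congr rfl fun x _ => ?_).le
    rw [← sum_linkCount huv (hmem hu) (hmem hv), Finset.sum_map]
    rfl
  · rw [mul_zero, Nat.le_zero]
    refine Finset.sum_eq_zero fun x hx => Finset.sum_eq_zero fun y hy => linkCount_eq_zero ?_
    exact fun hxy => h ⟨x, y, hxy, ⟨x, hx, rfl⟩, y, hy, rfl⟩

/-- A set of vertices that does not span a circuit has a large edge-cut. -/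
lemma card_add_two_le_cut {A : Finset V(G)} (hA : A.Nonempty)
    (h : ¬ ContainsCircuit (G.induce (Subtype.val '' (A : Set V(G))))) :
    A.card + 2 ≤ (cubicWeight hE hG).cut A := by
  have hRV : Subtype.val '' (A : Set V(G)) ⊆ V(G) := by
    rintro _ ⟨x, -, rfl⟩
    exact x.2
  have h1 : (Subtype.val '' (A : Set V(G))).ncard = A.card := by
    rw [Set.ncard_image_of_injective _ Subtype.val_injective, Set.ncard_coe_finset]
  have h2 := e_self_le_mul_ncard hE hG A
  have h3 := (cubicWeight hE hG).e_self_add_cut A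
  -- At most |A| - 1 inner edges leave at least 3|A| - 2(|A| - 1) = |A| + 2 edges for the cut.
  have h4 : E(G.induce (Subtype.val '' (A : Set V(G)))).ncard < A.card := by
    by_contra! h4
    refine h (containsCircuit_of_ncard_le (A.finite_toSet.image _)
      (hE.subset (Graph.induce_le hRV).edgeSet_mono) (hA.to_set.image _) ?_)
    rw [Graph.vertexSet_induce, h1]
    exact h4
  omega

lemma cyclicSeven_cubicWeight (hconn : IsCyclicallyEdgeConnected G 7) :
    (cubicWeight hE hG).CyclicSeven := by
  intro A hA hA'
  by_contra! h
  obtain ⟨h1, h2, h3⟩ := h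
  have hRV : Subtype.val '' (A : Set V(G)) ⊆ V(G) := by
    rintro _ ⟨x, -, rfl⟩
    exact x.2
  have hcompl : Subtype.val '' ((Aᶜ : Finset V(G)) : Set V(G)) =
      V(G) \ Subtype.val '' (A : Set V(G)) := by
    ext x
    constructor
    · rintro ⟨x, hx, rfl⟩
      refine ⟨x.2, ?_⟩
      rintro ⟨y, hy, hxy⟩
      rw [Subtype.val_injective hxy] at hy
      exact Finset.mem_compl.1 hx hy
    · rintro ⟨hx, hxA⟩
      exact ⟨⟨x, hx⟩, Finset.mem_compl.2 fun h => hxA ⟨_, h, rfl⟩, rfl⟩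
  refine hconn ⟨Subtype.val '' (A : Set V(G)), hRV, ?_, ?_, ?_⟩
  · refine (encard_edgeCut_le_cut hE hG A).trans_lt ?_
    exact_mod_cast h1
  · by_contra hc
    have := card_add_two_le_cut hE hG hA hc
    omega
  · by_contra hc
    rw [Graph.deleteVerts, ← hcompl] at hc
    have := card_add_two_le_cut hE hG hA' hc
    rw [CubicWeight.cut_compl] at this
    omega

end

/-! ### From a matching to a 2-factor, and the conclusion. -/

/-- The edges of a perfect matching. -/
lemma exists_matching_edges {σ : V(G) → V(G)} (hinv : ∀ x, σ (σ x) = x)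
    (hadj : ∀ x : V(G), G.Adj (x : α) (σ x)) :
    ∃ f : V(G) → β, (∀ x : V(G), G.IsLink (f x) x (σ x)) ∧ ∀ x, f (σ x) = f x := by
  -- The edge is chosen for each unordered pair, so that the two ends of a matched pair select the
  -- same one of possibly several parallel edges.
  have h : ∀ s : {s : Sym2 V(G) // ∃ x, s(x, σ x) = s},
      ∃ i, ∀ x : V(G), s(x, σ x) = (s : Sym2 V(G)) → G.IsLink i x (σ x) := by
    rintro ⟨_, x, rfl⟩
    obtain ⟨i, hi⟩ := hadj x
    refine ⟨i, fun y hy => ?_⟩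
    rcases Sym2.eq_iff.1 hy with ⟨rfl, -⟩ | ⟨rfl, -⟩
    · exact hi
    · rw [hinv]
      exact hi.symm
  choose g hg using h
  refine ⟨fun x => g ⟨s(x, σ x), x, rfl⟩, fun x => hg _ x rfl,
    fun x => congrArg g (Subtype.ext ?_)⟩
  change s(σ x, σ (σ x)) = s(x, σ x)
  rw [hinv, Sym2.eq_swap]

section

variable {σ : V(G) → V(G)} {f : V(G) → β}

lemma eq_of_inc_matching (hf : ∀ x : V(G), G.IsLink (f x) x (σ x))
    (hf' : ∀ x, f (σ x) = f x) {x y : V(G)} (h : G.Inc (f y) x) : f y = f x := by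
  rcases h.eq_or_eq_of_isLink (hf y) with h | h
  · rw [Subtype.val_injective h]
  · rw [Subtype.val_injective h, hf']

/-- The complement of a perfect matching in a cubic graph is a `2`-factor. -/
lemma isFactor_deleteEdges (hG : IsCubic G) (hne : ∀ x, σ x ≠ x)
    (hf : ∀ x : V(G), G.IsLink (f x) x (σ x)) (hf' : ∀ x, f (σ x) = f x) :
    IsFactor 2 (G.deleteEdges (Set.range f)) G := by
  refine ⟨⟨Graph.deleteEdges_le, rfl⟩, fun x hx => ?_⟩
  have h1 : (G.deleteEdges (Set.range f)).loopSet x = G.loopSet x := by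
    ext i
    rw [Graph.mem_loopSet, Graph.mem_loopSet, Graph.deleteEdges_isLoopAt, and_iff_left_iff_imp]
    rintro h ⟨y, rfl⟩
    exact hne y (Subtype.val_injective ((h.eq_of_inc (hf y).inc_right).symm.trans
      (h.eq_of_inc (hf y).inc_left)))
  have h2 : (G.deleteEdges (Set.range f)).incidenceSet x = G.incidenceSet x \ {f ⟨x, hx⟩} := by
    ext i
    simp only [Graph.mem_incidenceSet, Graph.deleteEdges_inc, Set.mem_sdiff,
      Set.mem_singleton_iff, and_congr_right_iff, not_iff_not]
    intro h
    constructor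
    · rintro ⟨y, rfl⟩
      exact eq_of_inc_matching hf hf' (x := ⟨x, hx⟩) h
    · rintro rfl
      exact ⟨_, rfl⟩
  have h3 : f ⟨x, hx⟩ ∈ G.incidenceSet x := (hf ⟨x, hx⟩).inc_left
  have h4 : degree G x = 3 := hG x hx
  have h5 := Set.encard_sdiff_singleton_add_one h3
  rw [degree, ← h5] at h4
  rw [degree, h1, h2]
  have h6 : (G.incidenceSet x \ {f ⟨x, hx⟩}).encard + (G.loopSet x).encard + 1 = 2 + 1 := by
    rw [add_right_comm, h4]
    rfl
  exact ENat.add_left_injective_of_ne_top (by simp) h6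

end

/-- A `2`-regular subgraph of a `2`-regular graph contains all edges at its vertices. -/
lemma mem_edgeSet_of_inc {F C : Graph α β} {d : ℕ} (hF : IsRegular F d) (hC : IsRegular C d)
    (hle : C ≤ F) {x : α} (hx : x ∈ V(C)) {i : β} (hi : F.Inc i x) : i ∈ E(C) := by
  have h1 : C.incidenceSet x ⊆ F.incidenceSet x := fun j hj => Graph.Inc.mono hle hj
  have h2 : C.loopSet x ⊆ F.loopSet x := fun j hj => Graph.IsLoopAt.mono hle hj
  have h3 := hF x (hle.vertexSet_mono hx)
  have h4 := hC x hx
  have hfin : (F.incidenceSet x).encard ≠ ⊤ ∧ (F.loopSet x).encard ≠ ⊤ := by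
    rw [degree] at h3
    constructor <;> intro h <;> simp [h] at h3
  have hfinI := Set.encard_ne_top_iff.1 hfin.1
  have hfinL := Set.encard_ne_top_iff.1 hfin.2
  rw [degree, ← hfinI.cast_ncard_eq, ← hfinL.cast_ncard_eq] at h3
  rw [degree, ← (hfinI.subset h1).cast_ncard_eq, ← (hfinL.subset h2).cast_ncard_eq] at h4
  have h5 := Set.ncard_le_ncard h1 hfinI
  have h6 := Set.ncard_le_ncard h2 hfinL
  have h7 : (F.incidenceSet x).ncard + (F.loopSet x).ncard = d := by exact_mod_cast h3
  have h8 : (C.incidenceSet x).ncard + (C.loopSet x).ncard = d := by exact_mod_cast h4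
  have h9 : C.incidenceSet x = F.incidenceSet x :=
    Set.eq_of_subset_of_ncard_le h1 (by omega) hfinI
  have h10 : i ∈ C.incidenceSet x := h9 ▸ hi
  exact C.incidenceSet_subset_edgeSet x h10

end CircuitFactor

theorem corollary4 {α β : Type*} (G : Graph α β) (hfin : V(G).Finite)
    (hcubic : CircuitFactor.IsCubic G)
    (hconn : CircuitFactor.IsCyclicallyEdgeConnected G 7)
    (v : α) (hv : v ∈ V(G)) :
    ∃ F : Graph α β, CircuitFactor.IsFactor 2 F G ∧
      ¬ ∃ C : Graph α β, C ≤ F ∧ CircuitFactor.IsCircuit C ∧ v ∈ V(C) ∧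
        CircuitFactor.length C = 7 := by
  classical
  have hE := CircuitFactor.IsRegular.finite_edgeSet hcubic hfin
  let := hfin.fintype
  obtain ⟨σ, hσ, hclosed⟩ :=
    (CircuitFactor.cyclicSeven_cubicWeight hE hcubic hconn).exists_avoidsSeven ⟨v, hv⟩
  obtain ⟨f, hf, hf'⟩ := CircuitFactor.exists_matching_edges hσ.invol
    fun x : V(G) => (CircuitFactor.adj_cubicWeight hE hcubic).1 (hσ.pos x)
  have hF := CircuitFactor.isFactor_deleteEdges hcubic hσ.ne hf hf'
  refine ⟨_, hF, ?_⟩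
  rintro ⟨C, hCF, ⟨hCfin, -, hC⟩, hvC, hlen⟩
  have hCV : V(C) ⊆ V(G) := hCF.vertexSet_mono
  have h7 : V(C).ncard = 7 := by
    have h1 : E(C).ncard = 7 := by
      rw [Set.ncard, show E(C).encard = 7 from hlen]
      rfl
    have h2 := hC.mul_ncard_eq hCfin (hC.finite_edgeSet hCfin)
    omega
  -- A circuit of length 7 has 7 vertices, and by 2-regularity it contains all edges of the factor
  -- at its vertices, so its vertex set is closed in the required sense.
  refine hclosed (Finset.univ.filter fun x => (x : α) ∈ V(C)) (by simpa using hvC) ?_ ?_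
  · rw [← h7, ← Set.ncard_coe_finset, ← Set.ncard_image_of_injective _ Subtype.val_injective]
    congr 1
    ext x
    simp only [Finset.coe_filter, Finset.mem_univ, true_and, Set.mem_image, Set.mem_ofPred_eq]
    exact ⟨by rintro ⟨x, hx, rfl⟩; exact hx, fun hx => ⟨⟨x, hCV hx⟩, hx, rfl⟩⟩
  · intro x hx y hxy hne
    simp only [Finset.mem_filter, Finset.mem_univ, true_and] at hx ⊢
    obtain ⟨i, hi⟩ := (CircuitFactor.adj_cubicWeight hE hcubic).1 hxy
    have hiF : (G.deleteEdges (Set.range f)).IsLink i x y := by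
      rw [Graph.deleteEdges_isLink]
      refine ⟨hi, ?_⟩
      rintro ⟨z, rfl⟩
      rw [CircuitFactor.eq_of_inc_matching hf hf' hi.inc_left] at hi
      exact hne (Subtype.val_injective (hi.right_unique (hf x)))
    have hiC := CircuitFactor.mem_edgeSet_of_inc hF.2 hC hCF hx hiF.inc_left
    exact ((hCF.isLink_iff hiC).2 hiF).right_mem
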